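/- Let $k$ be a commutative ring and let $d,n\ge 1$ be integers. Let $\Gamma^d\mathsf P_k$ be the category whose objects are the finitely generated projective $k$-modules and whose morphisms $V\to W$ are the elements of $\Gamma^d\operatorname{Hom}(V,W)=(\operatorname{Hom}(V,W)^{\otimes d})^{\mathfrak S_d}$, composed factorwise, and let $\operatorname{Rep}\Gamma^d_k$ be the category of $k$-linear functors from $\Gamma^d\mathsf P_k$ to $k$-modules. Write $\Gamma^{d,V}=\operatorname{Hom}_{\Gamma^d\mathsf P_k}(V,-)$. The internal tensor product and the internal Hom of $\operatorname{Rep}\Gamma^d_k$ are $$X\otimes_{\Gamma^d_k}Y=\operatorname{colim}_{\Gamma^{d,V}\to X}\ \operatorname{colim}_{\Gamma^{d,W}\to Y}\ \Gamma^{d,V\otimes W},\qquad \mathcal Hom_{\Gamma^d_k}(X,Y)=\lim_{\Gamma^{d,V}\to X}\ \operatorname{colim}_{\Gamma^{d,W}\to Y}\ \Gamma^{d,\operatorname{Hom}(V,W)}.$$ Let $\Lambda(n,d)$ be the set of sequences $\lambda=(\lambda_1,\dots,\lambda_n)$ of non-negative integers with $\sum_i\lambda_i=d$. For such $\lambda$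 let $\Gamma^\lambda=\Gamma^{\lambda_1}\otimes\cdots\otimes\Gamma^{\lambda_n}$, $\Lambda^\lambda=\Lambda^{\lambda_1}\otimes\cdots\otimes\Lambda^{\lambda_n}$ and $S^\lambda=S^{\lambda_1}\otimes\cdots\otimes S^{\lambda_n}$ be the external tensor products (formed pointwise, with $\Gamma^d\operatorname{Hom}(V,W)$ acting through the canonical map $\Gamma^d\operatorname{Hom}(V,W)\to\bigotimes_i\Gamma^{\lambda_i}\operatorname{Hom}(V,W)$) of the divided powers $\Gamma^eV=(V^{\otimes e})^{\mathfrak S_e}$, of the exterior powers $\Lambda^eV$, and of the symmetric powers $S^eV=(V^{\otimes e})_{\mathfrak S_e}$. For a set $\mathsf C$ of objects of $\operatorname{Rep}\Gamma^d_k$ let $\operatorname{add}\mathsf C$ be the full subcategory of all direct summands of finite direct sums of objects in $\mathsf C$. Then the functor $\Lambda^d\otimes_{\Gamma^d_k}-$ restricts to equivalences of categories $$\operatorname{add}\{\Gamma^\lambda\mid\lambda\in\Lambda(n,d)\}\xrightarrow{\ \sim\ }\operatorname{add}\{\Lambda^\lambda\mid\lambda\in\Lambda(n,d)\},\qquad \operatorname{add}\{\Lambda^\lambda\mid\lambda\in\Lambda(n,d)\}\xrightarrow{\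 \sim\ }\operatorname{add}\{S^\lambda\mid\lambda\in\Lambda(n,d)\},$$ and in both cases the functor $\mathcal Hom_{\Gamma^d_k}(\Lambda^d,-)$ restricts to a quasi-inverse. -/

import Mathlib

open CategoryTheory CategoryTheory.Limits Opposite
open scoped TensorProduct

set_option linter.unusedSectionVars false

universe u

noncomputable section

namespace StrictPoly

section LinearAlgebra

variable (k : Type u) [CommRing k] (ι : Type) (M N P Q : Type u)
  [AddCommGroup M] [Module k M] [AddCommGroup N] [Module k N] [AddCommGroup P] [Module k P]
  [AddCommGroup Q] [Module k Q]

/-- The tensor power `M^{⊗ι}`, as a module over `k`. -/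
abbrev TPow : Type u := ⨂[k] (_ : ι), M

variable {ι} in
/-- The action of a permutation of `ι` on `M^{⊗ι}` by permuting the factors. -/
def permute (σ : Equiv.Perm ι) : TPow k ι M →ₗ[k] TPow k ι M :=
  (PiTensorProduct.reindex k (fun _ : ι => M) σ).toLinearMap

/-- The module `Γ^ι M` of divided powers: the tensors in `M^{⊗ι}` that are invariant under all
permutations of the factors. For `ι = Fin d` this is `Γ^d M`. -/
def Gam : Submodule k (TPow k ι M) where
  carrier := {t | ∀ σ : Equiv.Perm ι, permute k M σ t = t}
  add_mem' ha hb σ := by rw [map_add, ha σ, hb σ]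
  zero_mem' σ := map_zero _
  smul_mem' c x hx σ := by rw [map_smul, hx σ]

variable {k M N P Q ι}

@[simp] lemma permute_tprod (σ : Equiv.Perm ι) (x : ι → M) :
    permute k M σ (PiTensorProduct.tprod k x) = PiTensorProduct.tprod k fun i => x (σ.symm i) :=
  PiTensorProduct.reindex_tprod σ x

lemma mem_Gam {t : TPow k ι M} : t ∈ Gam k ι M ↔ ∀ σ : Equiv.Perm ι, permute k M σ t = t :=
  Iff.rfl

lemma tind {κ : Type*} {X : κ → Type*} [∀ i, AddCommGroup (X i)] [∀ i, Module k (X i)]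
    {p : (⨂[k] i, X i) → Prop}
    (z : ⨂[k] i, X i) (tp : ∀ x : ∀ i, X i, p (PiTensorProduct.tprod k x))
    (smul : ∀ (c : k) x, p x → p (c • x)) (add : ∀ x y, p x → p y → p (x + y)) : p z :=
  PiTensorProduct.induction_on z (fun c x => smul c _ (tp x)) add

variable (ι) in
/-- The map `M^{⊗ι} → N^{⊗ι}` induced by `f : M → N`. -/
def tmap (f : M →ₗ[k] N) : TPow k ι M →ₗ[k] TPow k ι N := PiTensorProduct.map fun _ => f

@[simp] lemma tmap_tprod (f : M →ₗ[k] N) (x : ι → M) :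
    tmap ι f (PiTensorProduct.tprod k x) = PiTensorProduct.tprod k fun i => f (x i) :=
  PiTensorProduct.map_tprod _ _

lemma tmap_permute (f : M →ₗ[k] N) (σ : Equiv.Perm ι) (t : TPow k ι M) :
    tmap ι f (permute k M σ t) = permute k N σ (tmap ι f t) := by
  induction t using tind with
  | tp x => simp
  | smul c x h => simp [h]
  | add x y h h' => simp [h, h']

lemma tmap_mem {f : M →ₗ[k] N} {t : TPow k ι M} (ht : t ∈ Gam k ι M) :
    tmap ι f t ∈ Gam k ι N := fun σ => by rw [← tmap_permute, ht σ]

lemma tmap_tmap (g : N →ₗ[k] P) (f : M →ₗ[k] N) (t : TPow k ι M) :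
    tmap ι g (tmap ι f t) = tmap ι (g ∘ₗ f) t := by
  induction t using tind with
  | tp x => simp
  | smul c x h => simp [h]
  | add x y h h' => simp [h, h']

lemma tmap_id (t : TPow k ι M) : tmap ι (LinearMap.id : M →ₗ[k] M) t = t := by
  induction t using tind with
  | tp x => simp
  | smul c x h => simp [h]
  | add x y h h' => simp [h, h']

variable (ι) in
/-- The bilinear map `M^{⊗ι} × N^{⊗ι} → P^{⊗ι}` applying a bilinear map `B` in each factor. -/
def tmap₂ (B : M →ₗ[k] N →ₗ[k] P) : TPow k ι M →ₗ[k] TPow k ι N →ₗ[k] TPow k ι P :=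
  PiTensorProduct.map₂ fun _ => B

@[simp] lemma tmap₂_tprod (B : M →ₗ[k] N →ₗ[k] P) (x : ι → M) (y : ι → N) :
    tmap₂ ι B (PiTensorProduct.tprod k x) (PiTensorProduct.tprod k y) =
      PiTensorProduct.tprod k fun i => B (x i) (y i) :=
  PiTensorProduct.map₂_tprod_tprod _ _ _

lemma tmap₂_permute (B : M →ₗ[k] N →ₗ[k] P) (σ : Equiv.Perm ι) (s : TPow k ι M)
    (t : TPow k ι N) :
    tmap₂ ι B (permute k M σ s) (permute k N σ t) = permute k P σ (tmap₂ ι B s t) := by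
  induction s using tind with
  | tp x =>
    induction t using tind with
    | tp y => simp
    | smul c x h => simp only [map_smul, h]
    | add x y h h' => simp only [map_add, h, h']
  | smul c x h => simp only [map_smul, LinearMap.smul_apply, h]
  | add x y h h' => simp only [map_add, LinearMap.add_apply, h, h']

lemma tmap₂_mem (B : M →ₗ[k] N →ₗ[k] P) {s : TPow k ι M} {t : TPow k ι N}
    (hs : s ∈ Gam k ι M) (ht : t ∈ Gam k ι N) : tmap₂ ι B s t ∈ Gam k ι P := fun σ => by
  rw [← tmap₂_permute, hs σ, ht σ]

variable (ι) in
/-- The bilinear map `Γ^ι M × Γ^ι N → Γ^ι P` induced by a bilinear map `M × N → P`. -/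
def gmap₂ (B : M →ₗ[k] N →ₗ[k] P) : Gam k ι M →ₗ[k] Gam k ι N →ₗ[k] Gam k ι P :=
  LinearMap.mk₂ k (fun s t => ⟨tmap₂ ι B s t, tmap₂_mem B s.2 t.2⟩)
    (fun _ _ _ => by ext; simp) (fun _ _ _ => by ext; simp)
    (fun _ _ _ => by ext; simp) (fun _ _ _ => by ext; simp)

@[simp] lemma coe_gmap₂ (B : M →ₗ[k] N →ₗ[k] P) (s : Gam k ι M) (t : Gam k ι N) :
    (gmap₂ ι B s t : TPow k ι P) = tmap₂ ι B (s : TPow k ι M) (t : TPow k ι N) := rfl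

/-- The diagonal element `m ⊗ ⋯ ⊗ m` of `Γ^ι M`. -/
def diag (ι : Type) (m : M) : Gam k ι M := ⟨PiTensorProduct.tprod k fun _ => m, fun σ => by simp⟩

@[simp] lemma coe_diag (m : M) :
    (diag ι m : Gam k ι M) = (PiTensorProduct.tprod k fun _ : ι => m : TPow k ι M) := rfl

/-! ### Symmetric tensors over a projective module -/

section Sym

/-- The relation on multi-indices of being permutations of each other. -/
def permSetoid (ι I : Type) : Setoid (ι → I) where
  r x y := ∃ σ : Equiv.Perm ι, y = x ∘ σ
  iseqv := ⟨fun x => ⟨1, rfl⟩, fun {x y} ⟨σ, h⟩ => ⟨σ.symm, by subst h; ext; simp⟩,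
    fun {x y z} ⟨σ, h⟩ ⟨τ, h'⟩ => ⟨τ.trans σ, by subst h; subst h'; rfl⟩⟩

/-- A representative of the class of a multi-index up to permutation. -/
def rep {ι I : Type} (x : ι → I) : ι → I := (Quotient.mk (permSetoid ι I) x).out

lemma rep_spec {ι I : Type} (x : ι → I) : ∃ σ : Equiv.Perm ι, rep x = x ∘ σ := by
  obtain ⟨σ, h⟩ := Quotient.exact (Quotient.out_eq (Quotient.mk (permSetoid ι I) x))
  refine ⟨σ.symm, ?_⟩
  funext a
  have := congrFun h (σ.symm a)
  simp only [Function.comp_apply, Equiv.apply_symm_apply] at this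
  exact this.symm

lemma rep_comp {ι I : Type} (x : ι → I) (σ : Equiv.Perm ι) : rep (x ∘ σ) = rep x :=
  congrArg Quotient.out (Quotient.sound (s := permSetoid ι I) ⟨σ.symm, by ext; simp⟩)

variable [Fintype ι] {I : Type} [Fintype I] (b : Module.Basis I k M)

/-- The basis of `M^{⊗ι}` given by a basis of `M`. -/
def tbasis (ι : Type) [Fintype ι] : Module.Basis (ι → I) k (TPow k ι M) :=
  Basis.piTensorProduct fun _ : ι => b

lemma tbasis_apply (x : ι → I) :
    tbasis b ι x = PiTensorProduct.tprod k fun i => b (x i) :=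
  Basis.piTensorProduct_apply _ _

lemma tbasis_repr_permute (σ : Equiv.Perm ι) (t : TPow k ι M) (x : ι → I) :
    (tbasis b ι).repr (permute k M σ t) x = (tbasis b ι).repr t (x ∘ σ) := by
  induction t using tind with
  | tp y =>
    simp only [permute_tprod, tbasis, Basis.piTensorProduct_repr_tprod_apply, Function.comp_apply]
    exact Fintype.prod_equiv σ.symm _ _ fun i => by simp
  | smul c x h => simp [h]
  | add x y h h' => simp [h, h']

lemma tbasis_repr_comp {t : TPow k ι M} (ht : t ∈ Gam k ι M) (σ : Equiv.Perm ι) (x : ι → I) :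
    (tbasis b ι).repr t (x ∘ σ) = (tbasis b ι).repr t x := by
  rw [← tbasis_repr_permute, ht σ]

open Classical in
/-- An auxiliary projection of `M^{⊗ι}` onto `Γ^ι M`, for `M` free with basis `b`. -/
def freeSym (ι : Type) [Fintype ι] : TPow k ι M →ₗ[k] TPow k ι M :=
  (tbasis b ι).constr k fun y => ∑ z : ι → I, if rep z = y then tbasis b ι z else 0

open Classical in
lemma freeSym_apply (y : ι → I) :
    freeSym b ι (tbasis b ι y) = ∑ z : ι → I, if rep z = y then tbasis b ι z else 0 := by
  simp [freeSym]

lemma freeSym_mem (t : TPow k ι M) : freeSym b ι t ∈ Gam k ι M := by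
  classical
  intro σ
  suffices h : permute k M σ ∘ₗ freeSym b ι = freeSym b ι from LinearMap.congr_fun h t
  refine (tbasis b ι).ext fun y => ?_
  simp only [LinearMap.comp_apply, freeSym_apply, map_sum]
  refine Fintype.sum_equiv (Equiv.arrowCongr σ (Equiv.refl I)) _ _ fun z => ?_
  have h1 : (Equiv.arrowCongr σ (Equiv.refl I)) z = z ∘ σ.symm := by ext; simp
  rw [h1, rep_comp]
  split_ifs
  · simp [tbasis_apply]
  · simp

lemma freeSym_fix {t : TPow k ι M} (ht : t ∈ Gam k ι M) : freeSym b ι t = t := by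
  classical
  conv_lhs => rw [← (tbasis b ι).sum_repr t]
  conv_rhs => rw [← (tbasis b ι).sum_repr t]
  simp only [map_sum, map_smul, freeSym_apply, Finset.smul_sum]
  rw [Finset.sum_comm]
  refine Finset.sum_congr rfl fun z _ => ?_
  simp only [smul_ite, smul_zero, Finset.sum_ite_eq, Finset.mem_univ, if_true]
  obtain ⟨σ, h⟩ := rep_spec z
  rw [h, tbasis_repr_comp b ht]

end Sym

section Blocks

variable {J : Type} {κ : J → Type}

lemma blocks_update [DecidableEq J] [DecidableEq ι] (e : (Σ j, κ j) ≃ ι) (x : ι → M)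
    (j : J) (a : κ j) (v : M) :
    (fun j' => PiTensorProduct.tprod k fun a' : κ j' => Function.update x (e ⟨j, a⟩) v (e ⟨j', a'⟩)) =
      Function.update (fun j' => PiTensorProduct.tprod k fun a' : κ j' => x (e ⟨j', a'⟩)) j
        (PiTensorProduct.tprod k (by
          classical exact Function.update (fun a' : κ j => x (e ⟨j, a'⟩)) a v)) := by
  classical
  funext j'
  by_cases h : j' = j
  · subst h
    simp only [Function.update_self]
    congr 1
    funext a'
    by_cases h' : a' = a
    · subst h'; simp
    · rw [Function.update_of_ne h', Function.update_of_ne]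
      simpa using h'
  · rw [Function.update_of_ne h]
    congr 1
    funext a'
    rw [Function.update_of_ne]
    intro h'
    exact h (congrArg Sigma.fst (e.injective h'))

/-- Grouping the factors of a tensor: for `e : (Σ j, κ j) ≃ ι` this is the canonical isomorphism
`M^{⊗ι} ≅ ⨂ⱼ M^{⊗κⱼ}`. -/
def blocks (M : Type u) [AddCommGroup M] [Module k M] (e : (Σ j, κ j) ≃ ι) :
    TPow k ι M →ₗ[k] ⨂[k] j, TPow k (κ j) M :=
  PiTensorProduct.lift
    { toFun := fun x => PiTensorProduct.tprod k fun j =>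
        PiTensorProduct.tprod k fun a : κ j => x (e ⟨j, a⟩)
      map_update_add' := by
        classical
        intro _ x i v w
        obtain ⟨⟨j, a⟩, rfl⟩ := e.surjective i
        convert_to PiTensorProduct.tprod k _ = PiTensorProduct.tprod k _ + PiTensorProduct.tprod k _
        rw [blocks_update, blocks_update, blocks_update]
        rw [MultilinearMap.map_update_add, MultilinearMap.map_update_add]
      map_update_smul' := by
        classical
        intro _ x i c v
        obtain ⟨⟨j, a⟩, rfl⟩ := e.surjective i
        convert_to PiTensorProduct.tprod k _ = c • PiTensorProduct.tprod k _
        rw [blocks_update, blocks_update]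
        rw [MultilinearMap.map_update_smul, MultilinearMap.map_update_smul] }

@[simp] lemma blocks_tprod (e : (Σ j, κ j) ≃ ι) (x : ι → M) :
    blocks M e (PiTensorProduct.tprod k x) =
      PiTensorProduct.tprod k fun j => PiTensorProduct.tprod k fun a : κ j => x (e ⟨j, a⟩) :=
  PiTensorProduct.lift.tprod _

lemma blocks_tmap (e : (Σ j, κ j) ≃ ι) (f : M →ₗ[k] N) (t : TPow k ι M) :
    blocks N e (tmap ι f t) = PiTensorProduct.map (fun j => tmap (κ j) f) (blocks M e t) := by
  induction t using tind with
  | tp x => simp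
  | smul c x h => simp [h]
  | add x y h h' => simp [h, h']

variable [Fintype ι] [Fintype J] [∀ j, Fintype (κ j)]

lemma map_freeSym_blocks {I : Type} [Fintype I] (b : Module.Basis I k M) (e : (Σ j, κ j) ≃ ι)
    {t : TPow k ι M} (ht : t ∈ Gam k ι M) :
    PiTensorProduct.map (fun j => freeSym b (κ j)) (blocks M e t) = blocks M e t := by
  classical
  let E : (∀ j, κ j → I) ≃ (ι → I) :=
    (Equiv.piCurry fun (j : J) (_ : κ j) => I).symm.trans (Equiv.arrowCongr e (Equiv.refl I))
  have hE : ∀ z j a, E z (e ⟨j, a⟩) = z j a := fun z j a =>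
    congrArg (fun p : Σ j, κ j => z p.1 p.2) (e.symm_apply_apply ⟨j, a⟩)
  have hb : ∀ z, blocks M e (tbasis b ι (E z)) =
      PiTensorProduct.tprod k fun j => tbasis b (κ j) (z j) := fun z => by
    simp [tbasis_apply, hE]
  have key : t = ∑ z, (tbasis b ι).repr t (E z) • tbasis b ι (E z) := by
    conv_lhs => rw [← (tbasis b ι).sum_repr t]
    exact (Equiv.sum_comp E fun x => (tbasis b ι).repr t x • tbasis b ι x).symm
  have hc : ∀ z : ∀ j, κ j → I, (tbasis b ι).repr t (E fun j => rep (z j)) =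
      (tbasis b ι).repr t (E z) := fun z => by
    choose σ hσ using fun j => rep_spec (z j)
    rw [← tbasis_repr_comp b ht (e.permCongr (Equiv.sigmaCongrRight σ)) (E z)]
    congr 1
    funext i
    obtain ⟨⟨j, a⟩, rfl⟩ := e.surjective i
    simp [hE, hσ]
  conv_lhs => rw [key]
  conv_rhs => rw [key]
  simp only [map_sum, map_smul, hb, PiTensorProduct.map_tprod, freeSym_apply,
    MultilinearMap.map_sum, Finset.smul_sum]
  rw [Finset.sum_comm]
  refine Finset.sum_congr rfl fun z _ => ?_
  rw [Finset.sum_eq_single (fun j => rep (z j))]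
  · simp [hc]
  · intro y _ hy
    obtain ⟨j, hj⟩ := Function.ne_iff.mp hy
    rw [MultilinearMap.map_coord_zero _ j, smul_zero]
    rw [if_neg]
    exact fun h => hj h.symm
  · simp

variable [Module.Finite k M] [Module.Projective k M]

lemma exists_sym (k : Type u) [CommRing k] (M : Type u) [AddCommGroup M] [Module k M]
    [Module.Finite k M] [Module.Projective k M]
    (κ : J → Type) [∀ j, Fintype (κ j)] :
    ∃ ρ : ∀ j, TPow k (κ j) M →ₗ[k] Gam k (κ j) M,
      (∀ j (t : Gam k (κ j) M), ρ j t = t) ∧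
      ∀ (ι : Type) [Fintype ι] (e : (Σ j, κ j) ≃ ι) (t : TPow k ι M), t ∈ Gam k ι M →
        PiTensorProduct.map (fun j => (Gam k (κ j) M).subtype ∘ₗ ρ j) (blocks M e t) =
          blocks M e t := by
  obtain ⟨n, p, s, -, -, h⟩ := Module.Finite.exists_comp_eq_id_of_projective k M
  let b := Pi.basisFun k (Fin n)
  have hps : ∀ (ι : Type) (t : TPow k ι M), tmap ι p (tmap ι s t) = t := fun ι t => by
    rw [tmap_tmap, h, tmap_id]
  refine ⟨fun j => ((tmap (κ j) p) ∘ₗ freeSym b (κ j) ∘ₗ tmap (κ j) s).codRestrict _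
    fun t => tmap_mem (freeSym_mem _ _), fun j t => ?_, fun ι _ e t ht => ?_⟩
  · ext
    simp only [LinearMap.codRestrict_apply, LinearMap.comp_apply]
    rw [freeSym_fix _ (tmap_mem t.2), hps]
  · simp only [LinearMap.subtype_comp_codRestrict]
    rw [PiTensorProduct.map_comp, PiTensorProduct.map_comp, LinearMap.comp_apply,
      LinearMap.comp_apply, ← blocks_tmap, map_freeSym_blocks b e (tmap_mem ht), ← blocks_tmap, hps]

lemma mapIncl_injective :
    Function.Injective (PiTensorProduct.mapIncl fun j => Gam k (κ j) M) := by
  obtain ⟨ρ, h, -⟩ := exists_sym k M κ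
  refine Function.LeftInverse.injective (g := PiTensorProduct.map ρ) fun x => ?_
  rw [PiTensorProduct.mapIncl, ← LinearMap.comp_apply, ← PiTensorProduct.map_comp]
  have : (fun j => ρ j ∘ₗ (Gam k (κ j) M).subtype) = fun j => LinearMap.id := by
    funext j; ext t; simp [h]
  rw [this, PiTensorProduct.map_id, LinearMap.id_apply]

lemma blocks_mem_range (e : (Σ j, κ j) ≃ ι) (t : Gam k ι M) :
    blocks M e (t : TPow k ι M) ∈
      LinearMap.range (PiTensorProduct.mapIncl fun j => Gam k (κ j) M) := by
  obtain ⟨ρ, -, h⟩ := exists_sym k M κ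
  refine ⟨PiTensorProduct.map ρ (blocks M e t), ?_⟩
  rw [PiTensorProduct.mapIncl, ← LinearMap.comp_apply, ← PiTensorProduct.map_comp]
  exact h ι e t t.2

/-- The canonical map `Γ^ι M → ⨂ⱼ Γ^{κⱼ} M` for a finitely generated projective module `M`: the
inclusion of `Γ^ι M` into the tensors in `M^{⊗ι} ≅ ⨂ⱼ M^{⊗κⱼ}` that are invariant under the
product of the symmetric groups of the `κⱼ`, which form the submodule `⨂ⱼ Γ^{κⱼ} M`. -/
def comul (M : Type u) [AddCommGroup M] [Module k M] [Module.Finite k M] [Module.Projective k M]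
    (e : (Σ j, κ j) ≃ ι) : Gam k ι M →ₗ[k] ⨂[k] j, Gam k (κ j) M :=
  (LinearEquiv.ofInjective (PiTensorProduct.mapIncl fun j => Gam k (κ j) M)
    mapIncl_injective).symm.toLinearMap ∘ₗ
      (blocks M e ∘ₗ (Gam k ι M).subtype).codRestrict _ (blocks_mem_range e)

lemma mapIncl_comul (e : (Σ j, κ j) ≃ ι) (t : Gam k ι M) :
    PiTensorProduct.mapIncl (fun j => Gam k (κ j) M) (comul M e t) = blocks M e t := by
  have := LinearEquiv.apply_symm_apply
    (LinearEquiv.ofInjective (PiTensorProduct.mapIncl fun j => Gam k (κ j) M) mapIncl_injective)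
    ((blocks M e ∘ₗ (Gam k ι M).subtype).codRestrict _ (blocks_mem_range e) t)
  exact congrArg Subtype.val this

end Blocks
section Exterior

variable {d : ℕ}

variable (k d M) in
/-- The quotient map `M^{⊗d} → Λ^d M`. -/
def toExt : TPow k (Fin d) M →ₗ[k] ⋀[k]^d M :=
  PiTensorProduct.lift (exteriorPower.ιMulti k d).toMultilinearMap

@[simp] lemma toExt_tprod (x : Fin d → M) :
    toExt k M d (PiTensorProduct.tprod k x) = exteriorPower.ιMulti k d x :=
  PiTensorProduct.lift.tprod _

lemma toExt_tmap (f : M →ₗ[k] N) (t : TPow k (Fin d) M) :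
    toExt k N d (tmap _ f t) = exteriorPower.map d f (toExt k M d t) := by
  induction t using tind with
  | tp x => simp [Function.comp_def]
  | smul c x h => simp only [map_smul, h]
  | add x y h h' => simp only [map_add, h, h']

/-- A tensor which is invariant under a transposition vanishes in the exterior power. -/
lemma toExt_eq_zero [Module.Finite k M] [Module.Projective k M] {i j : Fin d} (hij : i ≠ j)
    {t : TPow k (Fin d) M} (ht : permute k M (Equiv.swap i j) t = t) : toExt k M d t = 0 := by
  classical
  obtain ⟨n, p, s, -, -, h⟩ := Module.Finite.exists_comp_eq_id_of_projective k M
  let b := Pi.basisFun k (Fin n)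
  have key : toExt k _ d (tmap _ s t) = 0 := by
    set u := tmap (Fin d) s t with hu
    have hu' : permute k _ (Equiv.swap i j) u = u := by rw [hu, ← tmap_permute, ht]
    rw [← (tbasis b (Fin d)).sum_repr u]
    simp only [map_sum, map_smul, tbasis_apply, toExt_tprod]
    refine Finset.sum_involution (fun x _ => x ∘ Equiv.swap i j) (fun x _ => ?_)
      (fun x _ hx h' => hx ?_) (fun _ _ => Finset.mem_univ _) (fun x _ => by ext; simp)
    · rw [← tbasis_repr_permute, hu', ← smul_add]
      have := AlternatingMap.map_swap (exteriorPower.ιMulti k d) (fun a => b (x a)) hij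
      rw [show (fun a => b ((x ∘ Equiv.swap i j) a)) = (fun a => b (x a)) ∘ Equiv.swap i j from rfl,
        this]
      simp
    · have : x i = x j := by simpa using (congrFun h' j)
      rw [AlternatingMap.map_eq_zero_of_eq _ _ (by rw [this]) hij, smul_zero]
  have := toExt_tmap p (tmap (Fin d) s t)
  rwa [key, map_zero, tmap_tmap, h, tmap_id] at this

end Exterior

section Action

variable {d : ℕ}

variable (k M N ι) in
/-- The action `Hom(M, N)^{⊗ι} × M^{⊗ι} → N^{⊗ι}`. -/
def act : TPow k ι (M →ₗ[k] N) →ₗ[k] TPow k ι M →ₗ[k] TPow k ι N := tmap₂ ι LinearMap.id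

@[simp] lemma act_tprod (f : ι → M →ₗ[k] N) (x : ι → M) :
    act k ι M N (PiTensorProduct.tprod k f) (PiTensorProduct.tprod k x) =
      PiTensorProduct.tprod k fun i => f i (x i) :=
  tmap₂_tprod _ _ _

lemma act_permute {f : TPow k ι (M →ₗ[k] N)} (hf : f ∈ Gam k ι (M →ₗ[k] N)) (σ : Equiv.Perm ι)
    (t : TPow k ι M) : act k ι M N f (permute k M σ t) = permute k N σ (act k ι M N f t) := by
  rw [act, ← tmap₂_permute, hf σ]

variable (k M N P) in
/-- Composition of linear maps as a bilinear map, the first map first. -/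
def compB : (M →ₗ[k] N) →ₗ[k] (N →ₗ[k] P) →ₗ[k] (M →ₗ[k] P) := (LinearMap.llcomp k M N P).flip

@[simp] lemma compB_apply (f : M →ₗ[k] N) (g : N →ₗ[k] P) : compB k M N P f g = g ∘ₗ f := rfl

lemma tind₂ {κ κ' : Type*} {X : κ → Type*} [∀ i, AddCommGroup (X i)] [∀ i, Module k (X i)]
    {Y : κ' → Type*} [∀ i, AddCommGroup (Y i)] [∀ i, Module k (Y i)] {E : Type*} [AddCommGroup E]
    [Module k E]
    {f g : (⨂[k] i, X i) →ₗ[k] (⨂[k] i, Y i) →ₗ[k] E}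
    (h : ∀ x y, f (PiTensorProduct.tprod k x) (PiTensorProduct.tprod k y) =
      g (PiTensorProduct.tprod k x) (PiTensorProduct.tprod k y)) : f = g := by
  refine PiTensorProduct.ext (MultilinearMap.ext fun x => PiTensorProduct.ext
    (MultilinearMap.ext fun y => h x y))

lemma act_comp (f : TPow k ι (M →ₗ[k] N)) (g : TPow k ι (N →ₗ[k] P)) (t : TPow k ι M) :
    act k ι M P (tmap₂ ι (compB k M N P) f g) t = act k ι N P g (act k ι M N f t) := by
  induction f using tind with
  | tp f =>
    induction g using tind with
    | tp g =>
      induction t using tind with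
      | tp x => simp
      | smul c x h => simp only [map_smul, h]
      | add x y h h' => simp only [map_add, h, h']
    | smul c x h => simp only [map_smul, LinearMap.smul_apply, h]
    | add x y h h' => simp only [map_add, LinearMap.add_apply, h, h']
  | smul c x h => simp only [map_smul, LinearMap.smul_apply, h]
  | add x y h h' => simp only [map_add, LinearMap.add_apply, h, h']

lemma act_id (t : TPow k ι M) :
    act k ι M M (PiTensorProduct.tprod k fun _ => LinearMap.id) t = t := by
  induction t using tind with
  | tp x => simp
  | smul c x h => simp only [map_smul, h]
  | add x y h h' => simp only [map_add, h, h']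

end Action

end LinearAlgebra

/-! ### The category of divided powers -/

/-- A finitely generated projective `k`-module. -/
structure FinProj (k : Type u) [CommRing k] : Type (u + 1) where
  /-- The underlying module. -/
  carrier : Type u
  [group : AddCommGroup carrier]
  [module : Module k carrier]
  [finite : Module.Finite k carrier]
  [projective : Module.Projective k carrier]

attribute [instance] FinProj.group FinProj.module FinProj.finite FinProj.projective

instance (k : Type u) [CommRing k] : CoeSort (FinProj k) (Type u) := ⟨FinProj.carrier⟩

section HomProj

variable (k : Type u) [CommRing k] (M N : Type u) [AddCommGroup M] [Module k M]
  [AddCommGroup N] [Module k N] [Module.Finite k M] [Module.Projective k M] [Module.Finite k N]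
  [Module.Projective k N]

lemma exists_retract_hom : ∃ (m n : ℕ)
    (p : ((Fin m → k) →ₗ[k] (Fin n → k)) →ₗ[k] (M →ₗ[k] N))
    (s : (M →ₗ[k] N) →ₗ[k] ((Fin m → k) →ₗ[k] (Fin n → k))), p ∘ₗ s = LinearMap.id := by
  obtain ⟨m, p, s, -, -, h⟩ := Module.Finite.exists_comp_eq_id_of_projective k M
  obtain ⟨n, p', s', -, -, h'⟩ := Module.Finite.exists_comp_eq_id_of_projective k N
  refine ⟨m, n, LinearMap.lcomp k N s ∘ₗ LinearMap.llcomp k _ _ _ p',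
    LinearMap.lcomp k _ p ∘ₗ LinearMap.llcomp k _ _ _ s', ?_⟩
  ext f x
  have h1 := LinearMap.congr_fun h x
  have h2 := LinearMap.congr_fun h' (f x)
  simp only [LinearMap.comp_apply, LinearMap.id_apply] at h1 h2
  simp [h1, h2]

instance finite_hom : Module.Finite k (M →ₗ[k] N) := by
  obtain ⟨m, n, p, s, h⟩ := exists_retract_hom k M N
  exact Module.Finite.of_surjective p fun x => ⟨s x, LinearMap.congr_fun h x⟩

instance projective_hom : Module.Projective k (M →ₗ[k] N) := by
  obtain ⟨m, n, p, s, h⟩ := exists_retract_hom k M N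
  exact Module.Projective.of_split s p h

end HomProj

/-- The category `Γ^d P_k` of divided powers of degree `d`: its objects are the finitely generated
projective `k`-modules. -/
structure DivPow (k : Type u) [CommRing k] (d : ℕ) : Type (u + 1) where
  /-- The underlying finitely generated projective module. -/
  as : FinProj k

variable (k : Type u) [CommRing k] (d : ℕ)

/-- Morphisms `V ⟶ W` are the elements of `Γ^d Hom(V, W)`; composition is composition of linear
maps in each tensor factor. -/
instance : Category (DivPow k d) where
  Hom V W := Gam k (Fin d) (V.as →ₗ[k] W.as)
  id V := diag (Fin d) LinearMap.id
  comp {U V W} f g := gmap₂ (Fin d) (compB k U.as V.as W.as) f g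
  id_comp {V W} f := by
    refine Subtype.ext ?_
    rw [coe_gmap₂, coe_diag]
    generalize (f : TPow k (Fin d) (V.as →ₗ[k] W.as)) = t
    induction t using tind with
    | tp x => simp
    | smul c x h => simp only [map_smul, h]
    | add x y h h' => simp only [map_add, h, h']
  comp_id {V W} f := by
    refine Subtype.ext ?_
    rw [coe_gmap₂, coe_diag]
    generalize (f : TPow k (Fin d) (V.as →ₗ[k] W.as)) = t
    induction t using tind with
    | tp x => simp
    | smul c x h => simp only [map_smul, LinearMap.smul_apply, h]
    | add x y h h' => simp only [map_add, LinearMap.add_apply, h, h']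
  assoc {U V W X} f g h := by
    refine Subtype.ext ?_
    simp only [coe_gmap₂]
    generalize (f : TPow k (Fin d) (U.as →ₗ[k] V.as)) = f
    generalize (g : TPow k (Fin d) (V.as →ₗ[k] W.as)) = g
    generalize (h : TPow k (Fin d) (W.as →ₗ[k] X.as)) = h
    induction f using tind with
    | tp f =>
      induction g using tind with
      | tp g =>
        induction h using tind with
        | tp x => simp [LinearMap.comp_assoc]
        | smul c x h => simp only [map_smul, h]
        | add x y h h' => simp only [map_add, h, h']
      | smul c x h => simp only [map_smul, LinearMap.smul_apply, h]
      | add x y h h' => simp only [map_add, LinearMap.add_apply, h, h']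
    | smul c x h => simp only [map_smul, LinearMap.smul_apply, h]
    | add x y h h' => simp only [map_add, LinearMap.add_apply, h, h']

variable {k d} in
/-- The tensor in `Hom(V, W)^{⊗d}` underlying a morphism. -/
def ten {V W : DivPow k d} (f : V ⟶ W) : TPow k (Fin d) (V.as →ₗ[k] W.as) := f.1

instance : Preadditive (DivPow k d) where
  homGroup V W := inferInstanceAs (AddCommGroup (Gam k (Fin d) (V.as →ₗ[k] W.as)))
  add_comp U V W f f' g := LinearMap.map_add₂ (gmap₂ (Fin d) (compB k U.as V.as W.as)) f f' g
  comp_add U V W f g g' := (gmap₂ (Fin d) (compB k U.as V.as W.as) f).map_add g g'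

instance : CategoryTheory.Linear k (DivPow k d) where
  homModule V W := inferInstanceAs (Module k (Gam k (Fin d) (V.as →ₗ[k] W.as)))
  smul_comp U V W c f g := LinearMap.map_smul₂ (gmap₂ (Fin d) (compB k U.as V.as W.as)) c f g
  comp_smul U V W f c g := (gmap₂ (Fin d) (compB k U.as V.as W.as) f).map_smul c g

section

variable {k d} {U V W : DivPow k d}

lemma hom_ext {f g : V ⟶ W} (h : ten f = ten g) : f = g := Subtype.ext h
lemma ten_mem (f : V ⟶ W) : ten f ∈ Gam k (Fin d) (V.as →ₗ[k] W.as) := f.2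
lemma ten_id : ten (𝟙 V) = PiTensorProduct.tprod k fun _ : Fin d => LinearMap.id := rfl
lemma ten_comp (f : U ⟶ V) (g : V ⟶ W) :
    ten (f ≫ g) = tmap₂ (Fin d) (compB k U.as V.as W.as) (ten f) (ten g) := rfl
lemma ten_add (f g : V ⟶ W) : ten (f + g) = ten f + ten g := rfl
lemma ten_smul (c : k) (f : V ⟶ W) : ten (c • f) = c • ten f := rfl

end

/-- The morphism `f^{⊗d}` in `Γ^d P_k` induced by a linear map `f`. -/
def ofLinear {V W : FinProj k} (f : V →ₗ[k] W) : (DivPow.mk V : DivPow k d) ⟶ DivPow.mk W :=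
  diag (Fin d) f

/-- A linear isomorphism induces an isomorphism in `Γ^d P_k`. -/
def isoOfEquiv {V W : FinProj k} (e : V ≃ₗ[k] W) : (DivPow.mk V : DivPow k d) ≅ DivPow.mk W where
  hom := ofLinear k d e.toLinearMap
  inv := ofLinear k d e.symm.toLinearMap
  hom_inv_id := hom_ext (by
    rw [ten_comp, ten_id]
    exact (tmap₂_tprod _ _ _).trans (by simp))
  inv_hom_id := hom_ext (by
    rw [ten_comp, ten_id]
    exact (tmap₂_tprod _ _ _).trans (by simp))

instance : EssentiallySmall.{u} (DivPow k d) := by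
  rw [essentiallySmall_iff]
  refine ⟨?_, inferInstance⟩
  let A := Σ n : ℕ, {S : Submodule k (Fin n → k) // Module.Projective k ((Fin n → k) ⧸ S)}
  let G : A → FinProj k := fun a =>
    haveI := a.2.2
    FinProj.mk ((Fin a.1 → k) ⧸ a.2.1)
  refine small_of_surjective (f := fun a : A => toSkeleton (DivPow.mk (d := d) (G a))) fun x => ?_
  obtain ⟨V, rfl⟩ : ∃ V, toSkeleton V = x := Quotient.exists_rep x
  obtain ⟨n, S, ⟨e⟩⟩ := Module.Finite.exists_fin_quot_equiv k V.as
  let a : A := ⟨n, S, Module.Projective.of_equiv e.symm⟩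
  exact ⟨a, Quotient.sound ⟨isoOfEquiv k d (V := G a) (W := V.as) e⟩⟩

section

variable (k : Type u) [CommRing k] (d : ℕ)

/-! ### Tensor product and internal Hom on the category of divided powers -/

section

variable (U V W X : FinProj k)

/-- The bilinear map `(f, g) ↦ f ⊗ g`. -/
def tensorB : (U →ₗ[k] V) →ₗ[k] (W →ₗ[k] X) →ₗ[k] (U ⊗[k] W →ₗ[k] V ⊗[k] X) :=
  TensorProduct.mapBilinear (RingHom.id k) U W V X

@[simp] lemma tensorB_apply (f : U →ₗ[k] V) (g : W →ₗ[k] X) :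
    tensorB k U V W X f g = TensorProduct.map f g := rfl

/-- The bilinear map `(f, g) ↦ (h ↦ g ∘ h ∘ f)`. -/
def homB : (U →ₗ[k] V) →ₗ[k] (W →ₗ[k] X) →ₗ[k] ((V →ₗ[k] W) →ₗ[k] (U →ₗ[k] X)) :=
  LinearMap.mk₂ k (fun f g => LinearMap.lcomp k X f ∘ₗ LinearMap.llcomp k V W X g)
    (fun f f' g => by ext; simp) (fun c f g => by ext; simp)
    (fun f g g' => by ext; simp) (fun c f g => by ext; simp)

lemma homB_apply (f : U →ₗ[k] V) (g : W →ₗ[k] X) (h : V →ₗ[k] W) :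
    homB k U V W X f g h = g ∘ₗ h ∘ₗ f := rfl

end

variable {k d}

/-- The tensor product of objects of `Γ^d P_k`. -/
def tensorObj (V W : DivPow k d) : DivPow k d := ⟨FinProj.mk (V.as ⊗[k] W.as)⟩

/-- The internal Hom of objects of `Γ^d P_k`. -/
def homObj (V W : DivPow k d) : DivPow k d := ⟨FinProj.mk (V.as →ₗ[k] W.as)⟩

/-- The tensor product of morphisms of `Γ^d P_k`, induced by
`Γ^d A × Γ^d B → Γ^d (A ⊗ B)` and `Hom(V, V') ⊗ Hom(W, W') → Hom(V ⊗ W, V' ⊗ W')`. -/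
def tensorMap {V V' W W' : DivPow k d} (f : V ⟶ V') (g : W ⟶ W') :
    tensorObj V W ⟶ tensorObj V' W' :=
  gmap₂ (Fin d) (tensorB k V.as V'.as W.as W'.as) f g

/-- The internal Hom on morphisms of `Γ^d P_k`. -/
def homMap {V V' W W' : DivPow k d} (f : V' ⟶ V) (g : W ⟶ W') : homObj V W ⟶ homObj V' W' :=
  gmap₂ (Fin d) (homB k V'.as V.as W.as W'.as) f g

lemma ten_tensorMap {V V' W W' : DivPow k d} (f : V ⟶ V') (g : W ⟶ W') :
    ten (tensorMap f g) = tmap₂ (Fin d) (tensorB k V.as V'.as W.as W'.as) (ten f) (ten g) := rfl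

lemma ten_homMap {V V' W W' : DivPow k d} (f : V' ⟶ V) (g : W ⟶ W') :
    ten (homMap f g) = tmap₂ (Fin d) (homB k V'.as V.as W.as W'.as) (ten f) (ten g) := rfl

/-- Two bilinear operations on tensor powers satisfy an interchange law if the operations on the
factors do. -/
lemma tmap₂_interchange {ι : Type} {A A' B B' C C' D D' E : Type u}
    [AddCommGroup A] [Module k A] [AddCommGroup A'] [Module k A'] [AddCommGroup B] [Module k B]
    [AddCommGroup B'] [Module k B'] [AddCommGroup C] [Module k C] [AddCommGroup C'] [Module k C']
    [AddCommGroup D] [Module k D] [AddCommGroup D'] [Module k D'] [AddCommGroup E] [Module k E]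
    (p : A →ₗ[k] A' →ₗ[k] C) (q : B →ₗ[k] B' →ₗ[k] C') (r : C →ₗ[k] C' →ₗ[k] E)
    (p' : A →ₗ[k] B →ₗ[k] D) (q' : A' →ₗ[k] B' →ₗ[k] D') (r' : D →ₗ[k] D' →ₗ[k] E)
    (h : ∀ a a' b b', r (p a a') (q b b') = r' (p' a b) (q' a' b'))
    (a : TPow k ι A) (a' : TPow k ι A') (b : TPow k ι B) (b' : TPow k ι B') :
    tmap₂ ι r (tmap₂ ι p a a') (tmap₂ ι q b b') =
      tmap₂ ι r' (tmap₂ ι p' a b) (tmap₂ ι q' a' b') := by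
  induction a using tind with
  | tp a =>
    induction a' using tind with
    | tp a' =>
      induction b using tind with
      | tp b =>
        induction b' using tind with
        | tp b' => simp [h]
        | smul c x h => simp only [map_smul, h]
        | add x y h h' => simp only [map_add, h, h']
      | smul c x h => simp only [map_smul, LinearMap.smul_apply, h]
      | add x y h h' => simp only [map_add, LinearMap.add_apply, h, h']
    | smul c x h => simp only [map_smul, LinearMap.smul_apply, h]
    | add x y h h' => simp only [map_add, LinearMap.add_apply, h, h']
  | smul c x h => simp only [map_smul, LinearMap.smul_apply, h]
  | add x y h h' => simp only [map_add, LinearMap.add_apply, h, h']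

lemma tensorMap_id (V W : DivPow k d) : tensorMap (𝟙 V) (𝟙 W) = 𝟙 (tensorObj V W) := by
  apply hom_ext
  rw [ten_tensorMap, ten_id, ten_id, ten_id, tmap₂_tprod]
  simp only [tensorB_apply, TensorProduct.map_id]
  rfl

lemma tensorMap_comp {V V' V'' W W' W'' : DivPow k d} (f : V ⟶ V') (f' : V' ⟶ V'')
    (g : W ⟶ W') (g' : W' ⟶ W'') :
    tensorMap (f ≫ f') (g ≫ g') = tensorMap f g ≫ tensorMap f' g' := by
  apply hom_ext
  rw [ten_comp, ten_tensorMap, ten_tensorMap, ten_tensorMap, ten_comp, ten_comp]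
  exact tmap₂_interchange _ _ _ _ _ _ (fun a a' b b' => TensorProduct.map_comp _ _ _ _) _ _ _ _

lemma homMap_id (V W : DivPow k d) : homMap (𝟙 V) (𝟙 W) = 𝟙 (homObj V W) := by
  apply hom_ext
  rw [ten_homMap, ten_id, ten_id, ten_id, tmap₂_tprod]
  rfl

lemma tmap₂_flip {ι : Type} {A B C : Type u} [AddCommGroup A] [Module k A] [AddCommGroup B]
    [Module k B] [AddCommGroup C] [Module k C] (p : A →ₗ[k] B →ₗ[k] C)
    (a : TPow k ι A) (b : TPow k ι B) : tmap₂ ι p.flip b a = tmap₂ ι p a b := by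
  induction a using tind with
  | tp a =>
    induction b using tind with
    | tp b => simp
    | smul c x h => simp only [map_smul, LinearMap.smul_apply, h]
    | add x y h h' => simp only [map_add, LinearMap.add_apply, h, h']
  | smul c x h => simp only [map_smul, LinearMap.smul_apply, h]
  | add x y h h' => simp only [map_add, LinearMap.add_apply, h, h']

lemma homMap_comp {V V' V'' W W' W'' : DivPow k d} (f : V' ⟶ V) (f' : V'' ⟶ V')
    (g : W ⟶ W') (g' : W' ⟶ W'') :
    homMap (f' ≫ f) (g ≫ g') = homMap f g ≫ homMap f' g' := by
  apply hom_ext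
  rw [ten_comp, ten_homMap, ten_homMap, ten_homMap, ten_comp, ten_comp,
    ← tmap₂_flip (compB k W.as W'.as W''.as)]
  refine Eq.trans ?_ (tmap₂_flip (compB k (V.as →ₗ[k] W.as) (V'.as →ₗ[k] W'.as)
    (V''.as →ₗ[k] W''.as)) _ _)
  exact tmap₂_interchange _ _ _ _ _ _ (fun a a' b b' => rfl) _ _ _ _

lemma tensorMap_comp_left {V V' V'' : DivPow k d} (f : V ⟶ V') (f' : V' ⟶ V'') (W : DivPow k d) :
    tensorMap (f ≫ f') (𝟙 W) = tensorMap f (𝟙 W) ≫ tensorMap f' (𝟙 W) := by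
  rw [← tensorMap_comp, Category.comp_id]

lemma tensorMap_comp_right (V : DivPow k d) {W W' W'' : DivPow k d} (g : W ⟶ W') (g' : W' ⟶ W'') :
    tensorMap (𝟙 V) (g ≫ g') = tensorMap (𝟙 V) g ≫ tensorMap (𝟙 V) g' := by
  rw [← tensorMap_comp, Category.comp_id]

lemma homMap_comp_left {V V' V'' : DivPow k d} (f : V' ⟶ V) (f' : V'' ⟶ V') (W : DivPow k d) :
    homMap (f' ≫ f) (𝟙 W) = homMap f (𝟙 W) ≫ homMap f' (𝟙 W) := by
  rw [← homMap_comp, Category.comp_id]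

lemma homMap_comp_right (V : DivPow k d) {W W' W'' : DivPow k d} (g : W ⟶ W') (g' : W' ⟶ W'') :
    homMap (𝟙 V) (g ≫ g') = homMap (𝟙 V) g ≫ homMap (𝟙 V) g' := by
  rw [← homMap_comp, Category.comp_id]

/-- The bifunctor `V, W ↦ V ⊗ W` of `Γ^d P_k`, on opposite categories. -/
def opTensor : (DivPow k d)ᵒᵖ ⥤ (DivPow k d)ᵒᵖ ⥤ (DivPow k d)ᵒᵖ where
  obj V :=
    { obj := fun W => op (tensorObj V.unop W.unop)
      map := fun g => (tensorMap (𝟙 V.unop) g.unop).op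
      map_id := fun W => congrArg Quiver.Hom.op (tensorMap_id _ _)
      map_comp := fun g g' => congrArg Quiver.Hom.op (tensorMap_comp_right _ _ _) }
  map {V V'} f :=
    { app := fun W => (tensorMap f.unop (𝟙 W.unop)).op
      naturality := fun W W' g => by
        change (tensorMap _ _).op ≫ (tensorMap _ _).op = (tensorMap _ _).op ≫ (tensorMap _ _).op
        rw [← op_comp, ← op_comp, ← tensorMap_comp, ← tensorMap_comp]
        simp }
  map_id V := by ext W; exact congrArg Quiver.Hom.op (tensorMap_id _ _)
  map_comp f f' := by
    ext W
    exact congrArg Quiver.Hom.op (tensorMap_comp_left _ _ _)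

/-- The bifunctor `V, W ↦ Hom(V, W)`, regarded as covariant in `V` and contravariant in `W` with
values in the opposite of `Γ^d P_k`. -/
def opHom : DivPow k d ⥤ (DivPow k d)ᵒᵖ ⥤ (DivPow k d)ᵒᵖ where
  obj V :=
    { obj := fun W => op (homObj V W.unop)
      map := fun g => (homMap (𝟙 V) g.unop).op
      map_id := fun W => congrArg Quiver.Hom.op (homMap_id _ _)
      map_comp := fun g g' => congrArg Quiver.Hom.op (homMap_comp_right _ _ _) }
  map {V V'} f :=
    { app := fun W => (homMap f (𝟙 W.unop)).op
      naturality := fun W W' g => by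
        change (homMap _ _).op ≫ (homMap _ _).op = (homMap _ _).op ≫ (homMap _ _).op
        rw [← op_comp, ← op_comp, ← homMap_comp, ← homMap_comp]
        simp }
  map_id V := by ext W; exact congrArg Quiver.Hom.op (homMap_id _ _)
  map_comp f f' := by
    ext W
    exact congrArg Quiver.Hom.op (homMap_comp_left _ _ _)

end

/-! ### Representations of the category of divided powers -/

section

variable (k : Type u) [CommRing k] (d : ℕ)

/-- The property of a functor `Γ^d P_k ⥤ M_k` of being `k`-linear. -/
def isLinear : ObjectProperty (DivPow k d ⥤ ModuleCat.{u} k) :=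
  fun F => F.Additive ∧ F.Linear k

/-- The category `Rep Γ^d_k` of `k`-linear functors from `Γ^d P_k` to `k`-modules. -/
abbrev RepGam := (isLinear k d).FullSubcategory

lemma isLinear_iff (F : DivPow k d ⥤ ModuleCat.{u} k) :
    isLinear k d F ↔ ∀ (V W : DivPow k d) (f g : V ⟶ W) (c : k),
      F.map (f + g) = F.map f + F.map g ∧ F.map (c • f) = c • F.map f :=
  ⟨fun h _ _ f _ c => ⟨h.1.map_add, h.2.map_smul f c⟩,
    fun h => ⟨⟨(h _ _ _ _ 0).1⟩, ⟨fun f c => (h _ _ f f c).2⟩⟩⟩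

instance (J : Type*) [Category* J] [HasColimitsOfShape J (ModuleCat.{u} k)] :
    (isLinear k d).IsClosedUnderColimitsOfShape J where
  colimitsOfShape_le := by
    rintro F ⟨p⟩
    rw [isLinear_iff]
    intro V W f g c
    have hF := fun j => (isLinear_iff k d (p.diag.obj j)).mp (p.prop_diag_obj j) V W f g c
    have hc := isColimitOfPreserves ((evaluation _ _).obj V) p.isColimit
    refine ⟨hc.hom_ext fun j => ?_, hc.hom_ext fun j => ?_⟩
    · change (p.ι.app j).app V ≫ F.map (f + g) = (p.ι.app j).app V ≫ (F.map f + F.map g)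
      have n : ∀ h : V ⟶ W, _ ≫ F.map h = _ := fun h => ((p.ι.app j).naturality h).symm
      rw [Preadditive.comp_add, n, n, n, (hF j).1, Preadditive.add_comp]
    · change (p.ι.app j).app V ≫ F.map (c • f) = (p.ι.app j).app V ≫ (c • F.map f)
      have n : ∀ h : V ⟶ W, _ ≫ F.map h = _ := fun h => ((p.ι.app j).naturality h).symm
      rw [Linear.comp_smul, n, n, (hF j).2, Linear.smul_comp]

instance (J : Type*) [Category* J] [HasLimitsOfShape J (ModuleCat.{u} k)] :
    (isLinear k d).IsClosedUnderLimitsOfShape J where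
  limitsOfShape_le := by
    rintro F ⟨p⟩
    rw [isLinear_iff]
    intro V W f g c
    have hF := fun j => (isLinear_iff k d (p.diag.obj j)).mp (p.prop_diag_obj j) V W f g c
    have hc := isLimitOfPreserves ((evaluation _ _).obj W) p.isLimit
    refine ⟨hc.hom_ext fun j => ?_, hc.hom_ext fun j => ?_⟩
    · change F.map (f + g) ≫ (p.π.app j).app W = (F.map f + F.map g) ≫ (p.π.app j).app W
      rw [Preadditive.add_comp]
      simp only [NatTrans.naturality, (hF j).1, Preadditive.comp_add]
    · change F.map (c • f) ≫ (p.π.app j).app W = (c • F.map f) ≫ (p.π.app j).app W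
      rw [Linear.smul_comp]
      simp only [NatTrans.naturality, (hF j).2, Linear.comp_smul]

instance : LocallySmall.{u} (DivPow k d ⥤ ModuleCat.{u} k) :=
  locallySmall_of_faithful ((Functor.whiskeringLeft _ _ (ModuleCat.{u} k)).obj
    (equivSmallModel.{u} (DivPow k d)).inverse)

/-- The Yoneda embedding `(Γ^d P_k)ᵒᵖ ⥤ Rep Γ^d_k`, `V ↦ Γ^{d, V} = Hom(V, -)`. -/
def yon : (DivPow k d)ᵒᵖ ⥤ RepGam k d :=
  (isLinear k d).lift (linearCoyoneda k (DivPow k d)) fun V =>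
    ⟨inferInstance, ⟨fun {W X} f c => by
      ext h
      exact Linear.comp_smul (R := k) V.unop W X (h : V.unop ⟶ W) c f⟩⟩

instance (X : RepGam k d) : HasColimitsOfShape (CostructuredArrow (yon k d) X) (ModuleCat.{u} k) :=
  HasColimitsOfShape.of_essentiallySmall.{u, u} _ _

instance (X : (RepGam k d)ᵒᵖ) :
    HasLimitsOfShape (StructuredArrow X (yon k d).rightOp) (ModuleCat.{u} k) :=
  HasLimitsOfShape.of_essentiallySmall.{u, u} _ _

instance : HasFiniteLimits (RepGam k d) := ⟨fun _ _ _ => inferInstance⟩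

instance : HasFiniteColimits (RepGam k d) := ⟨fun _ _ _ => inferInstance⟩

instance : HasFiniteBiproducts (RepGam k d) := HasFiniteBiproducts.of_hasFiniteProducts

instance : HasBinaryBiproducts (RepGam k d) := hasBinaryBiproducts_of_finite_biproducts _

/-- The internal tensor product `X ⊗_{Γ^d_k} Y`. First `Γ^{d, V} ⊗ Y` is the colimit of
`Γ^{d, V ⊗ W}` over all `Γ^{d, W} ⟶ Y`, and then `X ⊗ Y` is the colimit of `Γ^{d, V} ⊗ Y` over all
`Γ^{d, V} ⟶ X`; both steps are (pointwise) left Kan extensions along the Yoneda embedding. -/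
def internalTensor : RepGam k d ⥤ RepGam k d ⥤ RepGam k d :=
  (yon k d).lan.obj
    ((opTensor ⋙ (Functor.whiskeringRight _ _ _).obj (yon k d)) ⋙ (yon k d).lan)

/-- The internal Hom `ℋom(X, Y)`. First `ℋom(Γ^{d, V}, Y)` is the colimit of `Γ^{d, Hom(V, W)}` over
all `Γ^{d, W} ⟶ Y`, and then `ℋom(X, Y)` is the limit of `ℋom(Γ^{d, V}, Y)` over all
`Γ^{d, V} ⟶ X`; the steps are (pointwise) Kan extensions along the Yoneda embedding. -/
def internalHom : (RepGam k d)ᵒᵖ ⥤ RepGam k d ⥤ RepGam k d :=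
  (yon k d).rightOp.ran.obj
    ((opHom ⋙ (Functor.whiskeringRight _ _ _).obj (yon k d)) ⋙ (yon k d).lan)

end

section

variable {k : Type u} [CommRing k] {d : ℕ}

/-! ### Divided, symmetric and exterior powers as representations -/

/-- Constructor for representations from modules and linear actions of the morphism modules. -/
def mkRep (F : DivPow k d → Type u) [∀ V, AddCommGroup (F V)] [∀ V, Module k (F V)]
    (a : ∀ V W : DivPow k d, (V ⟶ W) →ₗ[k] F V →ₗ[k] F W)
    (a_id : ∀ V x, a V V (𝟙 V) x = x)
    (a_comp : ∀ (U V W : DivPow k d) (f : U ⟶ V) (g : V ⟶ W) (x : F U),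
      a U W (f ≫ g) x = a V W g (a U V f x)) : RepGam k d where
  obj :=
    { obj := fun V => ModuleCat.of k (F V)
      map := fun {V W} f => ModuleCat.ofHom (a V W f)
      map_id := fun V => by ext x; exact a_id V x
      map_comp := fun {U V W} f g => by ext x; exact a_comp U V W f g x }
  property := by
    rw [isLinear_iff]
    intro V W f g c
    constructor <;> ext x
    · change a V W (f + g) x = a V W f x + a V W g x
      rw [map_add, LinearMap.add_apply]
    · change a V W (c • f) x = c • a V W f x
      rw [map_smul, LinearMap.smul_apply]

/-- The action of a morphism `V ⟶ W` of `Γ^d P_k` as a linear map `V^{⊗d} → W^{⊗d}`. -/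
def actHom {V W : DivPow k d} (f : V ⟶ W) : TPow k (Fin d) V.as →ₗ[k] TPow k (Fin d) W.as :=
  act k (Fin d) V.as W.as (ten f)

lemma actHom_id (V : DivPow k d) (t : TPow k (Fin d) V.as) : actHom (𝟙 V) t = t := act_id t

lemma actHom_comp {U V W : DivPow k d} (f : U ⟶ V) (g : V ⟶ W) (t : TPow k (Fin d) U.as) :
    actHom (f ≫ g) t = actHom g (actHom f t) := act_comp _ _ t

lemma actHom_add {V W : DivPow k d} (f g : V ⟶ W) : actHom (f + g) = actHom f + actHom g := by
  rw [actHom, ten_add, map_add]; rfl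

lemma actHom_smul {V W : DivPow k d} (c : k) (f : V ⟶ W) : actHom (c • f) = c • actHom f := by
  rw [actHom, ten_smul, map_smul]; rfl

lemma actHom_permute {V W : DivPow k d} (f : V ⟶ W) (σ : Equiv.Perm (Fin d))
    (t : TPow k (Fin d) V.as) :
    actHom f (permute k V.as σ t) = permute k W.as σ (actHom f t) := act_permute (ten_mem f) σ t

variable (k d)

/-- The divided power `Γ^d`, sending `V` to the module `(V^{⊗d})^{𝔖_d}` of symmetric tensors. -/
def GammaRep : RepGam k d :=
  mkRep (fun V => Gam k (Fin d) V.as)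
    (fun V W =>
      { toFun := fun f => (actHom f).restrict fun t (ht : t ∈ Gam k (Fin d) V.as) σ => by
          rw [← actHom_permute, ht σ]
        map_add' := fun f g => LinearMap.ext fun t => Subtype.ext
          (LinearMap.congr_fun (actHom_add f g) t.1)
        map_smul' := fun c f => LinearMap.ext fun t => Subtype.ext
          (LinearMap.congr_fun (actHom_smul c f) t.1) })
    (fun V x => Subtype.ext (actHom_id V x.1))
    (fun U V W f g x => Subtype.ext (actHom_comp f g x.1))

/-- The submodule of `M^{⊗d}` spanned by the elements `σ t - t`. -/
def symRel (M : Type u) [AddCommGroup M] [Module k M] : Submodule k (TPow k (Fin d) M) :=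
  Submodule.span k {x | ∃ (σ : Equiv.Perm (Fin d)) (t : TPow k (Fin d) M), x = permute k M σ t - t}

variable {k d} in
lemma symRel_le {V W : DivPow k d} (f : V ⟶ W) :
    symRel k d V.as ≤ (symRel k d W.as).comap (actHom f) := by
  refine Submodule.span_le.mpr ?_
  rintro _ ⟨σ, t, rfl⟩
  refine Submodule.subset_span ⟨σ, actHom f t, ?_⟩
  rw [map_sub, actHom_permute]

/-- The symmetric power `S^d`, sending `V` to the largest quotient of `V^{⊗d}` on which the
symmetric group acts trivially. -/
def SymRep : RepGam k d :=
  mkRep (fun V => TPow k (Fin d) V.as ⧸ symRel k d V.as)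
    (fun V W =>
      { toFun := fun f => (symRel k d V.as).mapQ (symRel k d W.as) (actHom f) (symRel_le f)
        map_add' := fun f g => by
          refine Submodule.linearMap_qext _ ?_
          ext1; ext1 t
          simp [actHom_add]
        map_smul' := fun c f => by
          refine Submodule.linearMap_qext _ ?_
          ext1; ext1 t
          simp [actHom_smul] })
    (fun V x => by
      obtain ⟨t, rfl⟩ := Submodule.Quotient.mk_surjective _ x
      exact congrArg (Submodule.Quotient.mk) (actHom_id V t))
    (fun U V W f g x => by
      obtain ⟨t, rfl⟩ := Submodule.Quotient.mk_surjective _ x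
      exact congrArg (Submodule.Quotient.mk) (actHom_comp f g t))

variable {k d} in
/-- The linear map `Λ^d V → Λ^d W` induced by a morphism `V ⟶ W` of `Γ^d P_k`, through its action
`V^{⊗d} → W^{⊗d}`. -/
def extHom {V W : DivPow k d} (f : V ⟶ W) : ⋀[k]^d V.as →ₗ[k] ⋀[k]^d W.as :=
  exteriorPower.alternatingMapLinearEquiv
    { (toExt k W.as d ∘ₗ actHom f).compMultilinearMap (PiTensorProduct.tprod k) with
      map_eq_zero_of_eq' := fun v i j hv hij => by
        refine toExt_eq_zero hij ?_
        rw [← actHom_permute, permute_tprod]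
        congr 2
        funext a
        rw [Equiv.symm_swap]
        rcases eq_or_ne a i with rfl | hi
        · rw [Equiv.swap_apply_left, hv]
        rcases eq_or_ne a j with rfl | hj
        · rw [Equiv.swap_apply_right, hv]
        · rw [Equiv.swap_apply_of_ne_of_ne hi hj] }

variable {k d} in
lemma extHom_toExt {V W : DivPow k d} (f : V ⟶ W) (t : TPow k (Fin d) V.as) :
    extHom f (toExt k V.as d t) = toExt k W.as d (actHom f t) := by
  induction t using tind with
  | tp x =>
    rw [toExt_tprod, extHom, exteriorPower.alternatingMapLinearEquiv_apply_ιMulti]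
    rfl
  | smul c x h => simp only [map_smul, h]
  | add x y h h' => simp only [map_add, h, h']

variable {k d} in
lemma ext_ind {M E : Type u} [AddCommGroup M] [Module k M] [AddCommGroup E] [Module k E]
    {f g : ⋀[k]^d M →ₗ[k] E} (h : ∀ t, f (toExt k M d t) = g (toExt k M d t)) : f = g := by
  refine exteriorPower.linearMap_ext (AlternatingMap.ext fun x => ?_)
  have := h (PiTensorProduct.tprod k x)
  rwa [toExt_tprod] at this

/-- The exterior power `Λ^d`. -/
def ExtRep : RepGam k d :=
  mkRep (fun V => ⋀[k]^d V.as)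
    (fun V W =>
      { toFun := extHom
        map_add' := fun f g => ext_ind fun t => by
          rw [LinearMap.add_apply, extHom_toExt, extHom_toExt, extHom_toExt, actHom_add,
            LinearMap.add_apply, map_add]
        map_smul' := fun c f => ext_ind fun t => by
          rw [RingHom.id_apply, LinearMap.smul_apply, extHom_toExt, extHom_toExt, actHom_smul,
            LinearMap.smul_apply, map_smul] })
    (fun V x => LinearMap.congr_fun (f := extHom (𝟙 V)) (g := LinearMap.id)
      (ext_ind fun t => by rw [extHom_toExt, actHom_id, LinearMap.id_apply]) x)
    (fun U V W f g x => LinearMap.congr_fun (f := extHom (f ≫ g)) (g := extHom g ∘ₗ extHom f)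
      (ext_ind fun t => by
        rw [LinearMap.comp_apply, extHom_toExt, extHom_toExt, extHom_toExt, actHom_comp]) x)

/-! ### The external tensor product -/

variable {k d}

/-- The linear map `Γ^d Hom(V, W) → Hom(X(V), X(W))` given by a representation `X`. -/
def repMap (X : RepGam k d) (V W : FinProj k) :
    Gam k (Fin d) (V →ₗ[k] W) →ₗ[k] (X.obj.obj ⟨V⟩ →ₗ[k] X.obj.obj ⟨W⟩) where
  toFun f := (X.obj.map (X := ⟨V⟩) (Y := ⟨W⟩) f).hom
  map_add' f g := by
    have := X.property.1
    exact congrArg ModuleCat.Hom.hom (X.obj.map_add (X := ⟨V⟩) (Y := ⟨W⟩) (f := f) (g := g))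
  map_smul' c f := by
    have := X.property.2
    exact congrArg ModuleCat.Hom.hom (X.obj.map_smul (X := ⟨V⟩) (Y := ⟨W⟩) c f)

lemma repMap_id (X : RepGam k d) (V : FinProj k) :
    repMap X V V (diag (Fin d) LinearMap.id) = LinearMap.id :=
  congrArg ModuleCat.Hom.hom (X.obj.map_id ⟨V⟩)

lemma repMap_comp (X : RepGam k d) (U V W : FinProj k) (f : Gam k (Fin d) (U →ₗ[k] V))
    (g : Gam k (Fin d) (V →ₗ[k] W)) :
    repMap X U W (gmap₂ (Fin d) (compB k U V W) f g) = repMap X V W g ∘ₗ repMap X U V f :=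
  congrArg ModuleCat.Hom.hom (X.obj.map_comp (X := ⟨U⟩) (Y := ⟨V⟩) (Z := ⟨W⟩) f g)

section Comul

variable {ι J : Type} {κ : J → Type} [Fintype ι] [Fintype J] [∀ j, Fintype (κ j)]

lemma comul_diag {M : Type u} [AddCommGroup M] [Module k M] [Module.Finite k M]
    [Module.Projective k M] (e : (Σ j, κ j) ≃ ι) (m : M) :
    comul M e (diag ι m : Gam k ι M) = PiTensorProduct.tprod k fun j => diag (κ j) m := by
  apply mapIncl_injective
  rw [mapIncl_comul, coe_diag, blocks_tprod, PiTensorProduct.mapIncl, PiTensorProduct.map_tprod]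
  rfl

lemma blocks_tmap₂ {M N P : Type u} [AddCommGroup M] [Module k M] [AddCommGroup N] [Module k N]
    [AddCommGroup P] [Module k P] (B : M →ₗ[k] N →ₗ[k] P) (e : (Σ j, κ j) ≃ ι)
    (s : TPow k ι M) (t : TPow k ι N) :
    blocks P e (tmap₂ ι B s t) =
      PiTensorProduct.map₂ (fun j => tmap₂ (κ j) B) (blocks M e s) (blocks N e t) := by
  induction s using tind with
  | tp x =>
    induction t using tind with
    | tp y => simp [PiTensorProduct.map₂_tprod_tprod]
    | smul c x h => simp only [map_smul, h]
    | add x y h h' => simp only [map_add, h, h']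
  | smul c x h => simp only [map_smul, LinearMap.smul_apply, h]
  | add x y h h' => simp only [map_add, LinearMap.add_apply, h, h']

lemma comul_gmap₂ {M N P : Type u} [AddCommGroup M] [Module k M] [AddCommGroup N] [Module k N]
    [AddCommGroup P] [Module k P] [Module.Finite k M] [Module.Projective k M] [Module.Finite k N]
    [Module.Projective k N] [Module.Finite k P] [Module.Projective k P]
    (B : M →ₗ[k] N →ₗ[k] P) (e : (Σ j, κ j) ≃ ι) (s : Gam k ι M) (t : Gam k ι N) :
    comul P e (gmap₂ ι B s t) =
      PiTensorProduct.map₂ (fun j => gmap₂ (κ j) B) (comul M e s) (comul N e t) := by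
  apply mapIncl_injective
  rw [mapIncl_comul, coe_gmap₂, blocks_tmap₂, ← mapIncl_comul, ← mapIncl_comul]
  generalize comul M e s = x
  generalize comul N e t = y
  induction x using tind with
  | tp x =>
    induction y using tind with
    | tp y => simp [PiTensorProduct.map₂_tprod_tprod]
    | smul c x h => simp only [map_smul, h]
    | add x y h h' => simp only [map_add, h, h']
  | smul c x h => simp only [map_smul, LinearMap.smul_apply, h]
  | add x y h h' => simp only [map_add, LinearMap.add_apply, h, h']

end Comul

variable {n : ℕ}

/-- The action of `Γ^d Hom(V, W)` on `⨂ᵢ Xᵢ(V)`, through the canonical map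
`Γ^d Hom(V, W) → ⨂ᵢ Γ^{λᵢ} Hom(V, W)`. -/
def extTensorMap {l : Fin n → ℕ} (e : (Σ i, Fin (l i)) ≃ Fin d) (X : ∀ i, RepGam k (l i))
    (V W : FinProj k) : Gam k (Fin d) (V →ₗ[k] W) →ₗ[k]
      (⨂[k] i, (X i).obj.obj ⟨V⟩) →ₗ[k] ⨂[k] i, (X i).obj.obj ⟨W⟩ :=
  PiTensorProduct.piTensorHomMap ∘ₗ (PiTensorProduct.map fun i => repMap (X i) V W) ∘ₗ
    comul (V →ₗ[k] W) e

/-- The external tensor product `X₁ ⊗ ⋯ ⊗ Xₙ` of representations of degrees `λ₁, …, λₙ`, as a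
representation of degree `d = λ₁ + ⋯ + λₙ`; it sends `V` to `X₁(V) ⊗ ⋯ ⊗ Xₙ(V)`. -/
def extTensor (l : Fin n → ℕ) (hl : ∑ i, l i = d) (X : ∀ i, RepGam k (l i)) : RepGam k d :=
  mkRep (fun V => ⨂[k] i, (X i).obj.obj ⟨V.as⟩)
    (fun V W => extTensorMap (finSigmaFinEquiv.trans (finCongr hl)) X V.as W.as)
    (fun V x => by
      change extTensorMap _ X V.as V.as (diag (Fin d) LinearMap.id) x = x
      rw [extTensorMap, LinearMap.comp_apply, LinearMap.comp_apply, comul_diag,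
        PiTensorProduct.map_tprod, PiTensorProduct.piTensorHomMap_tprod_eq_map]
      simp only [repMap_id, PiTensorProduct.map_id, LinearMap.id_apply])
    (fun U V W f g x => by
      change extTensorMap _ X U.as W.as (gmap₂ (Fin d) (compB k U.as V.as W.as) f g) x =
        extTensorMap _ X V.as W.as g (extTensorMap _ X U.as V.as f x)
      simp only [extTensorMap, LinearMap.comp_apply]
      rw [comul_gmap₂]
      generalize comul (U.as →ₗ[k] V.as) (finSigmaFinEquiv.trans (finCongr hl)) f = y
      generalize comul (V.as →ₗ[k] W.as) (finSigmaFinEquiv.trans (finCongr hl)) g = z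
      induction y using tind with
      | tp y =>
        induction z using tind with
        | tp z =>
          simp only [PiTensorProduct.map₂_tprod_tprod, PiTensorProduct.map_tprod, repMap_comp,
            PiTensorProduct.piTensorHomMap_tprod_eq_map, PiTensorProduct.map_comp,
            LinearMap.comp_apply]
        | smul c x h => simp only [map_smul, LinearMap.smul_apply, h]
        | add x y h h' => simp only [map_add, LinearMap.add_apply, h, h']
      | smul c x h => simp only [map_smul, LinearMap.smul_apply, h]
      | add x y h h' => simp only [map_add, LinearMap.add_apply, h, h'])

/-- The set `Λ(n, d)` of sequences of `n` non-negative integers with sum `d`. -/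
def SeqSum (n d : ℕ) : Type := {l : Fin n → ℕ // ∑ i, l i = d}

variable (k)

/-- `Γ^λ = Γ^{λ₁} ⊗ ⋯ ⊗ Γ^{λₙ}`. -/
def GammaL (l : SeqSum n d) : RepGam k d := extTensor l.1 l.2 fun i => GammaRep k (l.1 i)

/-- `S^λ = S^{λ₁} ⊗ ⋯ ⊗ S^{λₙ}`. -/
def SymL (l : SeqSum n d) : RepGam k d := extTensor l.1 l.2 fun i => SymRep k (l.1 i)

/-- `Λ^λ = Λ^{λ₁} ⊗ ⋯ ⊗ Λ^{λₙ}`. -/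
def ExtL (l : SeqSum n d) : RepGam k d := extTensor l.1 l.2 fun i => ExtRep k (l.1 i)

end

/-! ### Additive closures and induced equivalences -/

/-- `add {X i | i}`: the property of being (isomorphic to) a direct summand of a finite direct sum
of objects `X i`. -/
def addClosure {C : Type*} [Category* C] [Preadditive C] [HasFiniteBiproducts C]
    [HasBinaryBiproducts C] {I : Type*}
    (X : I → C) : ObjectProperty C := fun Y =>
  ∃ (m : ℕ) (f : Fin m → I) (Z : C), Nonempty ((Y ⊞ Z) ≅ ⨁ fun j => X (f j))

/-- The functors `F` and `G` restrict to functors between the full subcategories given by `P` and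
`Q`, and these restrictions are mutually quasi-inverse equivalences of categories. -/
def InduceEquivalence {C D : Type*} [Category* C] [Category* D] (F : C ⥤ D) (G : D ⥤ C)
    (P : ObjectProperty C) (Q : ObjectProperty D) : Prop :=
  ∃ (hF : ∀ X : P.FullSubcategory, Q (F.obj X.obj)) (hG : ∀ Y : Q.FullSubcategory, P (G.obj Y.obj))
    (e : P.FullSubcategory ≌ Q.FullSubcategory),
    e.functor = Q.lift (P.ι ⋙ F) hF ∧ e.inverse = P.lift (Q.ι ⋙ G) hG

end StrictPoly
end

open StrictPoly

noncomputable section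

namespace StrictPoly

/-! ### Calculus of tensor powers of linear and bilinear maps -/

section

variable {k : Type u} [CommRing k] {ι : Type} {M M' N N' P Q : Type u}
  [AddCommGroup M] [Module k M] [AddCommGroup M'] [Module k M'] [AddCommGroup N] [Module k N]
  [AddCommGroup N'] [Module k N'] [AddCommGroup P] [Module k P] [AddCommGroup Q] [Module k Q]

/-! The proof rests on one adjunction and two pairings. A bilinear family (`Bil`) consists of maps
X(V) × Y(W) → Z(V ⊗ W) natural in V and W. Unwinding the iterated colimit by Yoneda, morphisms X ⊗ Y
→ Z are the same as bilinear families (`tensorBil_postcomp_bijective`). On Γ^d P_k the functor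
Hom(V, -) is left adjoint to V ⊗ -, so ℋom(Γ^{d,V}, Z) is Z(V ⊗ -); passing to the limit, morphisms
Y → ℋom(X, Z) are again the bilinear families (`homBil_precomp_bijective`). Hence X ⊗ - is left
adjoint to ℋom(X, -) (`tensorHomAdj`).

A family is perfect if it exhibits Z as X ⊗ Y and Y as ℋom(X, Z). The unit at Y and the counit at Z
are then isomorphisms (`Bil.IsPerfect.main`), and so they are on all summands of finite sums of
copies of Y and of Z; thus X ⊗ - induces an equivalence between these two categories of summands.
Perfectness is preserved when Y and Z are replaced by Y(E ⊗ -) and Z(E ⊗ -) (`Bil.IsPerfect.shift`).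

For E = kⁿ and Z one of Γ^d, Λ^d, S^d, the functor Z(kⁿ ⊗ -) is the direct sum of the Z^λ, λ in Λ(n,
d): expand (kⁿ ⊗ V)^{⊗d} over the colourings of the d factors by n basis vectors, and note that
colourings up to permutation are classified by their fibre sizes. So each additive closure in the
theorem consists of the summands of finite powers of a single object, and only two pairings have to
be shown perfect: Λ^d(V) × Γ^d(W) → Λ^d(V ⊗ W), which inserts a symmetric tensor
(`gammaBil_isPerfect`), and the determinant pairing Λ^d(V) × Λ^d(W) → S^d(V ⊗ W)
(`detBil_isPerfect`).

Universality: Γ^d is represented by k and is the tensor unit, while S^d is generated by the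
determinant of (ω, ω) with ω = e₁ ∧ ⋯ ∧ e_d. Couniversality: ω generates Λ^d, so a natural family
Λ^d → Z(- ⊗ U) is an element of Z(k^d ⊗ U) killed by the annihilator of ω. For Z a signed quotient
of the tensor power, such an element is the class of e₁ ⊗ ⋯ ⊗ e_d multiplied factorwise by a unique
t in U^{⊗d}. Permuting the e_j makes t symmetric for Z = Λ^d and antisymmetric for Z = S^d. In the
second case, merging two of the e_j also kills the coefficients of t with a repeated index, which
antisymmetry alone does not do when 2 is a zero divisor; then t comes from Λ^d U. -/

lemma tpow_hom_ext {f g : TPow k ι M →ₗ[k] Q}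
    (h : ∀ x, f (PiTensorProduct.tprod k x) = g (PiTensorProduct.tprod k x)) : f = g :=
  PiTensorProduct.ext (MultilinearMap.ext h)

lemma tmap_tmap₂ (l : P →ₗ[k] Q) (B : M →ₗ[k] N →ₗ[k] P) (s : TPow k ι M) (t : TPow k ι N) :
    tmap ι l (tmap₂ ι B s t) = tmap₂ ι (B.compr₂ l) s t := by
  suffices h : (tmap₂ ι B).compr₂ (tmap ι l) = tmap₂ ι (B.compr₂ l) from
    LinearMap.congr_fun (LinearMap.congr_fun h s) t
  exact tind₂ fun x y => by simp

lemma tmap₂_tmap_left (l : M' →ₗ[k] M) (B : M →ₗ[k] N →ₗ[k] P) (s : TPow k ι M')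
    (t : TPow k ι N) : tmap₂ ι B (tmap ι l s) t = tmap₂ ι (B ∘ₗ l) s t := by
  suffices h : tmap₂ ι B ∘ₗ tmap ι l = tmap₂ ι (B ∘ₗ l) from
    LinearMap.congr_fun (LinearMap.congr_fun h s) t
  exact tind₂ fun x y => by simp

lemma tmap₂_tmap_right (l : N' →ₗ[k] N) (B : M →ₗ[k] N →ₗ[k] P) (s : TPow k ι M)
    (t : TPow k ι N') : tmap₂ ι B s (tmap ι l t) = tmap₂ ι (B.compl₂ l) s t := by
  suffices h : (tmap₂ ι B).compl₂ (tmap ι l) = tmap₂ ι (B.compl₂ l) from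
    LinearMap.congr_fun (LinearMap.congr_fun h s) t
  exact tind₂ fun x y => by simp

lemma tmap₂_diag_left (B : M →ₗ[k] N →ₗ[k] P) (m : M) (t : TPow k ι N) :
    tmap₂ ι B (PiTensorProduct.tprod k fun _ => m) t = tmap ι (B m) t := by
  suffices h : tmap₂ ι B (PiTensorProduct.tprod k fun _ => m) = tmap ι (B m) from
    LinearMap.congr_fun h t
  exact tpow_hom_ext fun y => by simp

lemma tmap₂_diag_right (B : M →ₗ[k] N →ₗ[k] P) (s : TPow k ι M) (n : N) :
    tmap₂ ι B s (PiTensorProduct.tprod k fun _ => n) = tmap ι (B.flip n) s := by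
  suffices h : (tmap₂ ι B).flip (PiTensorProduct.tprod k fun _ => n) = tmap ι (B.flip n) from
    LinearMap.congr_fun h s
  exact tpow_hom_ext fun y => by simp

end

/-! ### Morphisms of `Γ^d P_k` given by linear maps -/

section

variable {k : Type u} [CommRing k] {d : ℕ} {U V V' V'' W W' : DivPow k d}

/-- The morphism `f^{⊗d}` of `Γ^d P_k`. -/
def ofLin {V W : DivPow k d} (f : V.as →ₗ[k] W.as) : V ⟶ W := diag (Fin d) f

lemma ten_ofLin (f : V.as →ₗ[k] W.as) :
    ten (ofLin f) = PiTensorProduct.tprod k fun _ : Fin d => f := rfl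

lemma ofLin_id : ofLin (LinearMap.id : V.as →ₗ[k] V.as) = 𝟙 V := rfl

lemma ten_ofLin_comp (f : U.as →ₗ[k] V.as) (g : V ⟶ W) :
    ten (ofLin f ≫ g) = tmap (Fin d) (compB k U.as V.as W.as f) (ten g) := by
  rw [ten_comp, ten_ofLin, tmap₂_diag_left]

lemma ten_comp_ofLin (f : U ⟶ V) (g : V.as →ₗ[k] W.as) :
    ten (f ≫ ofLin g) = tmap (Fin d) ((compB k U.as V.as W.as).flip g) (ten f) := by
  rw [ten_comp, ten_ofLin, tmap₂_diag_right]

lemma ofLin_comp (f : U.as →ₗ[k] V.as) (g : V.as →ₗ[k] W.as) :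
    ofLin f ≫ ofLin g = ofLin (g ∘ₗ f) := hom_ext <| by
  rw [ten_ofLin_comp, ten_ofLin, ten_ofLin, tmap_tprod]; rfl

/-- The bilinear map `(f, g) ↦ f ⊗ g`, with values in the maps between objects of `Γ^d P_k`. -/
def tensorBi (V V' W W' : DivPow k d) : (V.as →ₗ[k] V'.as) →ₗ[k] (W.as →ₗ[k] W'.as) →ₗ[k]
    ((tensorObj V W).as →ₗ[k] (tensorObj V' W').as) := tensorB k V.as V'.as W.as W'.as

/-- The bilinear map `(f, g) ↦ (h ↦ g ∘ h ∘ f)`, with values in the maps between objects of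
`Γ^d P_k`. -/
def homBi (V V' W W' : DivPow k d) : (V'.as →ₗ[k] V.as) →ₗ[k] (W.as →ₗ[k] W'.as) →ₗ[k]
    ((homObj V W).as →ₗ[k] (homObj V' W').as) := homB k V'.as V.as W.as W'.as

lemma ten_tensorMap_bi (f : V ⟶ V') (g : W ⟶ W') :
    ten (tensorMap f g) = tmap₂ (Fin d) (tensorBi V V' W W') (ten f) (ten g) := rfl

lemma ten_homMap_bi (f : V' ⟶ V) (g : W ⟶ W') :
    ten (homMap f g) = tmap₂ (Fin d) (homBi V V' W W') (ten f) (ten g) := rfl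

lemma ten_tensorMap_id_left (g : W ⟶ W') :
    ten (tensorMap (𝟙 V) g) = tmap (Fin d) (tensorBi V V W W' LinearMap.id) (ten g) := by
  rw [ten_tensorMap_bi, ten_id, tmap₂_diag_left]

lemma ten_tensorMap_id_right (f : V ⟶ V') :
    ten (tensorMap f (𝟙 W)) = tmap (Fin d) ((tensorBi V V' W W).flip LinearMap.id) (ten f) := by
  rw [ten_tensorMap_bi, ten_id, tmap₂_diag_right]

lemma ten_homMap_id_left (g : W ⟶ W') :
    ten (homMap (𝟙 V) g) = tmap (Fin d) (homBi V V W W' LinearMap.id) (ten g) := by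
  rw [ten_homMap_bi, ten_id, tmap₂_diag_left]

lemma ten_homMap_id_right (f : V' ⟶ V) :
    ten (homMap f (𝟙 W)) = tmap (Fin d) ((homBi V V' W W).flip LinearMap.id) (ten f) := by
  rw [ten_homMap_bi, ten_id, tmap₂_diag_right]

/-- The tensor product of linear maps, as a map between the tensor products in `Γ^d P_k`. -/
def tensorLin (f : V.as →ₗ[k] V'.as) (g : W.as →ₗ[k] W'.as) :
    (tensorObj V W).as →ₗ[k] (tensorObj V' W').as := TensorProduct.map f g

/-- Composition with a linear map, as a map between the internal Homs in `Γ^d P_k`. -/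
def homLin (V : DivPow k d) (g : W.as →ₗ[k] W'.as) : (homObj V W).as →ₗ[k] (homObj V W').as :=
  LinearMap.llcomp k V.as W.as W'.as g

lemma tensorMap_ofLin (f : V.as →ₗ[k] V'.as) (g : W.as →ₗ[k] W'.as) :
    tensorMap (ofLin f) (ofLin g) = ofLin (tensorLin f g) :=
  hom_ext <| (tmap₂_tprod _ _ _).trans rfl

lemma tensorMap_ofLin_right (g : W.as →ₗ[k] W'.as) :
    tensorMap (𝟙 V) (ofLin g) = ofLin (tensorLin LinearMap.id g) :=
  tensorMap_ofLin LinearMap.id g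

lemma homMap_ofLin_right (g : W.as →ₗ[k] W'.as) :
    homMap (𝟙 V) (ofLin g) = ofLin (homLin V g) :=
  hom_ext <| (tmap₂_tprod _ _ _).trans rfl

/-- Two operations on a tensor power agree on symmetric tensors as soon as the linear maps
inducing them agree. -/
lemma tmap_congr {ι : Type} {M N : Type u} [AddCommGroup M] [Module k M] [AddCommGroup N]
    [Module k N] {f g : M →ₗ[k] N} (h : ∀ x, f x = g x) (t : TPow k ι M) :
    tmap ι f t = tmap ι g t := by rw [LinearMap.ext h]

/-! Evaluation and coevaluation -/

lemma exists_dualBasis (V : FinProj k) : ∃ (n : ℕ) (v : Fin n → V) (l : Fin n → V →ₗ[k] k),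
    ∀ x, ∑ i, l i x • v i = x := by
  obtain ⟨n, p, s, -, -, h⟩ := Module.Finite.exists_comp_eq_id_of_projective k V
  refine ⟨n, fun i => p (Pi.single i 1), fun i => LinearMap.proj i ∘ₗ s, fun x => ?_⟩
  conv_rhs => rw [← LinearMap.id_apply (R := k) x, ← h, LinearMap.comp_apply,
    pi_eq_sum_univ' (s x)]
  simp only [map_sum, map_smul, LinearMap.comp_apply, LinearMap.proj_apply]

/-- The number of elements of a chosen dual basis. -/
def dbCard (V : FinProj k) : ℕ := (exists_dualBasis V).choose
/-- The vectors of a chosen dual basis. -/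
def dbVec (V : FinProj k) : Fin (dbCard V) → V := (exists_dualBasis V).choose_spec.choose
/-- The linear forms of a chosen dual basis. -/
def dbForm (V : FinProj k) : Fin (dbCard V) → V →ₗ[k] k :=
  (exists_dualBasis V).choose_spec.choose_spec.choose
lemma dualBasis_sum (V : FinProj k) (x : V) : ∑ i, dbForm V i x • dbVec V i = x :=
  (exists_dualBasis V).choose_spec.choose_spec.choose_spec x

section

variable (V : FinProj k) (W : Type u) [AddCommGroup W] [Module k W]

/-- The linear map `W → V ⊗ Hom(V, W)` given by the canonical element of `V ⊗ V^*`. -/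
def coevLin : W →ₗ[k] V ⊗[k] (V →ₗ[k] W) :=
  ∑ i, TensorProduct.mk k V (V →ₗ[k] W) (dbVec V i) ∘ₗ LinearMap.smulRightₗ (dbForm V i)

lemma coevLin_apply (w : W) :
    coevLin V W w = ∑ i, dbVec V i ⊗ₜ[k] (dbForm V i).smulRight w := by
  simp [coevLin]

/-- The linear map `Hom(V, V ⊗ W) → W` given by the trace. -/
def evLin : (V →ₗ[k] V ⊗[k] W) →ₗ[k] W :=
  ∑ i, (TensorProduct.lid k W).toLinearMap ∘ₗ LinearMap.rTensor W (dbForm V i) ∘ₗ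
    LinearMap.applyₗ (dbVec V i)

lemma evLin_apply (f : V →ₗ[k] V ⊗[k] W) :
    evLin V W f = ∑ i, TensorProduct.lid k W (LinearMap.rTensor W (dbForm V i) (f (dbVec V i))) := by
  simp [evLin]

/-- The trace of a rank one map is a contraction: the sum over the dual basis collapses, leaving a
formula free of the chosen dual basis. -/
lemma evLin_smulRight (l : V →ₗ[k] k) (x : V ⊗[k] W) :
    evLin V W (l.smulRight x) = TensorProduct.lid k W (LinearMap.rTensor W l x) := by
  rw [evLin_apply]
  induction x using TensorProduct.induction_on with
  | zero => simp
  | tmul v u =>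
    simp only [LinearMap.smulRight_apply, map_smul, LinearMap.rTensor_tmul,
      TensorProduct.lid_tmul, smul_smul, ← Finset.sum_smul]
    congr 1
    conv_rhs => rw [← dualBasis_sum V v]
    simp [mul_comm]
  | add x y h h' =>
    simp only [LinearMap.smulRight_apply, map_add, smul_add, map_smul,
      Finset.sum_add_distrib] at h h' ⊢
    rw [h, h']

variable {W} in
lemma evLin_map {W' : Type u} [AddCommGroup W'] [Module k W'] (f : W →ₗ[k] W')
    (g : V →ₗ[k] V ⊗[k] W) :
    evLin V W' (TensorProduct.map LinearMap.id f ∘ₗ g) = f (evLin V W g) := by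
  have h (l : V →ₗ[k] k) (x : V ⊗[k] W) :
      TensorProduct.lid k W' (LinearMap.rTensor W' l (TensorProduct.map LinearMap.id f x)) =
        f (TensorProduct.lid k W (LinearMap.rTensor W l x)) := by
    induction x using TensorProduct.induction_on with
    | zero => simp
    | tmul v u => simp
    | add x y h h' => simp only [map_add, h, h']
  rw [evLin_apply, evLin_apply, map_sum f]
  exact Finset.sum_congr rfl fun i _ => h _ _

/-- This and `ev_coev_lin` are the triangle identities of the adjunction Hom(V, -) ⊣ V ⊗ - for
linear maps. -/
lemma coev_ev_lin (x : V ⊗[k] W) :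
    TensorProduct.map LinearMap.id (evLin V W) (coevLin V (V ⊗[k] W) x) = x := by
  rw [coevLin_apply]
  simp only [map_sum, TensorProduct.map_tmul, LinearMap.id_apply, evLin_smulRight]
  induction x using TensorProduct.induction_on with
  | zero => simp
  | tmul v u =>
    simp only [LinearMap.rTensor_tmul, TensorProduct.lid_tmul, ← TensorProduct.smul_tmul,
      ← TensorProduct.sum_tmul, dualBasis_sum]
  | add x y h h' => simp only [map_add, TensorProduct.tmul_add, Finset.sum_add_distrib, h, h']

lemma ev_coev_lin (f : V →ₗ[k] W) :
    evLin V (V →ₗ[k] W) (coevLin V W ∘ₗ f) = f := by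
  refine LinearMap.ext fun x => ?_
  simp only [evLin_apply, LinearMap.comp_apply, coevLin_apply, map_sum, LinearMap.rTensor_tmul,
    TensorProduct.lid_tmul, LinearMap.sum_apply, LinearMap.smul_apply, LinearMap.smulRight_apply]
  -- Regrouped so that `f` is applied to one double sum; expanding `x` twice in the dual basis
  -- evaluates it.
  rw [Finset.sum_congr rfl fun i _ => Finset.sum_congr rfl fun j _ =>
    smul_comm (dbForm V i (dbVec V j)) (dbForm V j x) (f (dbVec V i))]
  simp only [smul_smul, ← map_smul, ← map_sum]
  congr 1
  conv_rhs => rw [← dualBasis_sum V x]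
  refine Finset.sum_congr rfl fun i _ => ?_
  rw [← Finset.sum_smul]
  congr 1
  conv_rhs => rw [← dualBasis_sum V x]
  simp

end

/-- The linear map underlying the coevaluation. -/
def coevHom (V W : DivPow k d) : W.as →ₗ[k] (tensorObj V (homObj V W)).as := coevLin V.as W.as

/-- The linear map underlying the evaluation. -/
def evHom (V W : DivPow k d) : (homObj V (tensorObj V W)).as →ₗ[k] W.as := evLin V.as W.as

/-- The coevaluation `W ⟶ V ⊗ Hom(V, W)` in `Γ^d P_k`. -/
def coev (V W : DivPow k d) : W ⟶ tensorObj V (homObj V W) := ofLin (coevHom V W)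

/-- The evaluation `Hom(V, V ⊗ W) ⟶ W` in `Γ^d P_k`. -/
def ev (V W : DivPow k d) : homObj V (tensorObj V W) ⟶ W := ofLin (evHom V W)

/-- Both composites are linear operations on the tensor underlying `g`, applied in each factor, so
the identity in Γ^d P_k reduces to the same identity for a linear map. The other naturality
statements for morphisms defined by linear maps are reduced in the same way. -/
lemma coev_naturality (V : DivPow k d) (g : W ⟶ W') :
    g ≫ coev V W' = coev V W ≫ tensorMap (𝟙 V) (homMap (𝟙 V) g) := hom_ext <| by
  rw [coev, coev, ten_comp_ofLin, ten_ofLin_comp, ten_tensorMap_id_left, ten_homMap_id_left,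
    tmap_tmap, tmap_tmap]
  refine tmap_congr (fun f => LinearMap.ext fun w => ?_) _
  change coevLin V.as W'.as (f w) = TensorProduct.map LinearMap.id
    (homB k V.as V.as W.as W'.as LinearMap.id f) (coevLin V.as W.as w)
  rw [coevLin_apply, coevLin_apply, map_sum]
  refine Finset.sum_congr rfl fun i _ => congrArg (dbVec V.as i ⊗ₜ[k] ·) ?_
  ext x
  simp [homB_apply]

/-- The canonical element of V ⊗ V^* is dinatural: pushing the vectors forward along `f` is the same
as pulling back the linear forms. This makes the comparison with Z(V ⊗ -) natural in V. -/
lemma coev_dinaturality (f : V ⟶ V') (W : DivPow k d) :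
    coev V W ≫ tensorMap f (𝟙 (homObj V W)) =
      coev V' W ≫ tensorMap (𝟙 V') (homMap f (𝟙 W)) := hom_ext <| by
  rw [coev, coev, ten_ofLin_comp, ten_ofLin_comp, ten_tensorMap_id_left, ten_homMap_id_right,
    ten_tensorMap_id_right, tmap_tmap, tmap_tmap, tmap_tmap]
  refine tmap_congr (fun f => LinearMap.ext fun w => ?_) _
  change TensorProduct.map f LinearMap.id (coevLin V.as W.as w) = TensorProduct.map LinearMap.id
    (homB k V.as V'.as W.as W.as f LinearMap.id) (coevLin V'.as W.as w)
  have h : ∀ l : V'.as →ₗ[k] k, homB k V.as V'.as W.as W.as f LinearMap.id (l.smulRight w) =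
      ∑ i, l (f (dbVec V.as i)) • (dbForm V.as i).smulRight w := fun l => by
    ext x
    simp only [homB_apply, LinearMap.comp_apply, LinearMap.id_apply, LinearMap.smulRight_apply,
      LinearMap.sum_apply, LinearMap.smul_apply, smul_smul, ← Finset.sum_smul]
    congr 1
    conv_lhs => rw [← dualBasis_sum V.as x]
    simp [mul_comm]
  simp only [coevLin_apply, map_sum, TensorProduct.map_tmul, h, LinearMap.id_apply,
    TensorProduct.tmul_sum, TensorProduct.tmul_smul]
  rw [Finset.sum_comm]
  refine Finset.sum_congr rfl fun i _ => ?_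
  simp only [TensorProduct.smul_tmul', ← TensorProduct.sum_tmul]
  rw [dualBasis_sum]

lemma ev_naturality (V : DivPow k d) (g : W ⟶ W') :
    homMap (𝟙 V) (tensorMap (𝟙 V) g) ≫ ev V W' = ev V W ≫ g := hom_ext <| by
  rw [ev, ev, ten_comp_ofLin, ten_ofLin_comp, ten_homMap_id_left, ten_tensorMap_id_left,
    tmap_tmap, tmap_tmap]
  refine tmap_congr (fun f => LinearMap.ext fun w => ?_) _
  exact evLin_map V.as f w

/-- With `ev_coev`, this makes Hom(V, -) left adjoint to V ⊗ - on Γ^d P_k. Both identities are those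
for linear maps, since unit and counit are d-th powers of linear maps. -/
lemma coev_ev (V W : DivPow k d) :
    coev V (tensorObj V W) ≫ tensorMap (𝟙 V) (ev V W) = 𝟙 (tensorObj V W) := by
  rw [coev, ev, tensorMap_ofLin_right, ofLin_comp, ← ofLin_id]
  exact congrArg ofLin (LinearMap.ext (coev_ev_lin V.as W.as))

lemma ev_coev (V W : DivPow k d) :
    homMap (𝟙 V) (coev V W) ≫ ev V (homObj V W) = 𝟙 (homObj V W) := by
  rw [coev, ev, homMap_ofLin_right, ofLin_comp, ← ofLin_id]
  exact congrArg ofLin (LinearMap.ext (ev_coev_lin V.as W.as))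

end

/-! ### Elements of representations -/

section

variable {k : Type u} [CommRing k] {d : ℕ} {U V W : DivPow k d} {X Y Z : RepGam k d}

/-- The linear map `X(V) → X(W)` induced by a morphism of `Γ^d P_k`. -/
def mp (X : RepGam k d) (f : V ⟶ W) : X.obj.obj V →ₗ[k] X.obj.obj W := (X.obj.map f).hom

/-- The component of a morphism of representations. -/
def ap (h : X ⟶ Y) (V : DivPow k d) : X.obj.obj V →ₗ[k] Y.obj.obj V := (h.hom.app V).hom

lemma mp_id (x : X.obj.obj V) : mp X (𝟙 V) x = x := by rw [mp, X.obj.map_id]; rfl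

lemma mp_comp (f : U ⟶ V) (g : V ⟶ W) (x : X.obj.obj U) : mp X (f ≫ g) x = mp X g (mp X f x) := by
  rw [mp, X.obj.map_comp]; rfl

lemma mp_add (f g : V ⟶ W) (x : X.obj.obj V) : mp X (f + g) x = mp X f x + mp X g x := by
  rw [mp, ((isLinear_iff k d X.obj).mp X.property V W f g 0).1]; rfl

lemma mp_smul (c : k) (f : V ⟶ W) (x : X.obj.obj V) : mp X (c • f) x = c • mp X f x := by
  rw [mp, ((isLinear_iff k d X.obj).mp X.property V W f f c).2]; rfl

lemma mp_zero (x : X.obj.obj V) : mp X (0 : V ⟶ W) x = 0 := by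
  rw [← zero_smul k (0 : V ⟶ W), mp_smul, zero_smul]

lemma mp_square {V' : DivPow k d} {f : U ⟶ V} {g : V ⟶ W} {f' : U ⟶ V'} {g' : V' ⟶ W}
    (h : f ≫ g = f' ≫ g') (x : X.obj.obj U) : mp X g (mp X f x) = mp X g' (mp X f' x) := by
  rw [← mp_comp, ← mp_comp, h]

lemma mp_mp_of_eq {f : U ⟶ V} {g : V ⟶ W} {e : U ⟶ W} (h : f ≫ g = e) (x : X.obj.obj U) :
    mp X g (mp X f x) = mp X e x := by rw [← mp_comp, h]

lemma mp_mp_cancel {f : U ⟶ V} {g : V ⟶ U} (h : f ≫ g = 𝟙 U) (x : X.obj.obj U) :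
    mp X g (mp X f x) = x := by rw [mp_mp_of_eq h, mp_id]

/-- The action of `Γ^d P_k` on a representation, as a linear map in the morphism. -/
def mpLin (X : RepGam k d) (V W : DivPow k d) : (V ⟶ W) →ₗ[k] X.obj.obj V →ₗ[k] X.obj.obj W where
  toFun f := mp X f
  map_add' f g := LinearMap.ext fun x => mp_add f g x
  map_smul' c f := LinearMap.ext fun x => mp_smul c f x

lemma mp_sum {I : Type*} (s : Finset I) (f : I → (V ⟶ W)) (x : X.obj.obj V) :
    mp X (∑ i ∈ s, f i) x = ∑ i ∈ s, mp X (f i) x := by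
  change mpLin X V W _ x = ∑ i ∈ s, mpLin X V W _ x
  rw [map_sum, LinearMap.sum_apply]

lemma ap_mp (h : X ⟶ Y) (f : V ⟶ W) (x : X.obj.obj V) :
    ap h W (mp X f x) = mp Y f (ap h V x) :=
  LinearMap.congr_fun (congrArg ModuleCat.Hom.hom (h.hom.naturality f)) x

lemma ap_comp (h : X ⟶ Y) (g : Y ⟶ Z) (V : DivPow k d) (x : X.obj.obj V) :
    ap (h ≫ g) V x = ap g V (ap h V x) := rfl

lemma ap_id (V : DivPow k d) (x : X.obj.obj V) : ap (𝟙 X) V x = x := rfl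

lemma ap_add (g h : X ⟶ Y) (V : DivPow k d) (x : X.obj.obj V) :
    ap (g + h) V x = ap g V x + ap h V x := rfl

lemma ap_sum {I : Type*} (s : Finset I) (f : I → (X ⟶ Y)) (V : DivPow k d) (x : X.obj.obj V) :
    ap (∑ i ∈ s, f i) V x = ∑ i ∈ s, ap (f i) V x := by
  classical
  induction s using Finset.induction_on with
  | empty => rfl
  | insert a s ha h => rw [Finset.sum_insert ha, Finset.sum_insert ha, ap_add, h]

lemma rep_hom_ext {f g : X ⟶ Y} (h : ∀ V x, ap f V x = ap g V x) : f = g := by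
  apply ObjectProperty.hom_ext
  ext V x
  exact h V x

/-- A morphism of representations from natural linear maps. -/
def repHom (φ : ∀ V, X.obj.obj V →ₗ[k] Y.obj.obj V)
    (nat : ∀ V W (f : V ⟶ W) x, φ W (mp X f x) = mp Y f (φ V x)) : X ⟶ Y :=
  ObjectProperty.homMk
    { app := fun V => ModuleCat.ofHom (φ V)
      naturality := fun V W f => by ext x; exact nat V W f x }

/-! Natural families of functions are linear -/

section

variable (φ : ∀ V, X.obj.obj V → Y.obj.obj V)
  (nat : ∀ V W (f : V ⟶ W) x, φ W (mp X f x) = mp Y f (φ V x))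

include nat

lemma map_smul_of_natural (V : DivPow k d) (c : k) (x : X.obj.obj V) :
    φ V (c • x) = c • φ V x := by
  have h := nat V V (c • 𝟙 V) x
  rwa [mp_smul, mp_smul, mp_id, mp_id] at h

/-- The elements x and y are the two components of one element z of X(V ⊕ V), and x + y is the image
of z under p₁ + p₂. The sum is taken in Γ^d Hom(V ⊕ V, V), where X and Y are linear; it is not the
d-th power of a sum of linear maps. -/
lemma map_add_of_natural (hd : 1 ≤ d) (V : DivPow k d) (x y : X.obj.obj V) :
    φ V (x + y) = φ V x + φ V y := by
  let D : DivPow k d := ⟨FinProj.mk (V.as × V.as)⟩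
  let i₁ : V ⟶ D := ofLin (W := D) (LinearMap.inl k V.as V.as)
  let i₂ : V ⟶ D := ofLin (W := D) (LinearMap.inr k V.as V.as)
  let p₁ : D ⟶ V := ofLin (V := D) (LinearMap.fst k V.as V.as)
  let p₂ : D ⟶ V := ofLin (V := D) (LinearMap.snd k V.as V.as)
  -- This needs `1 ≤ d`: for d = 0 the empty tensor of the zero map is the identity. It is why `hd`
  -- enters the whole theory.
  have zero : ofLin (V := V) (W := V) 0 = 0 := hom_ext <| by
    rw [ten_ofLin]
    exact MultilinearMap.map_coord_zero _ (⟨0, hd⟩ : Fin d) rfl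
  have h₁₁ : i₁ ≫ p₁ = 𝟙 V := (ofLin_comp _ _).trans (congrArg ofLin (LinearMap.fst_comp_inl k _ _))
  have h₂₂ : i₂ ≫ p₂ = 𝟙 V := (ofLin_comp _ _).trans (congrArg ofLin (LinearMap.snd_comp_inr k _ _))
  have h₁₂ : i₁ ≫ p₂ = 0 :=
    ((ofLin_comp _ _).trans (congrArg ofLin (LinearMap.snd_comp_inl k _ _))).trans zero
  have h₂₁ : i₂ ≫ p₁ = 0 :=
    ((ofLin_comp _ _).trans (congrArg ofLin (LinearMap.fst_comp_inr k _ _))).trans zero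
  let z : X.obj.obj D := mp X i₁ x + mp X i₂ y
  have hz₁ : mp X p₁ z = x := by
    rw [map_add, ← mp_comp, ← mp_comp, h₁₁, h₂₁, mp_id, mp_zero, add_zero]
  have hz₂ : mp X p₂ z = y := by
    rw [map_add, ← mp_comp, ← mp_comp, h₂₂, h₁₂, mp_id, mp_zero, zero_add]
  have h := nat D V (p₁ + p₂) z
  rwa [mp_add, mp_add, hz₁, hz₂, ← nat, ← nat, hz₁, hz₂] at h

/-- A morphism of representations from a natural family of functions. -/
def homOfNatural (hd : 1 ≤ d) : X ⟶ Y :=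
  repHom (fun V =>
    { toFun := φ V
      map_add' := map_add_of_natural φ nat hd V
      map_smul' := map_smul_of_natural φ nat V }) nat

end

/-! The Yoneda lemma -/

/-- The morphism `Γ^{d, V} ⟶ X` given by an element of `X(V)`. -/
def ofElt (x : X.obj.obj V) : (yon k d).obj (op V) ⟶ X :=
  repHom (fun W => (mpLin X V W).flip x) fun _ _ g f => mp_comp f g x

/-- The element of `X(V)` given by a morphism `Γ^{d, V} ⟶ X`. -/
def toElt (h : (yon k d).obj (op V) ⟶ X) : X.obj.obj V := ap h V (𝟙 V)

lemma toElt_ofElt (x : X.obj.obj V) : toElt (ofElt x) = x := mp_id x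

lemma ap_eq_mp_toElt (h : (yon k d).obj (op V) ⟶ X) (f : V ⟶ W) : ap h W f = mp X f (toElt h) := by
  refine (congrArg (ap h W) (Category.id_comp f).symm).trans ?_
  exact ap_mp h f (𝟙 V)

lemma ofElt_toElt (h : (yon k d).obj (op V) ⟶ X) : ofElt (toElt h) = h :=
  rep_hom_ext fun _ f => (ap_eq_mp_toElt h f).symm

lemma yon_hom_ext {f g : (yon k d).obj (op V) ⟶ X} (h : toElt f = toElt g) : f = g := by
  rw [← ofElt_toElt f, h, ofElt_toElt]

lemma toElt_comp (h : (yon k d).obj (op V) ⟶ X) (g : X ⟶ Y) : toElt (h ≫ g) = ap g V (toElt h) :=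
  rfl

lemma ofElt_comp (x : X.obj.obj V) (g : X ⟶ Y) : ofElt x ≫ g = ofElt (ap g V x) :=
  yon_hom_ext <| by rw [toElt_comp, toElt_ofElt, toElt_ofElt]

lemma toElt_yon_map (f : V ⟶ W) : toElt ((yon k d).map f.op) = f := Category.comp_id f

lemma toElt_yon_map_comp (f : V ⟶ W) (h : (yon k d).obj (op V) ⟶ X) :
    toElt ((yon k d).map f.op ≫ h) = mp X f (toElt h) := by
  rw [toElt_comp, toElt_yon_map, ap_eq_mp_toElt]

lemma yon_map_comp_ofElt (f : V ⟶ W) (x : X.obj.obj V) :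
    (yon k d).map f.op ≫ ofElt x = ofElt (mp X f x) :=
  yon_hom_ext <| by rw [toElt_yon_map_comp, toElt_ofElt, toElt_ofElt]

end

/-! ### Precomposition with tensor products and internal Homs -/

section

variable {k : Type u} [CommRing k] {d : ℕ} {U V V' W : DivPow k d} {X Y Z : RepGam k d}

/-- The functor `V ⊗ -` on `Γ^d P_k`. -/
def tensorFun (V : DivPow k d) : DivPow k d ⥤ DivPow k d where
  obj W := tensorObj V W
  map g := tensorMap (𝟙 V) g
  map_id W := tensorMap_id V W
  map_comp g g' := tensorMap_comp_right V g g'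

/-- The functor `Hom(V, -)` on `Γ^d P_k`. -/
def homFun (V : DivPow k d) : DivPow k d ⥤ DivPow k d where
  obj W := homObj V W
  map g := homMap (𝟙 V) g
  map_id W := homMap_id V W
  map_comp g g' := homMap_comp_right V g g'

/-- The representation `W ↦ Z(V ⊗ W)`. -/
def tensorShift (V : DivPow k d) (Z : RepGam k d) : RepGam k d where
  obj := tensorFun V ⋙ Z.obj
  property := (isLinear_iff k d _).mpr fun W W' f g c => by
    constructor
    · change Z.obj.map (tensorMap (𝟙 V) (f + g)) = _
      rw [show tensorMap (𝟙 V) (f + g) = tensorMap (𝟙 V) f + tensorMap (𝟙 V) g from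
        (gmap₂ (Fin d) (tensorB k V.as V.as W.as W'.as) (𝟙 V : V ⟶ V)).map_add f g]
      exact ((isLinear_iff k d Z.obj).mp Z.property _ _ _ _ 0).1
    · change Z.obj.map (tensorMap (𝟙 V) (c • f)) = _
      rw [show tensorMap (𝟙 V) (c • f) = c • tensorMap (𝟙 V) f from
        (gmap₂ (Fin d) (tensorB k V.as V.as W.as W'.as) (𝟙 V : V ⟶ V)).map_smul c f]
      exact ((isLinear_iff k d Z.obj).mp Z.property _ _ _ 0 _).2

/-- The representation `W ↦ Z(Hom(V, W))`. -/
def homShift (V : DivPow k d) (Z : RepGam k d) : RepGam k d where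
  obj := homFun V ⋙ Z.obj
  property := (isLinear_iff k d _).mpr fun W W' f g c => by
    constructor
    · change Z.obj.map (homMap (𝟙 V) (f + g)) = _
      rw [show homMap (𝟙 V) (f + g) = homMap (𝟙 V) f + homMap (𝟙 V) g from
        (gmap₂ (Fin d) (homB k V.as V.as W.as W'.as) (𝟙 V : V ⟶ V)).map_add f g]
      exact ((isLinear_iff k d Z.obj).mp Z.property _ _ _ _ 0).1
    · change Z.obj.map (homMap (𝟙 V) (c • f)) = _
      rw [show homMap (𝟙 V) (c • f) = c • homMap (𝟙 V) f from
        (gmap₂ (Fin d) (homB k V.as V.as W.as W'.as) (𝟙 V : V ⟶ V)).map_smul c f]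
      exact ((isLinear_iff k d Z.obj).mp Z.property _ _ _ 0 _).2

lemma tensorMap_swap (f : V ⟶ V') {W W' : DivPow k d} (g : W ⟶ W') :
    tensorMap f (𝟙 W) ≫ tensorMap (𝟙 V') g = tensorMap (𝟙 V) g ≫ tensorMap f (𝟙 W') := by
  rw [← tensorMap_comp, ← tensorMap_comp, Category.id_comp, Category.id_comp, Category.comp_id,
    Category.comp_id]

/-- The functor `Z ↦ Z(V ⊗ -)`, functorial in `V`. -/
def shiftFunctor (k : Type u) [CommRing k] (d : ℕ) : DivPow k d ⥤ RepGam k d ⥤ RepGam k d where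
  obj V :=
    { obj := tensorShift V
      map := fun {Z Z'} h => repHom (X := tensorShift V Z) (Y := tensorShift V Z')
        (fun W => ap h (tensorObj V W)) fun W W' f x => ap_mp h (tensorMap (𝟙 V) f) x
      map_id := fun Z => rfl
      map_comp := fun f g => rfl }
  map {V V'} f :=
    { app := fun Z => repHom (X := tensorShift V Z) (Y := tensorShift V' Z)
        (fun W => mp Z (tensorMap f (𝟙 W))) fun W W' g x => by
          exact mp_square (X := Z) (tensorMap_swap f g).symm x
      naturality := fun Z Z' h => rep_hom_ext fun W x => (ap_mp h _ x).symm }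
  map_id V := by
    ext1; funext Z
    refine rep_hom_ext fun W x => ?_
    exact (congrArg (fun f => mp Z f x) (tensorMap_id V W)).trans (mp_id (X := Z) x)
  map_comp f g := by
    ext1; funext Z
    refine rep_hom_ext fun W x => ?_
    exact (mp_mp_of_eq (X := Z) (tensorMap_comp_left f g W).symm x).symm

end

/-! ### Natural bilinear families -/

/-- Families of maps `X(V) × Y(W) → Z(V ⊗ W)`, natural in `V` and `W`. -/
@[ext]
structure Bil {k : Type u} [CommRing k] {d : ℕ} (X Y Z : RepGam k d) where
  /-- The components of the family. -/
  toFun : ∀ V W : DivPow k d, X.obj.obj V → Y.obj.obj W → Z.obj.obj (tensorObj V W)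
  nat_left : ∀ {V V' : DivPow k d} (f : V ⟶ V') (W : DivPow k d) (x : X.obj.obj V)
    (y : Y.obj.obj W), toFun V' W (mp X f x) y = mp Z (tensorMap f (𝟙 W)) (toFun V W x y)
  nat_right : ∀ (V : DivPow k d) {W W' : DivPow k d} (g : W ⟶ W') (x : X.obj.obj V)
    (y : Y.obj.obj W), toFun V W' x (mp Y g y) = mp Z (tensorMap (𝟙 V) g) (toFun V W x y)

section

variable {k : Type u} [CommRing k] {d : ℕ} {U V V' W W' : DivPow k d} {X Y Y' Z Z' : RepGam k d}

/-- Postcomposition of a bilinear family with a morphism. -/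
def Bil.postcomp (b : Bil X Y Z) (h : Z ⟶ Z') : Bil X Y Z' where
  toFun V W x y := ap h _ (b.toFun V W x y)
  nat_left f W x y := by rw [b.nat_left, ap_mp]
  nat_right V W W' g x y := by rw [b.nat_right, ap_mp]

/-- Precomposition of a bilinear family with a morphism in the second argument. -/
def Bil.precomp (b : Bil X Y Z) (h : Y' ⟶ Y) : Bil X Y' Z where
  toFun V W x y := b.toFun V W x (ap h W y)
  nat_left f W x y := b.nat_left f W x _
  nat_right V W W' g x y := by rw [ap_mp, b.nat_right]

/-! ### The universal property of the internal tensor product -/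

variable (k d) in
/-- The functor `V, W ↦ Γ^{d, V ⊗ W}`. -/
abbrev yonTensor : (DivPow k d)ᵒᵖ ⥤ (DivPow k d)ᵒᵖ ⥤ RepGam k d :=
  opTensor ⋙ (Functor.whiskeringRight _ _ _).obj (yon k d)

/-- The functor `Γ^{d, V} ⊗ -`. -/
def yonTensorRep (V : DivPow k d) : RepGam k d ⥤ RepGam k d :=
  (yon k d).lan.obj ((yonTensor k d).obj (op V))

/-- The natural transformation `Γ^{d, V'} ⊗ - ⟶ Γ^{d, V} ⊗ -` induced by `V ⟶ V'`. -/
def yonTensorRepMap (f : V ⟶ V') : yonTensorRep V' ⟶ yonTensorRep V :=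
  (yon k d).lan.map ((yonTensor k d).map f.op)

/-- The canonical morphism `Γ^{d, V ⊗ W} ⟶ Γ^{d, V} ⊗ Γ^{d, W}`. -/
def innerUnit (V W : DivPow k d) :
    (yon k d).obj (op (tensorObj V W)) ⟶ (yonTensorRep V).obj ((yon k d).obj (op W)) :=
  ((yon k d).lanUnit.app ((yonTensor k d).obj (op V))).app (op W)

lemma innerUnit_right (V : DivPow k d) (g : W ⟶ W') :
    (yon k d).map (tensorMap (𝟙 V) g).op ≫ innerUnit V W =
      innerUnit V W' ≫ (yonTensorRep V).map ((yon k d).map g.op) :=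
  ((yon k d).lanUnit.app ((yonTensor k d).obj (op V))).naturality g.op

lemma innerUnit_left (f : V ⟶ V') (W : DivPow k d) :
    (yon k d).map (tensorMap f (𝟙 W)).op ≫ innerUnit V W =
      innerUnit V' W ≫ (yonTensorRepMap f).app ((yon k d).obj (op W)) :=
  congrArg (fun t => NatTrans.app t (op W))
    ((yon k d).lanUnit.naturality ((yonTensor k d).map f.op))

/-- The canonical natural transformation from `Γ^{d, V} ⊗ -` as a colimit in the second argument
to `Γ^{d, V} ⊗ -` as a functor of two arguments. -/
def outerUnit (V : DivPow k d) : yonTensorRep V ⟶ (internalTensor k d).obj ((yon k d).obj (op V)) :=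
  ((yon k d).lanUnit.app (yonTensor k d ⋙ (yon k d).lan)).app (op V)

lemma outerUnit_naturality (f : V ⟶ V') :
    yonTensorRepMap f ≫ outerUnit V =
      outerUnit V' ≫ (internalTensor k d).map ((yon k d).map f.op) :=
  ((yon k d).lanUnit.app (yonTensor k d ⋙ (yon k d).lan)).naturality f.op

/-- The structure morphism `Γ^{d, V ⊗ W} ⟶ Γ^{d, V} ⊗ Y` of the colimit given by an element
of `Y(W)`. -/
def innerLeg (V : DivPow k d) (y : Y.obj.obj W) :
    (yon k d).obj (op (tensorObj V W)) ⟶ (yonTensorRep V).obj Y :=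
  innerUnit V W ≫ (yonTensorRep V).map (ofElt y)

/-- The structure morphism `Γ^{d, V} ⊗ Y ⟶ X ⊗ Y` of the colimit given by an element of `X(V)`. -/
def outerLeg (x : X.obj.obj V) (Y : RepGam k d) :
    (yonTensorRep V).obj Y ⟶ ((internalTensor k d).obj X).obj Y :=
  (outerUnit V).app Y ≫ ((internalTensor k d).map (ofElt x)).app Y

lemma innerLeg_mp (V : DivPow k d) (g : W ⟶ W') (y : Y.obj.obj W) :
    innerLeg V (mp Y g y) = (yon k d).map (tensorMap (𝟙 V) g).op ≫ innerLeg V y := by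
  rw [innerLeg, innerLeg, ← yon_map_comp_ofElt, Functor.map_comp, ← Category.assoc,
    ← innerUnit_right, Category.assoc]

lemma innerLeg_left (f : V ⟶ V') (y : Y.obj.obj W) :
    innerLeg V' y ≫ (yonTensorRepMap f).app Y =
      (yon k d).map (tensorMap f (𝟙 W)).op ≫ innerLeg V y := by
  rw [innerLeg, innerLeg, Category.assoc, NatTrans.naturality, ← Category.assoc,
    ← innerUnit_left, Category.assoc]

lemma outerLeg_mp (f : V ⟶ V') (x : X.obj.obj V) (Y : RepGam k d) :
    outerLeg (mp X f x) Y = (yonTensorRepMap f).app Y ≫ outerLeg x Y := by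
  rw [outerLeg, outerLeg, ← yon_map_comp_ofElt, Functor.map_comp, ← NatTrans.comp_app,
    ← NatTrans.comp_app, ← NatTrans.comp_app, ← Category.assoc, ← Category.assoc,
    outerUnit_naturality]

lemma outerLeg_map (x : X.obj.obj V) (h : Y ⟶ Y') :
    outerLeg x Y ≫ ((internalTensor k d).obj X).map h = (yonTensorRep V).map h ≫ outerLeg x Y' := by
  rw [outerLeg, outerLeg, ← NatTrans.comp_app, ← NatTrans.comp_app, NatTrans.naturality]

lemma innerLeg_map (V : DivPow k d) (y : Y.obj.obj W) (h : Y ⟶ Y') :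
    innerLeg V y ≫ (yonTensorRep V).map h = innerLeg V (ap h W y) := by
  rw [innerLeg, innerLeg, Category.assoc, ← Functor.map_comp, ofElt_comp]

/-- `Γ^{d, V} ⊗ Y` is a colimit. -/
def innerIsColimit (V : DivPow k d) (Y : RepGam k d) :=
  (yon k d).isPointwiseLeftKanExtensionLeftKanExtensionUnit ((yonTensor k d).obj (op V)) Y

lemma innerLeg_hom_ext {V : DivPow k d} {f g : (yonTensorRep V).obj Y ⟶ Z}
    (h : ∀ W (y : Y.obj.obj W), innerLeg V y ≫ f = innerLeg V y ≫ g) : f = g := by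
  refine (innerIsColimit V Y).hom_ext fun j => ?_
  have := h j.left.unop (toElt j.hom)
  rw [innerLeg, ofElt_toElt] at this
  exact this

/-- The colimit property of `Γ^{d, V} ⊗ Y`. -/
lemma exists_inner_desc (V : DivPow k d) (b : ∀ W, Y.obj.obj W → Z.obj.obj (tensorObj V W))
    (hb : ∀ W W' (g : W ⟶ W') y, b W' (mp Y g y) = mp Z (tensorMap (𝟙 V) g) (b W y)) :
    ∃ f : (yonTensorRep V).obj Y ⟶ Z, ∀ W y, innerLeg V y ≫ f = ofElt (b W y) := by
  -- By Yoneda, a leg from Γ^{d, V ⊗ W} is an element of Z(V ⊗ W), and compatibility of the legs is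
  -- the naturality `hb`.
  let s : Cocone (CostructuredArrow.proj (yon k d) Y ⋙ (yonTensor k d).obj (op V)) :=
    { pt := Z
      ι :=
        { app := fun j => ofElt (b j.left.unop (toElt j.hom))
          naturality := fun j j' φ => by
            refine Eq.trans ?_ (Category.comp_id _).symm
            have w := congrArg toElt (CostructuredArrow.w φ)
            refine (yon_map_comp_ofElt (X := Z) (tensorMap (𝟙 V) φ.left.unop) _).trans ?_
            refine congrArg ofElt ?_
            refine (hb _ _ φ.left.unop _).symm.trans (congrArg _ ?_)
            exact (toElt_yon_map_comp φ.left.unop j'.hom).symm.trans w } }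
  refine ⟨(innerIsColimit V Y).desc s, fun W y => ?_⟩
  refine Eq.trans ?_ (((innerIsColimit V Y).fac s (CostructuredArrow.mk (ofElt y))).trans ?_)
  · rfl
  · change ofElt (b W (toElt (ofElt y))) = _
    rw [toElt_ofElt]

/-- `X ⊗ Y` as a colimit. -/
def outerIsColimit (X Y : RepGam k d) :=
  isColimitOfPreserves ((evaluation (RepGam k d) (RepGam k d)).obj Y)
    ((yon k d).isPointwiseLeftKanExtensionLeftKanExtensionUnit (yonTensor k d ⋙ (yon k d).lan) X)

lemma outerLeg_hom_ext {f g : ((internalTensor k d).obj X).obj Y ⟶ Z}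
    (h : ∀ V (x : X.obj.obj V), outerLeg x Y ≫ f = outerLeg x Y ≫ g) : f = g := by
  refine (outerIsColimit X Y).hom_ext fun j => ?_
  have := h j.left.unop (toElt j.hom)
  rw [outerLeg, ofElt_toElt] at this
  exact this

/-- The colimit property of `X ⊗ Y`. -/
lemma exists_outer_desc
    (b : ∀ V, X.obj.obj V → ((yonTensorRep V).obj Y ⟶ Z))
    (hb : ∀ V V' (f : V ⟶ V') x,
      b V' (mp X f x) = (yonTensorRepMap f).app Y ≫ b V x) :
    ∃ f : ((internalTensor k d).obj X).obj Y ⟶ Z, ∀ V x, outerLeg x Y ≫ f = b V x := by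
  let s : Cocone ((CostructuredArrow.proj (yon k d) X ⋙ (yonTensor k d ⋙ (yon k d).lan)) ⋙
      (evaluation (RepGam k d) (RepGam k d)).obj Y) :=
    { pt := Z
      ι :=
        { app := fun j => b j.left.unop (toElt j.hom)
          naturality := fun j j' φ => by
            refine Eq.trans ?_ (Category.comp_id _).symm
            have w := congrArg toElt (CostructuredArrow.w φ)
            refine (hb _ _ φ.left.unop _).symm.trans (congrArg _ ?_)
            exact (toElt_yon_map_comp φ.left.unop j'.hom).symm.trans w } }
  refine ⟨(outerIsColimit X Y).desc s, fun V x => ?_⟩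
  refine Eq.trans ?_ (((outerIsColimit X Y).fac s (CostructuredArrow.mk (ofElt x))).trans ?_)
  · rfl
  · change b V (toElt (ofElt x)) = _
    rw [toElt_ofElt]

/-- The universal bilinear family `X(V) × Y(W) → (X ⊗ Y)(V ⊗ W)`. -/
def tensorBil (X Y : RepGam k d) : Bil X Y (((internalTensor k d).obj X).obj Y) where
  toFun V W x y := toElt (innerLeg V y ≫ outerLeg x Y)
  nat_left f W x y := by
    rw [outerLeg_mp, ← Category.assoc, innerLeg_left, Category.assoc, toElt_yon_map_comp]
  nat_right V W W' g x y := by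
    rw [innerLeg_mp, Category.assoc, toElt_yon_map_comp]

/-- A morphism out of the iterated colimit is a compatible family of morphisms Γ^{d, V ⊗ W} → Z
indexed by x in X(V) and y in Y(W). By Yoneda these are elements of Z(V ⊗ W), and compatibility is
naturality in V and W. -/
lemma tensorBil_postcomp_bijective (X Y Z : RepGam k d) :
    Function.Bijective fun f : ((internalTensor k d).obj X).obj Y ⟶ Z =>
      (tensorBil X Y).postcomp f := by
  constructor
  · intro f g h
    refine outerLeg_hom_ext fun V x => innerLeg_hom_ext fun W y => yon_hom_ext ?_
    have := congrFun (congrFun (congrFun (congrFun (congrArg Bil.toFun h) V) W) x) y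
    rw [← Category.assoc, ← Category.assoc]
    exact this
  · intro b
    choose f hf using fun V x => exists_inner_desc V (fun W y => b.toFun V W x y)
      fun W W' g y => b.nat_right V g x y
    obtain ⟨g, hg⟩ := exists_outer_desc f fun V V' φ x => innerLeg_hom_ext fun W y => by
      rw [hf, ← Category.assoc, innerLeg_left, Category.assoc, hf, yon_map_comp_ofElt, b.nat_left]
    refine ⟨g, ?_⟩
    ext V W x y
    change toElt ((innerLeg V y ≫ outerLeg x Y) ≫ g) = _
    rw [Category.assoc, hg, hf, toElt_ofElt]

lemma tensorBil_map (X : RepGam k d) (h : Y ⟶ Y') :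
    (tensorBil X Y).postcomp (((internalTensor k d).obj X).map h) =
      (tensorBil X Y').precomp h := by
  ext V W x y
  change toElt ((innerLeg V y ≫ outerLeg x Y) ≫ ((internalTensor k d).obj X).map h) =
    toElt (innerLeg V (ap h W y) ≫ outerLeg x Y')
  congr 1
  rw [Category.assoc, outerLeg_map, ← Category.assoc, innerLeg_map]

end

/-! ### The universal property of the internal Hom -/

section

variable {k : Type u} [CommRing k] {d : ℕ} {U V V' W W' : DivPow k d} {X Y Y' Z Z' : RepGam k d}

variable (k d) in
/-- The functor `V, W ↦ Γ^{d, Hom(V, W)}`. -/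
abbrev yonHom : DivPow k d ⥤ (DivPow k d)ᵒᵖ ⥤ RepGam k d :=
  opHom ⋙ (Functor.whiskeringRight _ _ _).obj (yon k d)

/-- The morphism `Γ^{d, Hom(V, W)} ⟶ Γ^{d, W}(V ⊗ -)` given by the coevaluation. -/
def coevYon (V W : DivPow k d) :
    (yon k d).obj (op (homObj V W)) ⟶ tensorShift V ((yon k d).obj (op W)) :=
  ofElt (X := tensorShift V ((yon k d).obj (op W))) (coev V W)

lemma toElt_coevYon_comp (V W : DivPow k d) (h : (yon k d).obj (op W) ⟶ Z) :
    toElt (coevYon V W ≫ ((shiftFunctor k d).obj V).map h) = mp Z (coev V W) (toElt h) := by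
  refine (congrArg (ap (((shiftFunctor k d).obj V).map h) (homObj V W)) (toElt_ofElt _)).trans ?_
  exact ap_eq_mp_toElt h (coev V W)

lemma toElt_coevYon (V W : DivPow k d) :
    toElt (coevYon V W) = (show W ⟶ tensorObj V (homObj V W) from coev V W) := toElt_ofElt _

/-- The natural transformation whose components are the morphisms `coevYon V W`. -/
def coevNat (V : DivPow k d) :
    (yonHom k d).obj V ⟶ yon k d ⋙ (shiftFunctor k d).obj V where
  app W := coevYon V W.unop
  naturality W W' g := by
    refine yon_hom_ext (V := homObj V W.unop) (X := tensorShift V ((yon k d).obj W')) ?_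
    refine (toElt_yon_map_comp (homMap (𝟙 V) g.unop) (coevYon V W'.unop)).trans ?_
    refine Eq.trans ?_ (toElt_coevYon_comp V W.unop ((yon k d).map g)).symm
    refine (congrArg (mp (tensorShift V ((yon k d).obj W')) _) (toElt_coevYon V W'.unop)).trans ?_
    refine Eq.trans ?_ (congrArg (mp ((yon k d).obj W') (coev V W.unop))
      (toElt_yon_map g.unop)).symm
    exact (coev_naturality V g.unop).symm

lemma coevNat_naturality (f : V ⟶ V') :
    (yonHom k d).map f ≫ coevNat V' =
      coevNat V ≫ Functor.whiskerLeft (yon k d) ((shiftFunctor k d).map f) := by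
  ext1
  funext W
  refine yon_hom_ext (V := homObj V W.unop) (X := tensorShift V' ((yon k d).obj W)) ?_
  refine (toElt_yon_map_comp (homMap f (𝟙 W.unop)) (coevYon V' W.unop)).trans ?_
  refine (congrArg (mp (tensorShift V' ((yon k d).obj W)) _) (toElt_coevYon V' W.unop)).trans ?_
  refine Eq.trans ?_ (congrArg (ap (((shiftFunctor k d).map f).app ((yon k d).obj W))
    (homObj V W.unop)) (toElt_coevYon V W.unop)).symm
  exact (coev_dinaturality f W.unop).symm

/-- `Z(V ⊗ -)` is the colimit of `Γ^{d, Hom(V, W)}` over all `Γ^{d, W} ⟶ Z`. -/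
def shiftIsPointwise (hd : 1 ≤ d) (V : DivPow k d) :
    (Functor.LeftExtension.mk ((shiftFunctor k d).obj V)
      (coevNat V)).IsPointwiseLeftKanExtension := fun Z =>
  -- An element z of Z(V ⊗ U) is a morphism from Γ^{d, V ⊗ U}, so the cocone has a leg Γ^{d, Hom(V,
  -- V ⊗ U)} → pt at z. Its value at the evaluation Hom(V, V ⊗ U) → U is the image of z. Linearity
  -- in z follows from naturality in U.
  { desc := fun s => homOfNatural (X := tensorShift V Z) (Y := s.pt)
      (fun U z => ap (s.ι.app (CostructuredArrow.mk (ofElt (V := tensorObj V U) z))) U (ev V U))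
      (fun U U' g z => by
        let z₀ : Z.obj.obj (tensorObj V U) := z
        let φ : CostructuredArrow.mk (ofElt (mp Z (tensorMap (𝟙 V) g) z₀)) ⟶
            CostructuredArrow.mk (ofElt z₀) :=
          CostructuredArrow.homMk (tensorMap (𝟙 V) g).op (yon_map_comp_ofElt _ _)
        have w := congrArg (fun t => ap t U' (ev V U')) (s.w φ)
        refine Eq.trans w.symm ?_
        refine Eq.trans ?_ (ap_mp (s.ι.app (CostructuredArrow.mk (ofElt z₀))) g (ev V U))
        exact congrArg (ap (s.ι.app (CostructuredArrow.mk (ofElt z₀))) U') (ev_naturality V g))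
      hd
    -- The coevaluation gives a morphism in the index category; compatibility of the legs along it
    -- reduces the claim to the triangle identity `ev_coev`.
    fac := fun s j => by
      refine yon_hom_ext (V := homObj V j.left.unop) ?_
      let W : DivPow k d := j.left.unop
      let φ : CostructuredArrow.mk (ofElt (mp Z (coev V W) (toElt j.hom))) ⟶ j :=
        CostructuredArrow.homMk (coev V W).op <| yon_hom_ext <|
          (toElt_yon_map_comp (coev V W) j.hom).trans (toElt_ofElt _).symm
      have w := congrArg (fun t => ap t (homObj V W) (ev V (homObj V W))) (s.w φ)
      have e := toElt_coevYon_comp V W j.hom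
      let S (z : Z.obj.obj (tensorObj V (homObj V W))) : s.pt.obj.obj (homObj V W) :=
        ap (s.ι.app (CostructuredArrow.mk (ofElt z))) (homObj V W) (ev V (homObj V W))
      refine (congrArg S e).trans ?_
      refine w.symm.trans ?_
      exact congrArg (ap (s.ι.app j) (homObj V W)) (ev_coev V W)
    -- By `coev_ev`, every z is the image under the evaluation of an element in the range of a
    -- structure map, so its image under `m` is forced.
    uniq := fun s m hm => by
      refine rep_hom_ext (X := tensorShift V Z) fun U z => ?_
      let z₀ : Z.obj.obj (tensorObj V U) := z
      have h := congrArg (fun t => ap t U (ev V U)) (hm (CostructuredArrow.mk (ofElt z₀)))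
      refine Eq.trans (congrArg (ap m U) ?_) h
      have e : coev V (tensorObj V U) ≫ tensorMap (𝟙 V) (ev V U) = 𝟙 (tensorObj V U) := coev_ev V U
      exact ((congrArg (fun f => mp Z f z₀) e).trans (mp_id z₀)).symm }

/-- The natural transformation `ℋom(Γ^{d, V}, -) ⟶ (Z ↦ Z(V ⊗ -))`. -/
def homToShiftApp (V : DivPow k d) :
    (yon k d).lan.obj ((yonHom k d).obj V) ⟶ (shiftFunctor k d).obj V :=
  (((yon k d).lanAdjunction (RepGam k d)).homEquiv ((yonHom k d).obj V)
    ((shiftFunctor k d).obj V)).symm (coevNat V)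

lemma homToShiftApp_naturality (f : V ⟶ V') :
    (yon k d).lan.map ((yonHom k d).map f) ≫ homToShiftApp V' =
      homToShiftApp V ≫ (shiftFunctor k d).map f := by
  have h₁ := ((yon k d).lanAdjunction (RepGam k d)).homEquiv_naturality_left_symm
    (Y := (shiftFunctor k d).obj V') ((yonHom k d).map f) (coevNat V')
  have h₂ := ((yon k d).lanAdjunction (RepGam k d)).homEquiv_naturality_right_symm
    (X := (yonHom k d).obj V) (coevNat V) ((shiftFunctor k d).map f)
  have h₃ := congrArg (((yon k d).lanAdjunction (RepGam k d)).homEquiv ((yonHom k d).obj V)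
    ((shiftFunctor k d).obj V')).symm (coevNat_naturality f)
  exact h₁.symm.trans (h₃.trans h₂)

/-- The natural transformation from the functors `ℋom(Γ^{d, V}, -)` to the functors
`Z ↦ Z(V ⊗ -)`. -/
def homToShift (k : Type u) [CommRing k] (d : ℕ) :
    yonHom k d ⋙ (yon k d).lan ⟶ shiftFunctor k d where
  app V := homToShiftApp V
  naturality _ _ f := homToShiftApp_naturality f

/-- Source and target are both left Kan extensions along the Yoneda embedding of W ↦ Γ^{d, Hom(V,
W)}, and this is the comparison map between them. -/
lemma isIso_homToShift (hd : 1 ≤ d) (V : DivPow k d) :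
    IsIso ((homToShift k d).app V) :=
  ((yon k d).isIso_lanAdjunction_homEquiv_symm_iff (coevNat V)).mpr
    (shiftIsPointwise hd V).isLeftKanExtension

lemma isIso_homToShift_app (hd : 1 ≤ d) (V : DivPow k d) (Z : RepGam k d) :
    IsIso (((homToShift k d).app V).app Z) := by
  have := isIso_homToShift (k := k) hd V
  exact Functor.map_isIso ((evaluation (RepGam k d) (RepGam k d)).obj Z) ((homToShift k d).app V)

/-- The natural transformation `ℋom(Γ^{d, V}, -) ⟶ (Z ↦ Z(V ⊗ -))`, for `ℋom` as a functor of
two arguments. -/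
def homUnit (V : DivPow k d) :
    (internalHom k d).obj (op ((yon k d).obj (op V))) ⟶ (shiftFunctor k d).obj V :=
  ((yon k d).rightOp.ranCounit.app (yonHom k d ⋙ (yon k d).lan)).app V ≫ (homToShift k d).app V

lemma homUnit_naturality (f : V ⟶ V') :
    (internalHom k d).map ((yon k d).map f.op).op ≫ homUnit V' =
      homUnit V ≫ (shiftFunctor k d).map f := by
  have h₁ := ((yon k d).rightOp.ranCounit.app (yonHom k d ⋙ (yon k d).lan)).naturality f
  have h₂ := (homToShift k d).naturality f
  exact (Category.assoc _ _ _).symm.trans ((congrArg (· ≫ _) h₁).trans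
    ((Category.assoc _ _ _).trans ((congrArg (_ ≫ ·) h₂).trans (Category.assoc _ _ _).symm)))

/-- The structure morphism `ℋom(X, Z) ⟶ Z(V ⊗ -)` of the limit given by an element of `X(V)`. -/
def homLeg (x : X.obj.obj V) (Z : RepGam k d) :
    ((internalHom k d).obj (op X)).obj Z ⟶ ((shiftFunctor k d).obj V).obj Z :=
  ((internalHom k d).map (ofElt x).op).app Z ≫ (homUnit V).app Z

lemma homLeg_mp (f : V ⟶ V') (x : X.obj.obj V) (Z : RepGam k d) :
    homLeg (mp X f x) Z = homLeg x Z ≫ ((shiftFunctor k d).map f).app Z := by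
  rw [homLeg, homLeg, ← yon_map_comp_ofElt, op_comp, Functor.map_comp, ← NatTrans.comp_app,
    ← NatTrans.comp_app, ← NatTrans.comp_app, Category.assoc, homUnit_naturality, Category.assoc]

lemma homLeg_map (x : X.obj.obj V) (h : Z ⟶ Z') :
    ((internalHom k d).obj (op X)).map h ≫ homLeg x Z' =
      homLeg x Z ≫ ((shiftFunctor k d).obj V).map h := by
  rw [homLeg, homLeg, ← NatTrans.comp_app, ← NatTrans.comp_app, NatTrans.naturality]

instance hasLimitsOfShape_repGam (X : (RepGam k d)ᵒᵖ) :
    HasLimitsOfShape (StructuredArrow X (yon k d).rightOp) (RepGam k d) := inferInstance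

instance hasLimitsOfShape_functor (X : (RepGam k d)ᵒᵖ) :
    HasLimitsOfShape (StructuredArrow X (yon k d).rightOp) (RepGam k d ⥤ RepGam k d) :=
  functorCategoryHasLimitsOfShape

instance hasPointwiseRightKanExtension (F : DivPow k d ⥤ RepGam k d ⥤ RepGam k d) :
    (yon k d).rightOp.HasPointwiseRightKanExtension F := fun X =>
  (hasLimitsOfShape_functor X).has_limit _

/-- `ℋom(X, Z)` is a limit. -/
def homIsLimit (X Z : RepGam k d) :=
  (evaluation_preservesLimitsOfShape (J := StructuredArrow (op X) (yon k d).rightOp)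
    (C := RepGam k d) (K := RepGam k d) Z).preservesLimit.preserves
    ((yon k d).rightOp.isPointwiseRightKanExtensionRanCounit (yonHom k d ⋙ (yon k d).lan)
      (op X)) |>.some

/-- The legs are the limit projections followed by the isomorphisms ℋom(Γ^{d,V}, Z) ≅ Z(V ⊗ -),
which can be cancelled. -/
lemma homLeg_hom_ext (hd : 1 ≤ d) {f g : Y ⟶ ((internalHom k d).obj (op X)).obj Z}
    (h : ∀ V (x : X.obj.obj V), f ≫ homLeg x Z = g ≫ homLeg x Z) : f = g := by
  refine (homIsLimit X Z).hom_ext fun j => ?_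
  refine (@cancel_mono _ _ _ _ _ (((homToShift k d).app j.right).app Z)
    (@IsIso.mono_of_iso _ _ _ _ _ (isIso_homToShift_app hd j.right Z)) _ _).mp ?_
  have e := h j.right (toElt j.hom.unop)
  rw [homLeg, ofElt_toElt] at e
  exact (Category.assoc _ _ _).trans (e.trans (Category.assoc _ _ _).symm)

/-- The limit property of `ℋom(X, Z)`. -/
lemma exists_hom_lift (hd : 1 ≤ d)
    (b : ∀ V, X.obj.obj V → (Y ⟶ ((shiftFunctor k d).obj V).obj Z))
    (hb : ∀ V V' (f : V ⟶ V') x, b V' (mp X f x) = b V x ≫ ((shiftFunctor k d).map f).app Z) :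
    ∃ f : Y ⟶ ((internalHom k d).obj (op X)).obj Z, ∀ V x, f ≫ homLeg x Z = b V x := by
  -- The limit is formed from the ℋom(Γ^{d,V}, Z), so the given morphisms to Z(V ⊗ -) are
  -- transported back along the inverses `i`.
  choose i hi hi' using fun V => (isIso_homToShift_app (k := k) hd V Z).out
  let s : Cone ((StructuredArrow.proj (op X) (yon k d).rightOp ⋙ (yonHom k d ⋙ (yon k d).lan)) ⋙
      (evaluation (RepGam k d) (RepGam k d)).obj Z) :=
    { pt := Y
      π :=
        { app := fun j => b j.right (toElt j.hom.unop) ≫ i j.right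
          naturality := fun j j' φ => by
            refine (Category.id_comp _).trans ?_
            have n := congrArg (fun t => NatTrans.app t Z) ((homToShift k d).naturality φ.right)
            have w : toElt j'.hom.unop = mp X φ.right (toElt j.hom.unop) :=
              (congrArg (fun t => toElt (Quiver.Hom.unop t)) (StructuredArrow.w φ).symm).trans
                (toElt_yon_map_comp φ.right j.hom.unop)
            rw [w, hb]
            -- The inverses `i` inherit naturality in V from `homToShift`.
            have e : i j.right ≫ ((yonHom k d ⋙ (yon k d).lan).map φ.right).app Z =
                ((shiftFunctor k d).map φ.right).app Z ≫ i j'.right := by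
              have n' := congrArg (fun t => i j.right ≫ t ≫ i j'.right) n
              refine Eq.trans ?_ (n'.trans ?_)
              · refine congrArg (i j.right ≫ ·) ?_
                refine Eq.trans ?_ (Category.assoc _ _ _).symm
                exact (Category.comp_id _).symm.trans (congrArg (_ ≫ ·) (hi j'.right).symm)
              · refine (congrArg (i j.right ≫ ·) (Category.assoc _ _ _)).trans ?_
                refine (Category.assoc _ _ _).symm.trans ?_
                exact (congrArg (· ≫ _) (hi' j.right)).trans (Category.id_comp _)
            refine (Category.assoc _ _ _).trans (Eq.trans ?_ (Category.assoc _ _ _).symm)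
            exact congrArg (b j.right _ ≫ ·) e.symm } }
  refine ⟨(homIsLimit X Z).lift s, fun V x => ?_⟩
  have := (homIsLimit X Z).fac s (StructuredArrow.mk (Y := V) (ofElt x).op)
  have h : s.π.app (StructuredArrow.mk (Y := V) (ofElt x).op) ≫ ((homToShift k d).app V).app Z =
      b V x := by
    refine (Category.assoc _ _ _).trans ((congrArg (_ ≫ ·) (hi' V)).trans ?_)
    refine (Category.comp_id _).trans ?_
    exact congrArg (b V) (toElt_ofElt x)
  rw [← this] at h
  exact (Category.assoc _ _ _).symm.trans h

/-- The couniversal bilinear family attached to `ℋom(X, Z)`. -/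
def homBil (X Z : RepGam k d) : Bil X (((internalHom k d).obj (op X)).obj Z) Z where
  toFun V W x y := ap (homLeg x Z) W y
  nat_left f W x y := by rw [homLeg_mp]; rfl
  nat_right V W W' g x y := ap_mp (homLeg x Z) g y

/-- A morphism into the limit is a compatible family of morphisms Y → Z(V ⊗ -) indexed by x in X(V),
which is a bilinear family. Its components are mere functions, and linearity in the second argument
comes from naturality. -/
lemma homBil_precomp_bijective (hd : 1 ≤ d) (X Y Z : RepGam k d) :
    Function.Bijective fun f : Y ⟶ ((internalHom k d).obj (op X)).obj Z =>
      (homBil X Z).precomp f := by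
  constructor
  · intro f g h
    refine homLeg_hom_ext hd fun V x => rep_hom_ext fun W y => ?_
    exact congrFun (congrFun (congrFun (congrFun (congrArg Bil.toFun h) V) W) x) y
  · intro b
    obtain ⟨f, hf⟩ := exists_hom_lift (Y := Y) hd
      (fun V x => homOfNatural (Y := tensorShift V Z) (fun W y => b.toFun V W x y)
        (fun W W' g y => b.nat_right V g x y) hd)
      fun V V' φ x => rep_hom_ext fun W y => b.nat_left φ W x y
    refine ⟨f, ?_⟩
    ext V W x y
    exact congrArg (fun t => ap t W y) (hf V x)

lemma homBil_map (X : RepGam k d) (h : Z ⟶ Z') :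
    (homBil X Z').precomp (((internalHom k d).obj (op X)).map h) = (homBil X Z).postcomp h := by
  ext V W x y
  exact congrArg (fun t => ap t W y) (homLeg_map x h)

/-! ### The adjunction between internal tensor product and internal Hom -/

/-- Morphisms `X ⊗ Y ⟶ Z` correspond to morphisms `Y ⟶ ℋom(X, Z)`. -/
def tensorHomEquiv (hd : 1 ≤ d) (X Y Z : RepGam k d) :
    (((internalTensor k d).obj X).obj Y ⟶ Z) ≃ (Y ⟶ ((internalHom k d).obj (op X)).obj Z) :=
  (Equiv.ofBijective _ (tensorBil_postcomp_bijective X Y Z)).trans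
    (Equiv.ofBijective _ (homBil_precomp_bijective hd X Y Z)).symm

lemma homBil_precomp_tensorHomEquiv (hd : 1 ≤ d)
    (f : ((internalTensor k d).obj X).obj Y ⟶ Z) :
    (homBil X Z).precomp (tensorHomEquiv hd X Y Z f) = (tensorBil X Y).postcomp f :=
  (Equiv.ofBijective _ (homBil_precomp_bijective hd X Y Z)).apply_symm_apply _

/-- The adjunction between `X ⊗ -` and `ℋom(X, -)`. -/
def tensorHomAdj (hd : 1 ≤ d) (X : RepGam k d) :
    (internalTensor k d).obj X ⊣ (internalHom k d).obj (op X) :=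
  Adjunction.mkOfHomEquiv
    { homEquiv := tensorHomEquiv hd X
      homEquiv_naturality_left_symm := fun {Y Y' Z} f g => by
        rw [Equiv.symm_apply_eq]
        refine (homBil_precomp_bijective hd X Y Z).1 ?_
        change _ = (homBil X Z).precomp (tensorHomEquiv hd X Y Z _)
        rw [homBil_precomp_tensorHomEquiv]
        have h := homBil_precomp_tensorHomEquiv hd ((tensorHomEquiv hd X Y' Z).symm g)
        rw [Equiv.apply_symm_apply] at h
        have e := congrArg (fun b => b.postcomp ((tensorHomEquiv hd X Y' Z).symm g))
          (tensorBil_map X f)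
        exact (congrArg (fun b => b.precomp f) h).trans e.symm
      homEquiv_naturality_right := fun {Y Z Z'} f g => by
        refine (homBil_precomp_bijective hd X Y Z').1 ?_
        change (homBil X Z').precomp (tensorHomEquiv hd X Y Z' _) = _
        rw [homBil_precomp_tensorHomEquiv]
        have h := homBil_precomp_tensorHomEquiv hd f
        have e := congrArg (fun b => b.precomp (tensorHomEquiv hd X Y Z f)) (homBil_map X g)
        exact (congrArg (fun b => b.postcomp g) h).symm.trans e.symm }

/-! ### Perfect bilinear families -/

/-- A bilinear family which identifies `Z` with `X ⊗ Y` and `Y` with `ℋom(X, Z)`. -/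
structure Bil.IsPerfect (b : Bil X Y Z) : Prop where
  universal : ∀ (Z' : RepGam k d) (c : Bil X Y Z'), ∃! h : Z ⟶ Z', b.postcomp h = c
  couniversal : ∀ (U : DivPow k d) (φ : ∀ V, X.obj.obj V → Z.obj.obj (tensorObj V U)),
    (∀ V V' (f : V ⟶ V') x, φ V' (mp X f x) = mp Z (tensorMap f (𝟙 U)) (φ V x)) →
      ∃! y : Y.obj.obj U, ∀ V x, b.toFun V U x y = φ V x

/-- Couniversality speaks of one element of Y(U) at a time. Its uniqueness makes the resulting
functions natural in U, hence linear, so Y has the universal property of ℋom(X, Z). -/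
lemma Bil.IsPerfect.precomp_bijective (hd : 1 ≤ d) {b : Bil X Y Z} (hb : b.IsPerfect)
    (Y' : RepGam k d) : Function.Bijective fun f : Y' ⟶ Y => b.precomp f := by
  constructor
  · intro f g h
    refine rep_hom_ext fun U y => ?_
    refine (hb.couniversal U (fun V x => b.toFun V U x (ap f U y))
      fun V V' f x => b.nat_left f U x _).unique (fun V x => rfl) fun V x => ?_
    exact (congrFun (congrFun (congrFun (congrFun (congrArg Bil.toFun h) V) U) x) y).symm
  · intro c
    choose φ hφ hφ' using fun U (y : Y'.obj.obj U) => hb.couniversal U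
      (fun V x => c.toFun V U x y) fun V V' f x => c.nat_left f U x y
    refine ⟨homOfNatural φ (fun U U' f y => ?_) hd, ?_⟩
    · refine (hφ' U' (mp Y' f y) _ fun V x => ?_).symm
      rw [b.nat_right, c.nat_right]
      exact congrArg _ (hφ U y V x)
    · ext V U x y
      exact hφ U y V x

/-- Here and in `isIso_hom`, two objects carry the same universal family, and the comparison
morphism is inverted by the comparison in the other direction. -/
lemma Bil.IsPerfect.isIso_tensor {b : Bil X Y Z} (hb : b.IsPerfect)
    {f : ((internalTensor k d).obj X).obj Y ⟶ Z} (hf : (tensorBil X Y).postcomp f = b) :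
    IsIso f := by
  obtain ⟨g, hg, -⟩ := hb.universal _ (tensorBil X Y)
  refine ⟨g, (tensorBil_postcomp_bijective X Y _).1 ?_, ?_⟩
  · exact (congrArg (fun c => c.postcomp g) hf).trans hg
  · refine (hb.universal _ b).unique ?_ rfl
    exact (congrArg (fun c => c.postcomp f) hg).trans hf

lemma Bil.IsPerfect.isIso_hom (hd : 1 ≤ d) {b : Bil X Y Z} (hb : b.IsPerfect)
    {g : Y ⟶ ((internalHom k d).obj (op X)).obj Z} (hg : (homBil X Z).precomp g = b) :
    IsIso g := by
  obtain ⟨f, hf⟩ := (hb.precomp_bijective hd _).2 (homBil X Z)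
  refine ⟨f, (hb.precomp_bijective hd _).1 ?_, (homBil_precomp_bijective hd X _ Z).1 ?_⟩
  · exact (congrArg (fun c => c.precomp g) hf).trans hg
  · exact (congrArg (fun c => c.precomp f) hg).trans hf

/-- The family `b` corresponds to f : X ⊗ Y → Z and to its adjunct g : Y → ℋom(X, Z), both of them
isomorphisms. Since g is the unit followed by ℋom(X, f), the unit at Y is invertible; since f is X ⊗
g followed by the counit, so is the counit at Z. -/
lemma Bil.IsPerfect.main (hd : 1 ≤ d) {b : Bil X Y Z} (hb : b.IsPerfect) :
    Nonempty (((internalTensor k d).obj X).obj Y ≅ Z) ∧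
    Nonempty (((internalHom k d).obj (op X)).obj Z ≅ Y) ∧
    IsIso ((tensorHomAdj hd X).unit.app Y) ∧ IsIso ((tensorHomAdj hd X).counit.app Z) := by
  obtain ⟨f, hf⟩ := (tensorBil_postcomp_bijective X Y Z).2 b
  have hg : (homBil X Z).precomp ((tensorHomAdj hd X).homEquiv Y Z f) = b := by
    have e : (tensorHomAdj hd X).homEquiv Y Z f = tensorHomEquiv hd X Y Z f := by
      simp [tensorHomAdj]
    rw [e, homBil_precomp_tensorHomEquiv]
    exact hf
  have := hb.isIso_tensor hf
  have := hb.isIso_hom hd hg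
  refine ⟨⟨asIso f⟩, ⟨(asIso ((tensorHomAdj hd X).homEquiv Y Z f)).symm⟩, ?_, ?_⟩
  · have e := (tensorHomAdj hd X).homEquiv_unit Y Z f
    have : IsIso ((tensorHomAdj hd X).unit.app Y ≫ ((internalHom k d).obj (op X)).map f) := by
      rw [← e]; assumption
    exact IsIso.of_isIso_comp_right _ (((internalHom k d).obj (op X)).map f)
  · have e := (tensorHomAdj hd X).homEquiv_counit Y Z ((tensorHomAdj hd X).homEquiv Y Z f)
    rw [Equiv.symm_apply_apply] at e
    have : IsIso (((internalTensor k d).obj X).map ((tensorHomAdj hd X).homEquiv Y Z f) ≫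
        (tensorHomAdj hd X).counit.app Z) := by
      rw [← e]; assumption
    exact IsIso.of_isIso_comp_left
      (((internalTensor k d).obj X).map ((tensorHomAdj hd X).homEquiv Y Z f)) _

end

/-! ### Shifts of perfect bilinear families -/

section

variable {k : Type u} [CommRing k] {d : ℕ} {U V V' W W' : DivPow k d} {X Y Z : RepGam k d}

/-- The linear map `V ⊗ (E ⊗ W) → E ⊗ (V ⊗ W)`. -/
def leftCommLin (E V W : DivPow k d) :
    (tensorObj V (tensorObj E W)).as →ₗ[k] (tensorObj E (tensorObj V W)).as :=
  (TensorProduct.leftComm k V.as E.as W.as).toLinearMap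

section

variable (E V W V' W' : FinProj k)

lemma leftComm_map_left (f : V →ₗ[k] V') (x : V ⊗[k] (E ⊗[k] W)) :
    TensorProduct.leftComm k V' E W (TensorProduct.map f LinearMap.id x) =
      TensorProduct.map LinearMap.id (TensorProduct.map f LinearMap.id)
        (TensorProduct.leftComm k V E W x) := by
  have h : (TensorProduct.leftComm k V' E W).toLinearMap ∘ₗ TensorProduct.map f LinearMap.id =
      TensorProduct.map LinearMap.id (TensorProduct.map f LinearMap.id) ∘ₗ
        (TensorProduct.leftComm k V E W).toLinearMap :=
    TensorProduct.ext_threefold' fun v e w => rfl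
  exact LinearMap.congr_fun h x

lemma leftComm_map_right (g : W →ₗ[k] W') (x : V ⊗[k] (E ⊗[k] W)) :
    TensorProduct.leftComm k V E W'
        (TensorProduct.map LinearMap.id (TensorProduct.map LinearMap.id g) x) =
      TensorProduct.map LinearMap.id (TensorProduct.map LinearMap.id g)
        (TensorProduct.leftComm k V E W x) := by
  have h : (TensorProduct.leftComm k V E W').toLinearMap ∘ₗ
        TensorProduct.map LinearMap.id (TensorProduct.map LinearMap.id g) =
      TensorProduct.map LinearMap.id (TensorProduct.map LinearMap.id g) ∘ₗ
        (TensorProduct.leftComm k V E W).toLinearMap :=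
    TensorProduct.ext_threefold' fun v e w => rfl
  exact LinearMap.congr_fun h x

/-- The linear map `V ⊗ Hom(E, W) → Hom(E, V ⊗ W)`. -/
def strengthAux : V ⊗[k] (E →ₗ[k] W) →ₗ[k] E →ₗ[k] V ⊗[k] W :=
  TensorProduct.lift ((LinearMap.llcomp k E W (V ⊗[k] W)) ∘ₗ TensorProduct.mk k V W)

lemma strengthAux_map (f : V →ₗ[k] V') (g : W →ₗ[k] W') (x : V ⊗[k] (E →ₗ[k] W)) :
    strengthAux E V' W' (TensorProduct.map f (LinearMap.llcomp k E W W' g) x) =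
      TensorProduct.map f g ∘ₗ strengthAux E V W x := by
  induction x using TensorProduct.induction_on with
  | zero => simp
  | tmul v h => rfl
  | add x y h h' => simp only [map_add, LinearMap.comp_add, h, h']

end

/-- The linear map `V ⊗ Hom(E, W) → Hom(E, V ⊗ W)`, as a map between objects of `Γ^d P_k`. -/
def strengthLin (E V W : DivPow k d) :
    (tensorObj V (homObj E W)).as →ₗ[k] (homObj E (tensorObj V W)).as :=
  strengthAux E.as V.as W.as

/-- The isomorphism `V ⊗ (E ⊗ W) ≅ E ⊗ (V ⊗ W)` in `Γ^d P_k`. -/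
def leftComm (E V W : DivPow k d) :
    tensorObj V (tensorObj E W) ⟶ tensorObj E (tensorObj V W) := ofLin (leftCommLin E V W)

/-- The morphism `V ⊗ Hom(E, W) ⟶ Hom(E, V ⊗ W)` in `Γ^d P_k`. -/
def strength (E V W : DivPow k d) :
    tensorObj V (homObj E W) ⟶ homObj E (tensorObj V W) := ofLin (strengthLin E V W)

lemma leftComm_leftComm (E V W : DivPow k d) :
    leftComm E V W ≫ leftComm V E W = 𝟙 (tensorObj V (tensorObj E W)) := by
  rw [leftComm, leftComm, ofLin_comp, ← ofLin_id]
  refine congrArg ofLin (LinearMap.ext fun x => ?_)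
  exact (TensorProduct.leftComm k V.as E.as W.as).symm_apply_apply x

lemma leftComm_naturality_left (E : DivPow k d) (f : V ⟶ V') (W : DivPow k d) :
    tensorMap f (𝟙 (tensorObj E W)) ≫ leftComm E V' W =
      leftComm E V W ≫ tensorMap (𝟙 E) (tensorMap f (𝟙 W)) := hom_ext <| by
  rw [leftComm, leftComm, ten_comp_ofLin, ten_ofLin_comp, ten_tensorMap_id_left,
    ten_tensorMap_id_right, ten_tensorMap_id_right, tmap_tmap, tmap_tmap, tmap_tmap]
  refine tmap_congr (fun f => LinearMap.ext fun x => ?_) _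
  exact leftComm_map_left E.as V.as W.as V'.as f x

lemma leftComm_naturality_right (E V : DivPow k d) (g : W ⟶ W') :
    tensorMap (𝟙 V) (tensorMap (𝟙 E) g) ≫ leftComm E V W' =
      leftComm E V W ≫ tensorMap (𝟙 E) (tensorMap (𝟙 V) g) := hom_ext <| by
  rw [leftComm, leftComm, ten_comp_ofLin, ten_ofLin_comp, ten_tensorMap_id_left,
    ten_tensorMap_id_left, ten_tensorMap_id_left, ten_tensorMap_id_left, tmap_tmap, tmap_tmap,
    tmap_tmap, tmap_tmap]
  refine tmap_congr (fun f => LinearMap.ext fun x => ?_) _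
  exact leftComm_map_right E.as V.as W.as W'.as f x

lemma strength_naturality_left (E : DivPow k d) (f : V ⟶ V') (W : DivPow k d) :
    tensorMap f (𝟙 (homObj E W)) ≫ strength E V' W =
      strength E V W ≫ homMap (𝟙 E) (tensorMap f (𝟙 W)) := hom_ext <| by
  rw [strength, strength, ten_comp_ofLin, ten_ofLin_comp, ten_homMap_id_left,
    ten_tensorMap_id_right, tmap_tmap, tmap_tmap]
  refine Eq.trans ?_ (congrArg (tmap (Fin d) _) (ten_tensorMap_id_right f)).symm
  rw [tmap_tmap]
  refine tmap_congr (fun f => LinearMap.ext fun x => ?_) _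
  exact strengthAux_map E.as V.as W.as V'.as W.as f LinearMap.id x

lemma strength_naturality_right (E V : DivPow k d) (g : W ⟶ W') :
    tensorMap (𝟙 V) (homMap (𝟙 E) g) ≫ strength E V W' =
      strength E V W ≫ homMap (𝟙 E) (tensorMap (𝟙 V) g) := hom_ext <| by
  rw [strength, strength, ten_comp_ofLin, ten_ofLin_comp, ten_homMap_id_left,
    ten_tensorMap_id_left, ten_tensorMap_id_left]
  refine (congrArg (fun t => tmap (Fin d) _ (tmap (Fin d) _ t)) (ten_homMap_id_left g)).trans ?_
  rw [tmap_tmap, tmap_tmap, tmap_tmap, tmap_tmap]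
  refine tmap_congr (fun f => LinearMap.ext fun x => ?_) _
  exact strengthAux_map E.as V.as W.as V.as W'.as LinearMap.id f x

/-- Coevaluation at a tensor product in terms of the strength; it carries the uniqueness half of
universality in `Bil.IsPerfect.shift`. -/
lemma coev_tensorObj (E V W : DivPow k d) :
    coev E (tensorObj V W) = tensorMap (𝟙 V) (coev E W) ≫ leftComm E V (homObj E W) ≫
      tensorMap (𝟙 E) (strength E V W) := by
  rw [coev, coev, leftComm, strength, tensorMap_ofLin_right, tensorMap_ofLin_right, ofLin_comp,
    ofLin_comp]
  refine congrArg ofLin (TensorProduct.ext' fun v w => ?_)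
  change coevLin E.as (V.as ⊗[k] W.as) (v ⊗ₜ w) =
    TensorProduct.map LinearMap.id (strengthAux E.as V.as W.as)
      (TensorProduct.leftComm k V.as E.as (E.as →ₗ[k] W.as) (v ⊗ₜ coevLin E.as W.as w))
  rw [coevLin_apply, coevLin_apply, TensorProduct.tmul_sum, map_sum, map_sum]
  refine Finset.sum_congr rfl fun i _ => congrArg (dbVec E.as i ⊗ₜ[k] ·) ?_
  ext e
  exact (TensorProduct.tmul_smul _ _ _).symm

/-- The dual compatibility, for evaluation; it carries the existence half. -/
lemma strength_leftComm_ev (E V W : DivPow k d) :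
    strength E V (tensorObj E W) ≫ homMap (𝟙 E) (leftComm E V W) ≫ ev E (tensorObj V W) =
      tensorMap (𝟙 V) (ev E W) := by
  rw [ev, ev, leftComm, strength, tensorMap_ofLin_right, homMap_ofLin_right, ofLin_comp,
    ofLin_comp]
  refine congrArg ofLin (TensorProduct.ext' fun v (f : E.as →ₗ[k] E.as ⊗[k] W.as) => ?_)
  have h (l : E.as →ₗ[k] k) (x : E.as ⊗[k] W.as) :
      TensorProduct.lid k (V.as ⊗[k] W.as) (LinearMap.rTensor _ l
        (TensorProduct.leftComm k V.as E.as W.as (v ⊗ₜ x))) =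
      v ⊗ₜ TensorProduct.lid k W.as (LinearMap.rTensor W.as l x) := by
    induction x using TensorProduct.induction_on with
    | zero => simp
    | tmul e u => simp
    | add x y h h' => simp only [map_add, TensorProduct.tmul_add, h, h']
  change evLin E.as (V.as ⊗[k] W.as) ((TensorProduct.leftComm k V.as E.as W.as).toLinearMap ∘ₗ
    TensorProduct.mk k V.as (E.as ⊗[k] W.as) v ∘ₗ f) = v ⊗ₜ evLin E.as W.as f
  rw [evLin_apply, evLin_apply, TensorProduct.tmul_sum]
  exact Finset.sum_congr rfl fun i _ => h _ _

/-- The bilinear family `X(V) × Y(E ⊗ W) → Z(E ⊗ (V ⊗ W))` obtained by shifting. -/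
def Bil.shift (b : Bil X Y Z) (E : DivPow k d) : Bil X (tensorShift E Y) (tensorShift E Z) where
  toFun V W x y := mp Z (leftComm E V W) (b.toFun V (tensorObj E W) x y)
  nat_left {V V'} f W x y := by
    refine (congrArg (mp Z (leftComm E V' W)) (b.nat_left f (tensorObj E W) x y)).trans ?_
    exact mp_square (X := Z) (leftComm_naturality_left E f W) _
  nat_right V {W W'} g x y := by
    refine (congrArg (mp Z (leftComm E V W'))
      (b.nat_right V (tensorMap (𝟙 E) g) x y)).trans ?_
    exact mp_square (X := Z) (leftComm_naturality_right E V g) _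

/-- The bilinear family `X(V) × Y(W) → Z(Hom(E, V ⊗ W))` corresponding to a bilinear family
`X(V) × Y(E ⊗ W) → Z(V ⊗ W)`. -/
def Bil.unshift {E : DivPow k d} (b : Bil X (tensorShift E Y) Z) : Bil X Y (homShift E Z) where
  toFun V W x y := mp Z (strength E V W) (b.toFun V (homObj E W) x (mp Y (coev E W) y))
  nat_left {V V'} f W x y := by
    refine (congrArg (mp Z (strength E V' W)) (b.nat_left f (homObj E W) x _)).trans ?_
    exact mp_square (X := Z) (strength_naturality_left E f W) _
  nat_right V {W W'} g x y := by
    have h : mp Y (coev E W') (mp Y g y) =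
        mp (tensorShift E Y) (homMap (𝟙 E) g) (mp Y (coev E W) y) :=
      mp_square (X := Y) (coev_naturality E g) y
    refine (congrArg (fun t => mp Z (strength E V W') (b.toFun V (homObj E W') x t)) h).trans ?_
    refine (congrArg (mp Z (strength E V W')) (b.nat_right V (homMap (𝟙 E) g) x _)).trans ?_
    exact mp_square (X := Z) (strength_naturality_right E V g) _

/-- The morphism `Z(E ⊗ -) ⟶ Z'` corresponding to `Z ⟶ Z'(Hom(E, -))`. -/
def shiftAdjunct {E : DivPow k d} {Z' : RepGam k d} (h : Z ⟶ homShift E Z') :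
    tensorShift E Z ⟶ Z' :=
  repHom (X := tensorShift E Z) (fun W => mp Z' (ev E W) ∘ₗ ap h (tensorObj E W))
    fun W W' g z => by
      refine (congrArg (mp Z' (ev E W')) (ap_mp h (tensorMap (𝟙 E) g) z)).trans ?_
      exact mp_square (X := Z') (ev_naturality E g) _

/-- The morphism `Z ⟶ Z'(Hom(E, -))` corresponding to `Z(E ⊗ -) ⟶ Z'`. -/
def shiftCoadjunct {E : DivPow k d} {Z' : RepGam k d} (h : tensorShift E Z ⟶ Z') :
    Z ⟶ homShift E Z' :=
  repHom (Y := homShift E Z') (fun W => ap h (homObj E W) ∘ₗ mp Z (coev E W))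
    fun W W' g z => by
      refine (congrArg (ap h (homObj E W')) (mp_square (X := Z) (coev_naturality E g) z)).trans ?_
      exact ap_mp h (homMap (𝟙 E) g) _

lemma shiftCoadjunct_injective {E : DivPow k d} {Z' : RepGam k d} {h h' : tensorShift E Z ⟶ Z'}
    (e : shiftCoadjunct h = shiftCoadjunct h') : h = h' := by
  have key : ∀ (g : tensorShift E Z ⟶ Z') W (z : Z.obj.obj (tensorObj E W)), ap g W z =
      mp Z' (ev E W) (ap (shiftCoadjunct g) (tensorObj E W) z) := fun g W z => by
    have h₁ : mp (tensorShift E Z) (ev E W) (mp Z (coev E (tensorObj E W)) z) = z :=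
      (mp_mp_of_eq (X := Z) (coev_ev E W) z).trans (mp_id (X := Z) z)
    exact (congrArg (ap g W) h₁.symm).trans (ap_mp g (ev E W) _)
  exact rep_hom_ext fun W z => (key h W z).trans (Eq.trans (by rw [e]) (key h' W z).symm)

/-- Since Hom(E, -) ⊣ E ⊗ -, restriction along E ⊗ - is left adjoint to restriction along Hom(E, -).
So morphisms Z(E ⊗ -) → Z' are morphisms Z → Z'(Hom(E, -)), and bilinear families on X and Y(E ⊗ -)
turn into families on X and Y by `Bil.unshift`; universality follows from that of `b`.
Couniversality at U is couniversality of `b` at E ⊗ U, up to exchanging V and E. -/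
lemma Bil.IsPerfect.shift {b : Bil X Y Z} (hb : b.IsPerfect) (E : DivPow k d) :
    (b.shift E).IsPerfect where
  universal Z' c := by
    obtain ⟨h, hh, hu⟩ := hb.universal _ c.unshift
    refine ⟨shiftAdjunct h, ?_, fun h' hh' => shiftCoadjunct_injective ?_⟩
    · ext V W x y
      have e₁ : ap h (tensorObj V (tensorObj E W)) (b.toFun V (tensorObj E W) x y) =
          c.unshift.toFun V (tensorObj E W) x y :=
        congrFun (congrFun (congrFun (congrFun (congrArg Bil.toFun hh) V) _) x) y
      have e₂ := ap_mp h (leftComm E V W) (b.toFun V (tensorObj E W) x y)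
      have e₃ : mp (tensorShift E Y) (ev E W) (mp Y (coev E (tensorObj E W)) y) = y :=
        (mp_mp_of_eq (X := Y) (coev_ev E W) y).trans (mp_id (X := Y) y)
      refine (congrArg (mp Z' (ev E (tensorObj V W))) (e₂.trans
        (congrArg (mp (homShift E Z') (leftComm E V W)) e₁))).trans ?_
      refine Eq.trans ?_ (congrArg (c.toFun V W x) e₃)
      refine Eq.trans ?_ (c.nat_right V (ev E W) x _).symm
      refine Eq.trans ?_ (mp_mp_of_eq (X := Z') (strength_leftComm_ev E V W) _)
      exact (mp_comp (X := Z') _ _ _).symm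
    · have hc : b.postcomp (shiftCoadjunct h') = c.unshift := by
        ext V W x y
        have e₁ : ap h' (tensorObj V (homObj E W)) _ = c.toFun V (homObj E W) x (mp Y (coev E W) y) :=
          congrFun (congrFun (congrFun (congrFun (congrArg Bil.toFun hh') V) _) x) _
        have e₂ := ap_mp h' (strength E V W)
          (mp Z (leftComm E V (homObj E W)) (mp Z (tensorMap (𝟙 V) (coev E W)) (b.toFun V W x y)))
        refine (congrArg (ap h' (homObj E (tensorObj V W))) ?_).trans
          (e₂.trans (congrArg (mp Z' (strength E V W)) ?_))
        · refine (congrArg (fun f => mp Z f (b.toFun V W x y)) (coev_tensorObj E V W)).trans ?_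
          exact (mp_comp (X := Z) _ _ _).trans (mp_comp (X := Z) _ _ _)
        · refine (congrArg (fun t => ap h' (tensorObj V (homObj E W))
            (mp Z (leftComm E V (homObj E W)) t)) ?_).trans e₁
          exact (b.nat_right V (coev E W) x y).symm
      have e : shiftCoadjunct (shiftAdjunct h) = h := by
        refine rep_hom_ext (Y := homShift E Z') fun W z => ?_
        refine (congrArg (mp Z' (ev E (homObj E W))) (ap_mp h (coev E W) z)).trans ?_
        exact (mp_mp_of_eq (X := Z') (ev_coev E W) _).trans (mp_id (X := Z') _)
      exact (hu _ hc).trans e.symm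
  couniversal U φ hφ := by
    -- The exchange of factors is invertible, so it can be moved to the other side of each equation.
    have key : ∀ V (z : Z.obj.obj (tensorObj V (tensorObj E U)))
        (w : Z.obj.obj (tensorObj E (tensorObj V U))),
        mp Z (leftComm E V U) z = w ↔ z = mp Z (leftComm V E U) w := fun V z w =>
      ⟨fun h => by
        rw [← h]
        exact ((mp_mp_of_eq (X := Z) (leftComm_leftComm E V U) z).trans (mp_id (X := Z) z)).symm,
      fun h => by
        rw [h]
        exact (mp_mp_of_eq (X := Z) (leftComm_leftComm V E U) w).trans (mp_id (X := Z) w)⟩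
    obtain ⟨y, hy, hu⟩ := hb.couniversal (tensorObj E U)
      (fun V x => mp Z (leftComm V E U) (φ V x)) fun V V' f x => by
        refine ((key V' _ _).mp ?_).symm
        refine (mp_square (X := Z) (leftComm_naturality_left E f U) _).trans ?_
        refine (congrArg (mp Z (tensorMap (𝟙 E) (tensorMap f (𝟙 U))))
          ((key V _ _).mpr rfl)).trans ?_
        exact (hφ V V' f x).symm
    exact ⟨y, fun V x => (key V _ _).mpr (hy V x), fun y' hy' =>
      hu y' fun V x => (key V _ _).mp (hy' V x)⟩

end

/-! ### Symmetrised tensors of linear forms -/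

section

variable {k : Type u} [CommRing k] {d : ℕ} {U V V' W W' : DivPow k d} {X Y Z : RepGam k d}

/-- The bilinear map `V^{⊗d} × W^{⊗d} → (V ⊗ W)^{⊗d}`. -/
def star (V W : DivPow k d) : TPow k (Fin d) V.as →ₗ[k] TPow k (Fin d) W.as →ₗ[k]
    TPow k (Fin d) (tensorObj V W).as := tmap₂ (Fin d) (TensorProduct.mk k V.as W.as)

lemma star_tprod (x : Fin d → V.as) (y : Fin d → W.as) :
    star V W (PiTensorProduct.tprod k x) (PiTensorProduct.tprod k y) =
      PiTensorProduct.tprod (R := k) (s := fun _ => (tensorObj V W).as.carrier)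
        fun i => x i ⊗ₜ[k] y i :=
  tmap₂_tprod _ _ _

lemma permute_star (σ : Equiv.Perm (Fin d)) (a : TPow k (Fin d) V.as) (b : TPow k (Fin d) W.as) :
    permute k (tensorObj V W).as σ (star V W a b) =
      star V W (permute k V.as σ a) (permute k W.as σ b) :=
  (tmap₂_permute (TensorProduct.mk k V.as W.as) σ a b).symm

lemma actHom_tensorMap_star (f : V ⟶ V') (g : W ⟶ W') (a : TPow k (Fin d) V.as)
    (b : TPow k (Fin d) W.as) :
    actHom (tensorMap f g) (star V W a b) = star V' W' (actHom f a) (actHom g b) := by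
  have key : ∀ (f : TPow k (Fin d) (V.as →ₗ[k] V'.as)) (g : TPow k (Fin d) (W.as →ₗ[k] W'.as)),
      act k (Fin d) (V.as ⊗[k] W.as) (V'.as ⊗[k] W'.as)
        (tmap₂ (Fin d) (tensorB k V.as V'.as W.as W'.as) f g)
        (tmap₂ (Fin d) (TensorProduct.mk k V.as W.as) a b) =
      tmap₂ (Fin d) (TensorProduct.mk k V'.as W'.as) (act k (Fin d) V.as V'.as f a)
        (act k (Fin d) W.as W'.as g b) := fun f g => by
    induction f using tind with
    | tp f =>
      induction g using tind with
      | tp g =>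
        induction a using tind with
        | tp x =>
          induction b using tind with
          | tp y => simp
          | smul c x h => simp only [map_smul, h]
          | add x y h h' => simp only [map_add, h, h']
        | smul c x h => simp only [map_smul, LinearMap.smul_apply, h]
        | add x y h h' => simp only [map_add, LinearMap.add_apply, h, h']
      | smul c x h => simp only [map_smul, LinearMap.smul_apply, h]
      | add x y h h' => simp only [map_add, LinearMap.add_apply, h, h']
    | smul c x h => simp only [map_smul, LinearMap.smul_apply, h]
    | add x y h h' => simp only [map_add, LinearMap.add_apply, h, h']
  exact key (ten f) (ten g)

section

variable {M N P Q : Type u} [AddCommGroup M] [Module k M] [AddCommGroup N] [Module k N]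
  [AddCommGroup P] [Module k P] [AddCommGroup Q] [Module k Q]

lemma permute_permute {ι : Type} (σ τ : Equiv.Perm ι) (t : TPow k ι M) :
    permute k M σ (permute k M τ t) = permute k M (σ * τ) t := by
  induction t using tind with
  | tp x => simp [Equiv.Perm.mul_def]
  | smul c x h => simp [h]
  | add x y h h' => simp [h, h']

lemma permute_one {ι : Type} (t : TPow k ι M) : permute k M 1 t = t := by
  induction t using tind with
  | tp x => simp [Equiv.Perm.one_def]
  | smul c x h => simp [h]
  | add x y h h' => simp [h, h']

/-- The linear form on `M^{⊗d}` given by a sequence of linear forms on `M`. -/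
def pairing (ε : Fin d → M →ₗ[k] k) : TPow k (Fin d) M →ₗ[k] k :=
  PiTensorProduct.lift ((MultilinearMap.mkPiAlgebra k (Fin d) k).compLinearMap ε)

@[simp] lemma pairing_tprod (ε : Fin d → M →ₗ[k] k) (x : Fin d → M) :
    pairing ε (PiTensorProduct.tprod k x) = ∏ j, ε j (x j) := by
  simp [pairing]

/-- A pair of permutations (ρ, τ) is written as (ρ, ρσ): ρ acts on the product as a whole and σ
measures the relative position. -/
lemma tmap₂_sum_permute (B : M →ₗ[k] N →ₗ[k] P) (s : TPow k (Fin d) M) (t : TPow k (Fin d) N) :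
    tmap₂ (Fin d) B (∑ σ : Equiv.Perm (Fin d), permute k M σ s)
        (∑ σ : Equiv.Perm (Fin d), permute k N σ t) =
      ∑ ρ : Equiv.Perm (Fin d), ∑ σ : Equiv.Perm (Fin d),
        permute k P ρ (tmap₂ (Fin d) B s (permute k N σ t)) := by
  rw [LinearMap.map_sum₂]
  refine Finset.sum_congr rfl fun ρ _ => ?_
  rw [map_sum]
  refine (Fintype.sum_equiv (Equiv.mulLeft ρ) _ _ fun σ => ?_).symm
  rw [Equiv.coe_mulLeft, ← permute_permute, tmap₂_permute]

lemma permute_mem_sum (t : TPow k (Fin d) M) :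
    ∑ σ : Equiv.Perm (Fin d), permute k M σ t ∈ Gam k (Fin d) M := fun τ => by
  rw [map_sum]
  exact Fintype.sum_equiv (Equiv.mulLeft τ) _ _ fun σ => permute_permute τ σ t

end

/-- The product of linear forms `ε_j` and a tensor, as a tensor of linear maps. -/
def formMul (M N : FinProj k) (ε : Fin d → M →ₗ[k] k) :
    TPow k (Fin d) N →ₗ[k] TPow k (Fin d) (M →ₗ[k] N) :=
  tmap₂ (Fin d) LinearMap.smulRightₗ (PiTensorProduct.tprod k ε)

lemma formMul_tprod (M N : FinProj k) (ε : Fin d → M →ₗ[k] k) (x : Fin d → N) :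
    formMul M N ε (PiTensorProduct.tprod k x) =
      PiTensorProduct.tprod k fun j => (ε j).smulRight (x j) :=
  tmap₂_tprod _ _ _

lemma permute_formMul (M N : FinProj k) (ε : Fin d → M →ₗ[k] k) (σ : Equiv.Perm (Fin d))
    (t : TPow k (Fin d) N) : permute k (M →ₗ[k] N) σ (formMul M N ε t) =
      formMul M N (fun j => ε (σ.symm j)) (permute k N σ t) := by
  rw [formMul, formMul, ← tmap₂_permute, permute_tprod]

lemma act_formMul (M N : FinProj k) (ε : Fin d → M →ₗ[k] k) (t : TPow k (Fin d) N)
    (w : TPow k (Fin d) M) :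
    act k (Fin d) M N (formMul M N ε t) w = pairing ε w • t := by
  suffices h : act k (Fin d) M N ∘ₗ formMul M N ε =
      (LinearMap.lsmul k (TPow k (Fin d) N) ∘ₗ pairing ε).flip from
    LinearMap.congr_fun (LinearMap.congr_fun h t) w
  refine tind₂ fun x y => ?_
  simp only [LinearMap.comp_apply, formMul_tprod, act_tprod, LinearMap.flip_apply, pairing_tprod,
    LinearMap.smulRight_apply, LinearMap.lsmul_apply]
  exact MultilinearMap.map_smul_univ _ _ _

lemma act_permute_permute (M N : FinProj k) (f : TPow k (Fin d) (M →ₗ[k] N))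
    (σ : Equiv.Perm (Fin d)) (w : TPow k (Fin d) M) :
    act k (Fin d) M N (permute k (M →ₗ[k] N) σ f) w =
      permute k N σ (act k (Fin d) M N f (permute k M σ⁻¹ w)) := by
  rw [act, ← tmap₂_permute, permute_permute, mul_inv_cancel, permute_one]

/-- The morphism `V ⟶ W` of `Γ^d P_k` obtained by symmetrising `⨂ⱼ ε_j ⊗ t_j`, for linear
forms `ε_j` on `V` and a tensor `t` in `W^{⊗d}`. -/
def bracket (ε : Fin d → V.as →ₗ[k] k) : TPow k (Fin d) W.as →ₗ[k] (V ⟶ W) :=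
  LinearMap.codRestrict (Gam k (Fin d) (V.as →ₗ[k] W.as))
    (∑ σ : Equiv.Perm (Fin d), permute k (V.as →ₗ[k] W.as) σ ∘ₗ formMul V.as W.as ε)
    fun t => by
      rw [LinearMap.sum_apply]
      exact permute_mem_sum _

lemma ten_bracket (ε : Fin d → V.as →ₗ[k] k) (t : TPow k (Fin d) W.as) :
    ten (bracket ε t) = ∑ σ : Equiv.Perm (Fin d),
      permute k (V.as →ₗ[k] W.as) σ (formMul V.as W.as ε t) :=
  LinearMap.sum_apply _ _ _

lemma actHom_bracket (ε : Fin d → V.as →ₗ[k] k) (t : TPow k (Fin d) W.as)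
    (w : TPow k (Fin d) V.as) : actHom (bracket ε t) w =
      ∑ σ : Equiv.Perm (Fin d), pairing ε (permute k V.as σ⁻¹ w) • permute k W.as σ t := by
  rw [actHom, ten_bracket, map_sum, LinearMap.sum_apply]
  refine Finset.sum_congr rfl fun σ _ => ?_
  rw [act_permute_permute, act_formMul, map_smul]

/-- Only the relative position of forms and tensor factors survives the symmetrisation. -/
lemma bracket_permute (ε : Fin d → V.as →ₗ[k] k) (τ : Equiv.Perm (Fin d))
    (t : TPow k (Fin d) W.as) :
    bracket ε (permute k W.as τ t) = bracket (fun j => ε (τ j)) t := hom_ext <| by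
  rw [ten_bracket, ten_bracket]
  refine Fintype.sum_equiv (Equiv.mulRight τ) _ _ fun σ => ?_
  rw [Equiv.coe_mulRight, ← permute_permute, permute_formMul V.as W.as (fun j => ε (τ j)) τ]
  simp

lemma bracket_comp (ε : Fin d → U.as →ₗ[k] k) (t : TPow k (Fin d) V.as) (f : V ⟶ W) :
    bracket ε t ≫ f = bracket ε (actHom f t) := hom_ext <| by
  rw [ten_comp, ten_bracket, ten_bracket, map_sum, LinearMap.sum_apply]
  refine Finset.sum_congr rfl fun σ _ => ?_
  -- As f is a symmetric tensor it equals its own permutation by σ, so σ can be taken out of the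
  -- composite.
  conv_lhs => rw [← ten_mem f σ]
  rw [tmap₂_permute]
  refine congrArg _ ?_
  suffices h : tmap₂ (Fin d) (compB k U.as V.as W.as) ∘ₗ formMul U.as V.as ε =
      (act k (Fin d) V.as W.as).flip.compr₂ (formMul U.as W.as ε) from
    LinearMap.congr_fun (LinearMap.congr_fun h t) (ten f)
  refine tind₂ fun x y => ?_
  simp only [LinearMap.comp_apply, formMul_tprod, tmap₂_tprod, LinearMap.compr₂_apply,
    LinearMap.flip_apply, act_tprod]
  refine congrArg _ (funext fun j => LinearMap.ext fun v => ?_)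
  simp

lemma ofLin_comp_bracket (g : U.as →ₗ[k] V.as) (ε : Fin d → V.as →ₗ[k] k)
    (t : TPow k (Fin d) W.as) :
    ofLin g ≫ bracket ε t = bracket (fun j => ε j ∘ₗ g) t := hom_ext <| by
  rw [ten_ofLin_comp, ten_bracket, ten_bracket, map_sum]
  refine Finset.sum_congr rfl fun σ _ => ?_
  rw [tmap_permute]
  refine congrArg _ ?_
  suffices h : tmap (Fin d) (compB k U.as V.as W.as g) ∘ₗ formMul V.as W.as ε =
      formMul U.as W.as (fun j => ε j ∘ₗ g) from LinearMap.congr_fun h t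
  refine tpow_hom_ext fun x => ?_
  simp only [LinearMap.comp_apply, formMul_tprod, tmap_tprod]
  rfl

/-- The product of a linear form on `V` and a linear form on `W`, as a form on `V ⊗ W`. -/
def mulForm (l : V.as →ₗ[k] k) (l' : W.as →ₗ[k] k) : (tensorObj V W).as →ₗ[k] k :=
  LinearMap.mul' k k ∘ₗ TensorProduct.map l l'

lemma tensorB_formMul (V W V' W' : FinProj k) (ε : Fin d → V →ₗ[k] k) (ε' : Fin d → W →ₗ[k] k)
    (a : TPow k (Fin d) V') (b : TPow k (Fin d) W') :
    tmap₂ (Fin d) (tensorB k V V' W W') (formMul V V' ε a) (formMul W W' ε' b) =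
      tmap₂ (Fin d) (LinearMap.smulRightₗ (R := k) (M₂ := V ⊗[k] W) (M := V' ⊗[k] W'))
        (PiTensorProduct.tprod k fun j => LinearMap.mul' k k ∘ₗ TensorProduct.map (ε j) (ε' j))
        (tmap₂ (Fin d) (TensorProduct.mk k V' W') a b) := by
  induction a using tind with
  | tp x =>
    induction b using tind with
    | tp y =>
      simp only [formMul_tprod, tmap₂_tprod, tensorB_apply]
      refine congrArg (PiTensorProduct.tprod k) (funext fun j => ?_)
      refine TensorProduct.ext' (R := k) (M := V) (N := W) (P₂ := V' ⊗[k] W') fun v w => ?_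
      simp only [TensorProduct.map_tmul, LinearMap.smulRight_apply, LinearMap.smulRightₗ_apply,
        LinearMap.comp_apply, LinearMap.mul'_apply, TensorProduct.mk_apply,
        TensorProduct.smul_tmul_smul]
    | smul c x h => simp only [map_smul, h]
    | add x y h h' => simp only [map_add, h, h']
  | smul c x h => simp only [map_smul, LinearMap.smul_apply, h]
  | add x y h h' => simp only [map_add, LinearMap.add_apply, h, h']

/-- The product of two symmetrisations is a sum of symmetrisations over the relative permutations,
which move both the second forms and the second tensor. -/
lemma tensorMap_bracket (ε : Fin d → V.as →ₗ[k] k) (ε' : Fin d → W.as →ₗ[k] k)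
    (a : TPow k (Fin d) V'.as) (b : TPow k (Fin d) W'.as) :
    tensorMap (bracket ε a) (bracket ε' b) = ∑ σ : Equiv.Perm (Fin d),
      bracket (fun j => mulForm (ε j) (ε' (σ.symm j))) (star V' W' a (permute k W'.as σ b)) := hom_ext <| by
  have h : ten (∑ σ : Equiv.Perm (Fin d),
      bracket (fun j => mulForm (ε j) (ε' (σ.symm j))) (star V' W' a (permute k W'.as σ b))) =
      ∑ σ : Equiv.Perm (Fin d), ten
        (bracket (fun j => mulForm (ε j) (ε' (σ.symm j))) (star V' W' a (permute k W'.as σ b))) :=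
    map_sum (Gam k (Fin d) ((tensorObj V W).as →ₗ[k] (tensorObj V' W').as)).subtype _ _
  have h' : tmap₂ (Fin d) (tensorB k V.as V'.as W.as W'.as) (ten (bracket ε a))
      (ten (bracket ε' b)) =
      ∑ σ : Equiv.Perm (Fin d), ∑ ρ : Equiv.Perm (Fin d),
        permute k (V.as ⊗[k] W.as →ₗ[k] V'.as ⊗[k] W'.as) ρ
          (tmap₂ (Fin d) (tensorB k V.as V'.as W.as W'.as) (formMul V.as V'.as ε a)
            (permute k (W.as →ₗ[k] W'.as) σ (formMul W.as W'.as ε' b))) := by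
    rw [ten_bracket, ten_bracket, tmap₂_sum_permute, Finset.sum_comm]
  refine h'.trans (Eq.trans (Finset.sum_congr rfl fun σ _ => ?_) h.symm)
  refine Eq.trans (Finset.sum_congr rfl fun ρ _ => ?_) (ten_bracket (V := tensorObj V W)
    (W := tensorObj V' W') _ _).symm
  rw [permute_formMul]
  exact congrArg (permute k (V.as ⊗[k] W.as →ₗ[k] V'.as ⊗[k] W'.as) ρ)
    (tensorB_formMul V.as W.as V'.as W'.as ε (fun j => ε' (σ.symm j)) a _)

/-! ### The tensor `e₁ ⊗ ⋯ ⊗ e_d` -/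

variable (k d) in
/-- The object `k^d` of `Γ^d P_k`. -/
def stdObj : DivPow k d := ⟨FinProj.mk (Fin d → k)⟩

variable (k d) in
/-- The basis vectors of `k^d`. -/
def stdVec (j : Fin d) : (stdObj k d).as := (Pi.single j 1 : Fin d → k)

variable (k d) in
/-- The tensor `e₁ ⊗ ⋯ ⊗ e_d`. -/
def stdTen : TPow k (Fin d) (stdObj k d).as := PiTensorProduct.tprod k (stdVec k d)

/-- The coordinates on `k^d`. -/
def stdForm (j : Fin d) : (stdObj k d).as →ₗ[k] k := LinearMap.proj (R := k) (φ := fun _ => k) j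

lemma pairing_permute_stdTen (σ : Equiv.Perm (Fin d)) :
    pairing stdForm (permute k _ σ (stdTen k d)) = if σ = 1 then 1 else 0 := by
  rw [stdTen, permute_tprod, pairing_tprod]
  split_ifs with h
  · subst h
    exact Finset.prod_eq_one fun j _ => Pi.single_eq_same _ _
  · obtain ⟨j, hj⟩ : ∃ j, σ.symm j ≠ j := by
      by_contra! h'
      exact h (Equiv.ext fun j => by conv_lhs => rw [← h' j, Equiv.apply_symm_apply, ← Equiv.Perm.one_apply j])
    exact Finset.prod_eq_zero (Finset.mem_univ j) (Pi.single_eq_of_ne hj.symm _)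

/-- The morphism `k^d ⟶ W` given by a tensor in `W^{⊗d}`. -/
abbrev br (t : TPow k (Fin d) W.as) : stdObj k d ⟶ W := bracket stdForm t

/-- The coordinates pair to 1 with e₁ ⊗ ⋯ ⊗ e_d and to 0 with its other permutations, so one term of
the symmetrisation survives. Hence every tensor is an image of e₁ ⊗ ⋯ ⊗ e_d, and quotients of the
tensor power are generated by its class. -/
lemma actHom_br (t : TPow k (Fin d) W.as) : actHom (br t) (stdTen k d) = t := by
  rw [actHom_bracket, Finset.sum_eq_single 1]
  · rw [pairing_permute_stdTen, if_pos inv_one, one_smul, permute_one]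
  · intro σ _ hσ
    rw [pairing_permute_stdTen, if_neg (inv_ne_one.mpr hσ), zero_smul]
  · simp

/-- The permutation of the coordinates of `k^d`. -/
def permLin (τ : Equiv.Perm (Fin d)) : (stdObj k d).as →ₗ[k] (stdObj k d).as :=
  LinearMap.funLeft k k τ

/-- The permutation of the coordinates of `k^d` as a morphism of `Γ^d P_k`. -/
def permMor (τ : Equiv.Perm (Fin d)) : stdObj k d ⟶ stdObj k d := ofLin (permLin τ)

lemma actHom_permMor (τ : Equiv.Perm (Fin d)) :
    actHom (permMor τ) (stdTen k d) = permute k _ τ (stdTen k d) := by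
  refine (act_tprod _ _).trans (Eq.trans ?_ (permute_tprod _ _).symm)
  refine congrArg _ (funext fun j => funext fun i => ?_)
  change (Pi.single j 1 : Fin d → k) (τ i) = (Pi.single (τ.symm j) 1 : Fin d → k) i
  simp [Pi.single_apply, Equiv.eq_symm_apply]

/-! ### Signed symmetrisation -/

/-- A representation which is the quotient of `V ↦ V^{⊗d}` by symmetrisation with respect to a
character of the symmetric group. -/
structure SignedQuotient (Z : RepGam k d) (χ : Equiv.Perm (Fin d) →* k) where
  /-- The projection. -/
  proj : ∀ V : DivPow k d, TPow k (Fin d) V.as →ₗ[k] Z.obj.obj V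
  proj_surjective : ∀ V, Function.Surjective (proj V)
  proj_permute : ∀ V σ t, proj V (permute k V.as σ t) = χ σ • proj V t
  mp_proj : ∀ V W (f : V ⟶ W) t, mp Z f (proj V t) = proj W (actHom f t)
  /-- The symmetrisation. -/
  norm : ∀ V : DivPow k d, Z.obj.obj V →ₗ[k] TPow k (Fin d) V.as
  norm_proj : ∀ V t, norm V (proj V t) = ∑ σ, χ σ • permute k V.as σ t

variable (k d) in
/-- The sign character of the symmetric group with values in `k`. -/
def signChar : Equiv.Perm (Fin d) →* k :=
  ((Int.castRingHom k).toMonoidHom.comp (Units.coeHom ℤ)).comp Equiv.Perm.sign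

lemma signChar_smul {M : Type*} [AddCommGroup M] [Module k M] (σ : Equiv.Perm (Fin d)) (x : M) :
    signChar k d σ • x = Equiv.Perm.sign σ • x := by
  change ((Equiv.Perm.sign σ : ℤ) : k) • x = _
  rw [Int.cast_smul_eq_zsmul]
  rfl

lemma signChar_mul_self (σ : Equiv.Perm (Fin d)) : signChar k d σ * signChar k d σ = 1 := by
  rw [← map_mul]
  change (((Equiv.Perm.sign (σ * σ) : ℤˣ) : ℤ) : k) = 1
  simp

/-- The symmetric power as a quotient of the tensor power. -/
def symQuotient : SignedQuotient (SymRep k d) 1 where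
  proj V := (symRel k d V.as).mkQ
  proj_surjective V := Submodule.mkQ_surjective _
  proj_permute V σ t := by
    rw [MonoidHom.one_apply, one_smul]
    exact (Submodule.Quotient.eq _).mpr (Submodule.subset_span ⟨σ, t, rfl⟩)
  mp_proj _ _ _ _ := rfl
  norm V := (symRel k d V.as).liftQ (∑ σ : Equiv.Perm (Fin d), permute k V.as σ) <| by
    refine Submodule.span_le.mpr ?_
    rintro _ ⟨τ, t, rfl⟩
    rw [SetLike.mem_coe, LinearMap.mem_ker, map_sub, sub_eq_zero, LinearMap.sum_apply,
      LinearMap.sum_apply]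
    exact Fintype.sum_equiv (Equiv.mulRight τ) _ _ fun σ => permute_permute _ _ _
  norm_proj V t := by
    refine (LinearMap.sum_apply _ _ _).trans ?_
    simp

lemma toExt_surjective (M : Type u) [AddCommGroup M] [Module k M] :
    Function.Surjective (toExt k M d) := by
  rw [← LinearMap.range_eq_top]
  refine (Submodule.ker_mkQ _).symm.trans (LinearMap.ker_eq_top.mpr (ext_ind fun t => ?_))
  exact (Submodule.Quotient.mk_eq_zero _).mpr ⟨t, rfl⟩

lemma toExt_permute {M : Type u} [AddCommGroup M] [Module k M] (σ : Equiv.Perm (Fin d))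
    (t : TPow k (Fin d) M) :
    toExt k M d (permute k M σ t) = signChar k d σ • toExt k M d t := by
  induction t using tind with
  | tp x =>
    refine Eq.trans ?_ (signChar_smul (M := ↥(⋀[k]^d M)) σ _).symm
    rw [permute_tprod, toExt_tprod, toExt_tprod, ← Equiv.Perm.sign_symm]
    exact AlternatingMap.map_perm (exteriorPower.ιMulti k d) x σ.symm
  | smul c x h => rw [map_smul, map_smul, map_smul, h, smul_comm]
  | add x y h h' => rw [map_add, map_add, map_add, h, h', smul_add]

lemma toTensorPower_toExt {M : Type u} [AddCommGroup M] [Module k M] (t : TPow k (Fin d) M) :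
    exteriorPower.toTensorPower k M d (toExt k M d t) =
      ∑ σ, signChar k d σ • permute k M σ t := by
  induction t using tind with
  | tp x =>
    rw [toExt_tprod, exteriorPower.toTensorPower_apply_ιMulti]
    refine Fintype.sum_equiv (Equiv.inv _) _ _ fun σ => ?_
    rw [permute_tprod, signChar_smul, Equiv.inv_apply, Equiv.Perm.sign_inv]
    rfl
  | smul c x h =>
    rw [map_smul, map_smul, h, Finset.smul_sum]
    exact Finset.sum_congr rfl fun σ _ => by rw [map_smul, smul_comm]
  | add x y h h' =>
    rw [map_add, map_add, h, h', ← Finset.sum_add_distrib]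
    exact Finset.sum_congr rfl fun σ _ => by rw [map_add, smul_add]

/-- The exterior power as a quotient of the tensor power. -/
def extQuotient : SignedQuotient (ExtRep k d) (signChar k d) where
  proj V := toExt k V.as d
  proj_surjective V := toExt_surjective V.as
  proj_permute _ σ t := toExt_permute σ t
  mp_proj _ _ f t := extHom_toExt f t
  norm V := exteriorPower.toTensorPower k V.as d
  norm_proj _ t := toTensorPower_toExt t

end

/-! ### Natural families on the exterior power -/

section

variable {k : Type u} [CommRing k] {d : ℕ} {U V V' W W' : DivPow k d} {X Y Z : RepGam k d}

variable (k d) in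
/-- The element `e₁ ∧ ⋯ ∧ e_d` of `Λ^d(k^d)`. -/
def omega : (ExtRep k d).obj.obj (stdObj k d) := extQuotient.proj (stdObj k d) (stdTen k d)

lemma mp_br_omega (t : TPow k (Fin d) W.as) :
    mp (ExtRep k d) (br t) (omega k d) = extQuotient.proj W t := by
  rw [omega, extQuotient.mp_proj, actHom_br]

lemma mp_permMor_omega (τ : Equiv.Perm (Fin d)) :
    mp (ExtRep k d) (permMor τ) (omega k d) = signChar k d τ • omega k d := by
  rw [omega, extQuotient.mp_proj, actHom_permMor, extQuotient.proj_permute]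

/-- An element `z` of `Z(k^d ⊗ U)` is killed by the annihilator of `e₁ ∧ ⋯ ∧ e_d`. -/
def IsAnnihilated (Z : RepGam k d) (U : DivPow k d) (z : Z.obj.obj (tensorObj (stdObj k d) U)) :
    Prop :=
  ∀ V (f : stdObj k d ⟶ V), mp (ExtRep k d) f (omega k d) = 0 → mp Z (tensorMap f (𝟙 U)) z = 0

lemma tensorMap_add_left (f g : V ⟶ V') (h : W ⟶ W') :
    tensorMap (f + g) h = tensorMap f h + tensorMap g h :=
  LinearMap.map_add₂ (gmap₂ (Fin d) (tensorB k V.as V'.as W.as W'.as)) f g h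

lemma tensorMap_smul_left (c : k) (f : V ⟶ V') (h : W ⟶ W') :
    tensorMap (c • f) h = c • tensorMap f h :=
  LinearMap.map_smul₂ (gmap₂ (Fin d) (tensorB k V.as V'.as W.as W'.as)) c f h

/-- The annihilation condition is applied to f - c g. -/
lemma IsAnnihilated.mp_eq {z : Z.obj.obj (tensorObj (stdObj k d) U)} (hz : IsAnnihilated Z U z)
    {f g : stdObj k d ⟶ V} (c : k)
    (h : mp (ExtRep k d) f (omega k d) = c • mp (ExtRep k d) g (omega k d)) :
    mp Z (tensorMap f (𝟙 U)) z = c • mp Z (tensorMap g (𝟙 U)) z := by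
  have e : mp (ExtRep k d) (f + (-c) • g) (omega k d) = 0 := by
    rw [mp_add, mp_smul, h, neg_smul, add_neg_cancel]
  have := hz V _ e
  rw [tensorMap_add_left, tensorMap_smul_left, mp_add, mp_smul, neg_smul] at this
  exact eq_of_sub_eq_zero ((sub_eq_add_neg _ _).trans this)

/-- A criterion for couniversality in terms of the value at `e₁ ∧ ⋯ ∧ e_d`. -/
lemma couniversal_of_omega (b : Bil (ExtRep k d) Y Z) (U : DivPow k d)
    (h : ∀ z, IsAnnihilated Z U z → ∃! y : Y.obj.obj U, b.toFun (stdObj k d) U (omega k d) y = z)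
    (φ : ∀ V, (ExtRep k d).obj.obj V → Z.obj.obj (tensorObj V U))
    (hφ : ∀ V V' (f : V ⟶ V') x, φ V' (mp (ExtRep k d) f x) =
      mp Z (tensorMap f (𝟙 U)) (φ V x)) :
    ∃! y : Y.obj.obj U, ∀ V x, b.toFun V U x y = φ V x := by
  -- The φ are mere functions; that they preserve 0 follows from naturality along the zero morphism.
  have h₀ : ∀ V, φ V 0 = 0 := fun V => by
    have := hφ V V 0 0
    rw [map_zero] at this
    rw [this, show tensorMap (0 : V ⟶ V) (𝟙 U) = 0 from
      (gmap₂ (Fin d) (tensorB k V.as V.as U.as U.as)).map_zero₂ _, mp_zero]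
  obtain ⟨y, hy, hu⟩ := h (φ _ (omega k d)) fun V f hf => by rw [← hφ, hf, h₀]
  refine ⟨y, fun V x => ?_, fun y' hy' => hu y' (hy' _ _)⟩
  obtain ⟨t, rfl⟩ := extQuotient.proj_surjective V x
  -- Every element of Λ^d V is an image of ω, so agreement at ω suffices.
  rw [← mp_br_omega, b.nat_left, hφ]
  exact congrArg _ hy

/-- Contraction with the coordinates of `k^d`, as a map `(k^d ⊗ U)^{⊗d} → U^{⊗d}`. -/
def contract (U : DivPow k d) :
    TPow k (Fin d) (tensorObj (stdObj k d) U).as →ₗ[k] TPow k (Fin d) U.as :=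
  PiTensorProduct.map fun j => (TensorProduct.lid k U.as).toLinearMap ∘ₗ
    LinearMap.rTensor U.as (stdForm j)

lemma contract_permute_star (σ : Equiv.Perm (Fin d)) (t : TPow k (Fin d) U.as) :
    contract U (permute k _ σ (star (stdObj k d) U (stdTen k d) t)) =
      if σ = 1 then t else 0 := by
  have key : contract U (permute k _ σ (star (stdObj k d) U (stdTen k d) t)) =
      pairing stdForm (permute k _ σ (stdTen k d)) • permute k U.as σ t := by
    rw [permute_star]
    induction t using tind with
    | tp x =>
      rw [stdTen, permute_tprod, permute_tprod, star_tprod, pairing_tprod]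
      refine (PiTensorProduct.map_tprod _ _).trans ?_
      exact MultilinearMap.map_smul_univ (PiTensorProduct.tprod k) _ _
    | smul c x h => rw [map_smul, map_smul, map_smul, h, smul_comm]
    | add x y h h' => rw [map_add, map_add, map_add, h, h', smul_add]
  rw [key, pairing_permute_stdTen]
  split_ifs with h
  · rw [h, one_smul, permute_one]
  · rw [zero_smul]

lemma map_smulRight (M N : FinProj k) (l : M →ₗ[k] k) (m : M) (x : M ⊗[k] N) :
    TensorProduct.map (l.smulRight m) LinearMap.id x =
      m ⊗ₜ TensorProduct.lid k N (LinearMap.rTensor N l x) := by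
  induction x using TensorProduct.induction_on with
  | zero => simp
  | tmul v u => simp [TensorProduct.smul_tmul]
  | add x y h h' => simp only [map_add, TensorProduct.tmul_add, h, h']

/-- The endomorphism `br (stdTen k d)` symmetrises the tensor of the projections onto the coordinate
lines; on k^d ⊗ U, each term contracts with the coordinates and then multiplies by e₁ ⊗ ⋯ ⊗ e_d. -/
lemma actHom_tensorMap_br (s : TPow k (Fin d) (tensorObj (stdObj k d) U).as) :
    actHom (tensorMap (br (stdTen k d)) (𝟙 U)) s = ∑ σ : Equiv.Perm (Fin d),
      permute k _ σ (star (stdObj k d) U (stdTen k d) (contract U (permute k _ σ⁻¹ s))) := by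
  rw [actHom, ten_tensorMap_id_right, ten_bracket, map_sum, map_sum, LinearMap.sum_apply]
  refine Finset.sum_congr rfl fun σ _ => ?_
  rw [tmap_permute, act_permute_permute (tensorObj (stdObj k d) U).as]
  refine congrArg _ ?_
  generalize permute k (tensorObj (stdObj k d) U).as σ⁻¹ s = w
  induction w using tind with
  | tp x =>
    rw [stdTen, formMul_tprod, tmap_tprod, act_tprod, contract]
    refine Eq.trans ?_ (congrArg (star (stdObj k d) U _) (PiTensorProduct.map_tprod _ _)).symm
    rw [star_tprod]
    exact congrArg (PiTensorProduct.tprod k) (funext fun j =>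
      map_smulRight (stdObj k d).as U.as (stdForm j) (stdVec k d j) (x j))
  | smul c x h => simp only [map_smul, h]
  | add x y h h' => simp only [map_add, h, h']

/-- Symmetrising with χ and contracting with the coordinates is a left inverse, as only the identity
permutation contributes. -/
lemma SignedQuotient.injective_proj_star {χ : Equiv.Perm (Fin d) →* k} (q : SignedQuotient Z χ)
    (U : DivPow k d) : Function.Injective fun t : TPow k (Fin d) U.as =>
      q.proj (tensorObj (stdObj k d) U) (star (stdObj k d) U (stdTen k d) t) := by
  refine Function.LeftInverse.injective (g := fun z => contract U (q.norm _ z)) fun t => ?_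
  beta_reduce
  rw [q.norm_proj, map_sum, Finset.sum_eq_single 1]
  · rw [map_smul, contract_permute_star, if_pos rfl, map_one, one_smul]
  · intro σ _ hσ
    rw [map_smul, contract_permute_star, if_neg hσ, smul_zero]
  · simp

/-- The endomorphism `br (stdTen k d)` of k^d fixes ω, so it fixes every annihilated z. By
`actHom_tensorMap_br` its image consists of classes of the required form, once the permutations are
absorbed into the character. -/
lemma SignedQuotient.exists_proj_star {χ : Equiv.Perm (Fin d) →* k} (q : SignedQuotient Z χ)
    {z : Z.obj.obj (tensorObj (stdObj k d) U)} (hz : IsAnnihilated Z U z) :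
    ∃ t : TPow k (Fin d) U.as,
      q.proj (tensorObj (stdObj k d) U) (star (stdObj k d) U (stdTen k d) t) = z := by
  obtain ⟨s, rfl⟩ := q.proj_surjective _ z
  have h := hz.mp_eq (f := br (stdTen k d)) (g := 𝟙 _) 1
    (by rw [mp_br_omega, mp_id, one_smul]; rfl)
  rw [one_smul, q.mp_proj, actHom_tensorMap_br, map_sum] at h
  refine ⟨∑ σ, χ σ • contract U (permute k _ σ⁻¹ s), ?_⟩
  rw [map_sum, map_sum]
  refine Eq.trans (Finset.sum_congr rfl fun σ _ => ?_) (h.trans ?_)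
  · rw [q.proj_permute, map_smul, map_smul]
  · exact (congrArg (fun f => mp Z f _) (tensorMap_id _ _)).trans (mp_id (X := Z) _)

/-- Permuting coordinates of k^d multiplies ω by the sign, hence also z. On representatives it
permutes e₁ ⊗ ⋯ ⊗ e_d, which up to χ amounts to the inverse permutation of t; then t can be compared
by injectivity. -/
lemma SignedQuotient.permute_eq {χ : Equiv.Perm (Fin d) →* k} (q : SignedQuotient Z χ)
    {t : TPow k (Fin d) U.as} (hz : IsAnnihilated Z U
      (q.proj (tensorObj (stdObj k d) U) (star (stdObj k d) U (stdTen k d) t)))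
    (τ : Equiv.Perm (Fin d)) : χ τ • permute k U.as τ⁻¹ t = signChar k d τ • t := by
  refine q.injective_proj_star U ?_
  beta_reduce
  have h := hz.mp_eq (f := permMor τ) (g := 𝟙 _) (signChar k d τ)
    (by rw [mp_permMor_omega, mp_id])
  rw [q.mp_proj, actHom_tensorMap_star, actHom_permMor, actHom_id] at h
  rw [map_smul, map_smul, map_smul, map_smul, ← q.proj_permute, permute_star, permute_permute,
    mul_inv_cancel, permute_one, h]
  refine congrArg _ ?_
  exact (congrArg (fun f => mp Z f _) (tensorMap_id _ _)).trans (mp_id (X := Z) _)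

lemma tmap₂_congr {ι : Type} {M N P : Type u} [AddCommGroup M] [Module k M] [AddCommGroup N]
    [Module k N] [AddCommGroup P] [Module k P] {B B' : M →ₗ[k] N →ₗ[k] P}
    (h : ∀ x y, B x y = B' x y) (s : TPow k ι M) (t : TPow k ι N) :
    tmap₂ ι B s t = tmap₂ ι B' s t := by rw [LinearMap.ext₂ h]

/-! ### The pairing of a representation with the divided power -/

/-- The linear map `W → Hom(V, V ⊗ W)`. -/
def insertLin (V W : DivPow k d) : W.as →ₗ[k] V.as →ₗ[k] (tensorObj V W).as :=
  (TensorProduct.mk k V.as W.as).flip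

/-- The morphism `V ⟶ V ⊗ W` of `Γ^d P_k` given by an element of `Γ^d W`. -/
def insertGam (V : DivPow k d) (t : (GammaRep k d).obj.obj W) : V ⟶ tensorObj V W :=
  show Gam k (Fin d) (V.as →ₗ[k] (tensorObj V W).as) from
    ⟨tmap (Fin d) (insertLin V W) (Subtype.val (p := (· ∈ Gam k (Fin d) W.as)) t),
      tmap_mem (Subtype.property (p := (· ∈ Gam k (Fin d) W.as)) t)⟩

/-- The underlying tensor of an element of `Γ^d W`. -/
def gamTen (t : (GammaRep k d).obj.obj W) : TPow k (Fin d) W.as :=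
  Subtype.val (p := (· ∈ Gam k (Fin d) W.as)) t

lemma ten_insert (V : DivPow k d) (t : (GammaRep k d).obj.obj W) :
    ten (insertGam V t) = tmap (Fin d) (insertLin V W) (gamTen t) := rfl

lemma gamTen_mp (f : V ⟶ W) (t : (GammaRep k d).obj.obj V) :
    gamTen (mp (GammaRep k d) f t) = actHom f (gamTen t) := rfl

lemma insert_naturality_left (f : V ⟶ V') (t : (GammaRep k d).obj.obj W) :
    f ≫ insertGam V' t = insertGam V t ≫ tensorMap f (𝟙 W) := hom_ext <| by
  rw [ten_comp, ten_comp, ten_insert, ten_insert, ten_tensorMap_id_right, tmap₂_tmap_right,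
    tmap₂_tmap_left, tmap₂_tmap_right, ← tmap₂_flip]
  refine tmap₂_congr (fun w f => LinearMap.ext fun v => ?_) _ _
  rfl

lemma insert_naturality_right (V : DivPow k d) (g : W ⟶ W') (t : (GammaRep k d).obj.obj W) :
    insertGam V (mp (GammaRep k d) g t) = insertGam V t ≫ tensorMap (𝟙 V) g := hom_ext <| by
  rw [ten_comp, ten_insert, ten_insert, gamTen_mp, ten_tensorMap_id_left, actHom,
    act, tmap_tmap₂, tmap₂_tmap_left, tmap₂_tmap_right, ← tmap₂_flip]
  refine tmap₂_congr (fun w f => LinearMap.ext fun v => ?_) _ _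
  rfl

/-- The pairing `X(V) × Γ^d(W) → X(V ⊗ W)`. -/
def gammaBil (X : RepGam k d) : Bil X (GammaRep k d) X where
  toFun V W x t := mp X (insertGam V t) x
  nat_left f W x t := mp_square (X := X) (insert_naturality_left f t) x
  nat_right V W W' g x t := by rw [insert_naturality_right, mp_comp]

variable (k d) in
/-- The object `k` of `Γ^d P_k`. -/
def unitObj : DivPow k d := ⟨FinProj.mk k⟩

variable (k d) in
/-- The generator of `Γ^d k`. -/
def unitElt : (GammaRep k d).obj.obj (unitObj k d) := (diag (Fin d) (1 : k) : Gam k (Fin d) k)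

/-- The linear map `V ⊗ k → V`. -/
def runitLin (V : DivPow k d) : (tensorObj V (unitObj k d)).as →ₗ[k] V.as :=
  (TensorProduct.rid k V.as).toLinearMap

/-- The isomorphism `V ⊗ k ≅ V`. -/
def runit (V : DivPow k d) : tensorObj V (unitObj k d) ⟶ V := ofLin (runitLin V)

lemma insertGam_unitElt_runit (V : DivPow k d) : insertGam V (unitElt k d) ≫ runit V = 𝟙 V :=
  hom_ext <| by
    rw [runit, ten_comp_ofLin, ten_insert, tmap_tmap]
    refine (tmap_tprod _ _).trans (congrArg (PiTensorProduct.tprod k) (funext fun _ => ?_))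
    exact LinearMap.ext fun v => TensorProduct.rid_tmul v 1 |>.trans (one_smul k v)

lemma runit_naturality (f : V ⟶ W) : tensorMap f (𝟙 (unitObj k d)) ≫ runit W = runit V ≫ f :=
  hom_ext <| by
    rw [runit, runit, ten_comp_ofLin, ten_ofLin_comp, ten_tensorMap_id_right, tmap_tmap]
    refine tmap_congr (fun f => ?_) _
    exact TensorProduct.ext' (R := k) (M := V.as) (N := k) (P₂ := W.as) fun v c =>
      (map_smul f c v).symm

/-- The linear map `W → Hom(k, W)`. -/
def pointLin (W : DivPow k d) : W.as →ₗ[k] (unitObj k d).as →ₗ[k] W.as :=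
  (LinearMap.lsmul k W.as).flip

/-- The morphism `k ⟶ W` given by an element of `Γ^d W`. -/
def point (t : (GammaRep k d).obj.obj W) : unitObj k d ⟶ W :=
  show Gam k (Fin d) (k →ₗ[k] W.as) from
    ⟨tmap (Fin d) (LinearMap.lsmul k W.as).flip (gamTen t),
      tmap_mem (Subtype.property (p := (· ∈ Gam k (Fin d) W.as)) t)⟩

lemma ten_point (t : (GammaRep k d).obj.obj W) :
    ten (point t) = tmap (Fin d) (pointLin W) (gamTen t) := rfl

/-- Γ^d is represented by the object k: each element is an image of the generator. -/
lemma mp_point (t : (GammaRep k d).obj.obj W) :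
    mp (GammaRep k d) (point t) (unitElt k d) = t := by
  have h : tmap₂ (Fin d) (LinearMap.id : (k →ₗ[k] W.as) →ₗ[k] k →ₗ[k] W.as)
      (tmap (Fin d) (LinearMap.lsmul k W.as).flip (gamTen t))
      (PiTensorProduct.tprod k fun _ => (1 : k)) = gamTen t := by
    rw [tmap₂_diag_right, tmap_tmap]
    conv_rhs => rw [← tmap_id (gamTen t)]
    exact tmap_congr (fun w => one_smul k w) _
  exact Subtype.ext (p := (· ∈ Gam k (Fin d) W.as)) h

lemma runit_insert (V : DivPow k d) (t : (GammaRep k d).obj.obj W) :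
    runit V ≫ insertGam V t = tensorMap (𝟙 V) (point t) := hom_ext <| by
  rw [runit, ten_ofLin_comp, ten_insert, ten_tensorMap_id_left, ten_point, tmap_tmap, tmap_tmap]
  refine tmap_congr (fun w => ?_) _
  exact TensorProduct.ext' (R := k) (M := V.as) (N := k) (P₂ := V.as ⊗[k] W.as) fun v c =>
    TensorProduct.smul_tmul c v w

/-- Γ^d = Γ^{d,k} is the unit of ⊗: a family on X and Γ^d is determined by its values at the
generator of Γ^d k, which lie in Z'(V ⊗ k) ≅ Z'(V). Any value can be prescribed, since t in Γ^d W is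
the image of the generator under `point t`. -/
lemma gammaBil_universal (hd : 1 ≤ d) (Z' : RepGam k d) (c : Bil X (GammaRep k d) Z') :
    ∃! h : X ⟶ Z', (gammaBil X).postcomp h = c := by
  let φ V (x : X.obj.obj V) := mp Z' (runit V) (c.toFun V (unitObj k d) x (unitElt k d))
  have hφ : ∀ {V W : DivPow k d} (f : V ⟶ W) (x : X.obj.obj V), φ W (mp X f x) = mp Z' f (φ V x) :=
    fun {V W} f x => by
      refine (congrArg (mp Z' (runit W)) (c.nat_left f _ x _)).trans ?_
      exact mp_square (X := Z') (runit_naturality f) _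
  refine ⟨homOfNatural φ (fun V W f x => hφ f x) hd, ?_, fun h hh => ?_⟩
  · ext V W x t
    refine (hφ (insertGam V t) x).trans ?_
    refine (mp_mp_of_eq (X := Z') (runit_insert V t) _).trans ?_
    rw [← c.nat_right, mp_point]
  · refine rep_hom_ext fun V x => ?_
    have e : mp X (runit V) (mp X (insertGam V (unitElt k d)) x) = x := by
      rw [mp_mp_of_eq (insertGam_unitElt_runit V), mp_id]
    have e' : ap h _ (mp X (insertGam V (unitElt k d)) x) = c.toFun V (unitObj k d) x (unitElt k d) :=
      congrFun (congrFun (congrFun (congrFun (congrArg Bil.toFun hh) V) _) x) _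
    refine (congrArg (ap h V) e.symm).trans ((ap_mp h (runit V) _).trans ?_)
    exact congrArg (mp Z' (runit V)) e'

lemma actHom_insert (t : (GammaRep k d).obj.obj W) (a : TPow k (Fin d) V.as) :
    actHom (insertGam V t) a = star V W a (gamTen t) := by
  rw [actHom, ten_insert, act, tmap₂_tmap_left, ← tmap₂_flip]
  rfl

/-- The pairing `Λ^d(V) × Γ^d(W) → Λ^d(V ⊗ W)` is perfect. -/
lemma gammaBil_isPerfect (hd : 1 ≤ d) : (gammaBil (ExtRep k d)).IsPerfect where
  universal := gammaBil_universal hd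
  couniversal U := by
    refine couniversal_of_omega _ U fun z hz => ?_
    obtain ⟨t, rfl⟩ := extQuotient.exists_proj_star hz
    -- For the exterior power χ is itself the sign, so the two signs cancel and t is symmetric.
    have ht : t ∈ Gam k (Fin d) U.as := fun τ => by
      have h := congrArg (signChar k d τ⁻¹ • ·) (extQuotient.permute_eq hz τ⁻¹)
      simpa only [smul_smul, signChar_mul_self, one_smul, inv_inv] using h
    have key : ∀ y : (GammaRep k d).obj.obj U, (gammaBil (ExtRep k d)).toFun (stdObj k d) U
        (omega k d) y = extQuotient.proj _ (star (stdObj k d) U (stdTen k d) (gamTen y)) :=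
      fun y => by
        refine (extQuotient.mp_proj _ _ (insertGam (stdObj k d) y) _).trans ?_
        rw [actHom_insert]
    refine ⟨(⟨t, ht⟩ : Gam k (Fin d) U.as), key _, fun y hy => ?_⟩
    exact Subtype.ext (extQuotient.injective_proj_star U ((key y).symm.trans hy))

end

/-! ### Antisymmetric tensors over a free module -/

section

variable {k : Type u} [CommRing k] {d : ℕ} {M : Type u} [AddCommGroup M] [Module k M]
  {n : ℕ} (b : Module.Basis (Fin n) k M)

open Classical in
/-- An auxiliary map `M^{⊗d} → Λ^d M` for `M` free, keeping only the strictly increasing basis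
tensors. -/
def freeAlt : TPow k (Fin d) M →ₗ[k] ⋀[k]^d M :=
  (tbasis b (Fin d)).constr k fun c =>
    if StrictMono c then exteriorPower.ιMulti k d fun i => b (c i) else 0

open Classical in
lemma freeAlt_apply (c : Fin d → Fin n) :
    freeAlt b (tbasis b (Fin d) c) =
      if StrictMono c then exteriorPower.ιMulti k d fun i => b (c i) else 0 := by
  rw [freeAlt, Module.Basis.constr_basis]

lemma toTensorPower_basis (c : Fin d → Fin n) :
    exteriorPower.toTensorPower k M d (exteriorPower.ιMulti k d fun i => b (c i)) =
      ∑ σ : Equiv.Perm (Fin d), signChar k d σ • tbasis b (Fin d) (c ∘ σ) := by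
  rw [exteriorPower.toTensorPower_apply_ιMulti]
  refine Finset.sum_congr rfl fun σ _ => ?_
  rw [signChar_smul, tbasis_apply]
  rfl

lemma strictMono_comp_sort {c : Fin d → Fin n} (hc : Function.Injective c) :
    StrictMono (c ∘ Tuple.sort c) :=
  (Tuple.monotone_sort c).strictMono_of_injective (hc.comp (Tuple.sort c).injective)

lemma eq_sort {c : Fin d → Fin n} (hc : Function.Injective c) {σ : Equiv.Perm (Fin d)}
    (hσ : StrictMono (c ∘ σ)) : σ = Tuple.sort c :=
  Equiv.ext fun i => hc (congrFun (Tuple.unique_monotone hσ.monotone (Tuple.monotone_sort c)) i)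

/-- Among the rearrangements of an injective multi-index exactly one is increasing, and its sign
occurs twice. -/
lemma freeAlt_toTensorPower (y : ⋀[k]^d M) :
    freeAlt b (exteriorPower.toTensorPower k M d y) = y := by
  classical
  suffices h : freeAlt b ∘ₗ exteriorPower.toTensorPower k M d = LinearMap.id from
    LinearMap.congr_fun h y
  refine exteriorPower.linearMap_ext (Module.Basis.ext_alternating b fun c hc => ?_)
  change freeAlt b (exteriorPower.toTensorPower k M d (exteriorPower.ιMulti k d fun i => b (c i))) =
    exteriorPower.ιMulti k d fun i => b (c i)
  rw [toTensorPower_basis, map_sum, Finset.sum_eq_single (Tuple.sort c)]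
  · rw [map_smul, freeAlt_apply, if_pos (strictMono_comp_sort hc)]
    refine (signChar_smul (M := ↥(⋀[k]^d M)) _ _).trans ?_
    rw [show (fun i => b ((c ∘ Tuple.sort c) i)) = (fun i => b (c i)) ∘ Tuple.sort c from rfl,
      AlternatingMap.map_perm, smul_smul, Int.units_mul_self, one_smul]
  · intro σ _ hσ
    rw [map_smul, freeAlt_apply, if_neg, smul_zero]
    exact fun h => hσ (eq_sort hc h)
  · simp

/-- An antisymmetric tensor without coefficients at repeated indices is determined by its
coefficients at increasing indices. The condition `h₂` has to be demanded separately, because `h₁`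
only yields it up to a factor 2. -/
lemma toTensorPower_freeAlt {t : TPow k (Fin d) M}
    (h₁ : ∀ σ : Equiv.Perm (Fin d), permute k M σ t = signChar k d σ • t)
    (h₂ : ∀ c : Fin d → Fin n, ¬ Function.Injective c → (tbasis b (Fin d)).repr t c = 0) :
    exteriorPower.toTensorPower k M d (freeAlt b t) = t := by
  classical
  refine (tbasis b (Fin d)).ext_elem fun c₀ => ?_
  have e : exteriorPower.toTensorPower k M d (freeAlt b t) = ∑ c : Fin d → Fin n,
      (tbasis b (Fin d)).repr t c • if StrictMono c then
        ∑ σ : Equiv.Perm (Fin d), signChar k d σ • tbasis b (Fin d) (c ∘ σ) else 0 := by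
    conv_lhs => rw [← (tbasis b (Fin d)).sum_repr t]
    simp only [map_sum, map_smul]
    refine Finset.sum_congr rfl fun c _ => congrArg _ ?_
    rw [freeAlt_apply]
    split_ifs
    · exact toTensorPower_basis b c
    · rw [map_zero]
  rw [e, map_sum, Finsupp.finsetSum_apply]
  -- An increasing c with c ∘ σ = c₀ must be the sorted version of c₀, so each coefficient receives
  -- at most one contribution.
  have key : ∀ c : Fin d → Fin n, StrictMono c → ∀ σ : Equiv.Perm (Fin d), c ∘ σ = c₀ →
      Function.Injective c₀ ∧ c = c₀ ∘ Tuple.sort c₀ ∧ σ = (Tuple.sort c₀)⁻¹ := fun c hc σ h => by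
    have hi : Function.Injective c₀ := h ▸ hc.injective.comp σ.injective
    have hc' : c = c₀ ∘ σ.symm := by rw [← h]; ext; simp
    have := eq_sort hi (hc' ▸ hc)
    exact ⟨hi, this ▸ hc', by rw [← this]; rfl⟩
  have key' : ∀ c : Fin d → Fin n, ¬ (Function.Injective c₀ ∧ c = c₀ ∘ Tuple.sort c₀) →
      (tbasis b (Fin d)).repr ((tbasis b (Fin d)).repr t c • if StrictMono c then
        ∑ σ : Equiv.Perm (Fin d), signChar k d σ • tbasis b (Fin d) (c ∘ σ) else 0) c₀ = 0 :=
    fun c hc => by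
      split_ifs with h
      · rw [map_smul, map_sum, Finsupp.smul_apply, Finsupp.finsetSum_apply,
          Finset.sum_eq_zero, smul_zero]
        intro σ _
        rw [map_smul, Module.Basis.repr_self, Finsupp.smul_apply, Finsupp.single_eq_of_ne,
          smul_zero]
        exact fun hσ => hc ⟨(key c h σ hσ.symm).1, (key c h σ hσ.symm).2.1⟩
      · simp
  by_cases hi : Function.Injective c₀
  · rw [Finset.sum_eq_single (c₀ ∘ Tuple.sort c₀) (fun c _ hc => key' c fun h => hc h.2) (by simp),
      if_pos (strictMono_comp_sort hi), map_smul, map_sum, Finsupp.smul_apply,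
      Finsupp.finsetSum_apply, Finset.sum_eq_single (Tuple.sort c₀)⁻¹]
    · have e : (c₀ ∘ Tuple.sort c₀) ∘ ((Tuple.sort c₀)⁻¹ : Equiv.Perm (Fin d)) = c₀ := by
        ext; simp
      rw [e, map_smul, Module.Basis.repr_self, Finsupp.smul_apply, Finsupp.single_eq_same,
        ← tbasis_repr_permute, h₁, map_smul, Finsupp.smul_apply, smul_eq_mul, smul_eq_mul,
        smul_eq_mul, mul_one, mul_right_comm, ← map_mul, mul_inv_cancel, map_one, one_mul]
    · intro σ _ hσ
      rw [map_smul, Module.Basis.repr_self, Finsupp.smul_apply, Finsupp.single_eq_of_ne, smul_zero]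
      exact fun h => hσ (key _ (strictMono_comp_sort hi) σ h.symm).2.2
    · simp
  · rw [h₂ c₀ hi]
    exact Finset.sum_eq_zero fun c _ => key' c fun h => hi h.1

end

/-! ### The pairing of two exterior powers -/

section

variable {k : Type u} [CommRing k] {d : ℕ} {U V V' W W' : DivPow k d} {X Y Z : RepGam k d}

/-- The projection `V^{⊗d} → S^d V`. -/
abbrev symProj (V : DivPow k d) : TPow k (Fin d) V.as →ₗ[k] (SymRep k d).obj.obj V :=
  symQuotient.proj V

/-- The bilinear map `V^{⊗d} × Λ^d W → S^d(V ⊗ W)`. -/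
def detAux (V W : DivPow k d) : TPow k (Fin d) V.as →ₗ[k] ⋀[k]^d W.as →ₗ[k]
    (SymRep k d).obj.obj (tensorObj V W) :=
  ((star V W).compr₂ (symProj (tensorObj V W))).compl₂ (exteriorPower.toTensorPower k W.as d)

lemma detAux_apply (a : TPow k (Fin d) V.as) (y : ⋀[k]^d W.as) :
    detAux V W a y =
      symProj (tensorObj V W) (star V W a (exteriorPower.toTensorPower k W.as d y)) := rfl

/-- A determinant with two equal rows vanishes: the transposition (i j) fixes v and acts trivially
on S^d, so the terms for σ and (i j)σ agree up to opposite signs. -/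
lemma detAux_eq_zero {v : Fin d → V.as} {i j : Fin d} (hv : v i = v j) (hij : i ≠ j) :
    detAux V W (PiTensorProduct.tprod k v) = 0 := by
  refine ext_ind fun s => ?_
  rw [detAux_apply, toTensorPower_toExt, LinearMap.zero_apply, map_sum, map_sum]
  have h : ∀ σ : Equiv.Perm (Fin d), symProj (tensorObj V W) (star V W (PiTensorProduct.tprod k v)
      (permute k W.as (Equiv.swap i j * σ) s)) =
        symProj (tensorObj V W) (star V W (PiTensorProduct.tprod k v) (permute k W.as σ s)) :=
    fun σ => by
      have hv' : permute k V.as (Equiv.swap i j) (PiTensorProduct.tprod k v) =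
          PiTensorProduct.tprod k v := by
        rw [permute_tprod, Equiv.symm_swap]
        refine congrArg _ (funext fun l => ?_)
        rw [Equiv.apply_swap_eq_self hv]
      rw [← permute_permute]
      conv_lhs => rw [← hv']
      rw [← permute_star, symQuotient.proj_permute, MonoidHom.one_apply, one_smul]
  refine Finset.sum_involution (fun σ _ => Equiv.swap i j * σ) (fun σ _ => ?_) (fun σ _ _ h' => ?_)
    (fun _ _ => Finset.mem_univ _) (fun σ _ => by rw [← mul_assoc, Equiv.swap_mul_self, one_mul])
  · rw [map_smul, map_smul, map_smul, map_smul, h, ← add_smul]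
    have : signChar k d (Equiv.swap i j * σ) = - signChar k d σ := by
      rw [map_mul]
      change (((Equiv.Perm.sign (Equiv.swap i j) : ℤˣ) : ℤ) : k) * _ = _
      rw [Equiv.Perm.sign_swap hij]
      simp
    rw [this, add_neg_cancel, zero_smul]
  · exact hij (Equiv.swap_eq_one_iff.mp (mul_eq_right.mp h'))

/-- The bilinear map `Λ^d V × Λ^d W → S^d(V ⊗ W)` given by determinants. -/
def detLin (V W : DivPow k d) : ⋀[k]^d V.as →ₗ[k] ⋀[k]^d W.as →ₗ[k]
    (SymRep k d).obj.obj (tensorObj V W) :=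
  exteriorPower.alternatingMapLinearEquiv
    { (detAux V W).compMultilinearMap (PiTensorProduct.tprod k) with
      map_eq_zero_of_eq' := fun _ _ _ hv hij => detAux_eq_zero hv hij }

lemma detLin_toExt (a : TPow k (Fin d) V.as) : detLin V W (toExt k V.as d a) = detAux V W a := by
  induction a using tind with
  | tp x =>
    rw [toExt_tprod, detLin, exteriorPower.alternatingMapLinearEquiv_apply_ιMulti]
    rfl
  | smul c x h => simp only [map_smul, h]
  | add x y h h' => simp only [map_add, h, h']

lemma toTensorPower_extHom (f : V ⟶ W) (y : ⋀[k]^d V.as) :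
    exteriorPower.toTensorPower k W.as d (extHom f y) =
      actHom f (exteriorPower.toTensorPower k V.as d y) := by
  suffices h : exteriorPower.toTensorPower k W.as d ∘ₗ extHom f =
      actHom f ∘ₗ exteriorPower.toTensorPower k V.as d from LinearMap.congr_fun h y
  refine ext_ind fun t => ?_
  rw [LinearMap.comp_apply, LinearMap.comp_apply, extHom_toExt, toTensorPower_toExt,
    toTensorPower_toExt, map_sum]
  exact Finset.sum_congr rfl fun σ _ => by rw [map_smul, actHom_permute]

lemma detLin_extHom_left (f : V ⟶ V') (x : ⋀[k]^d V.as) (y : ⋀[k]^d W.as) :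
    detLin V' W (extHom f x) y = mp (SymRep k d) (tensorMap f (𝟙 W)) (detLin V W x y) := by
  obtain ⟨a, rfl⟩ := toExt_surjective V.as x
  rw [extHom_toExt, detLin_toExt, detLin_toExt, detAux_apply, detAux_apply, symQuotient.mp_proj,
    actHom_tensorMap_star, actHom_id]

lemma detLin_extHom_right (g : W ⟶ W') (x : ⋀[k]^d V.as) (y : ⋀[k]^d W.as) :
    detLin V W' x (extHom g y) = mp (SymRep k d) (tensorMap (𝟙 V) g) (detLin V W x y) := by
  obtain ⟨a, rfl⟩ := toExt_surjective V.as x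
  rw [detLin_toExt, detLin_toExt, detAux_apply, detAux_apply, symQuotient.mp_proj,
    actHom_tensorMap_star, actHom_id, toTensorPower_extHom]

variable (k d) in
/-- The pairing `Λ^d(V) × Λ^d(W) → S^d(V ⊗ W)` given by determinants. -/
def detBil : Bil (ExtRep k d) (ExtRep k d) (SymRep k d) where
  toFun V W x y := detLin V W x y
  nat_left f _ x y := detLin_extHom_left f x y
  nat_right _ _ _ g x y := detLin_extHom_right g x y

lemma detBil_omega (y : (ExtRep k d).obj.obj U) :
    (detBil k d).toFun (stdObj k d) U (omega k d) y = symProj (tensorObj (stdObj k d) U)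
      (star (stdObj k d) U (stdTen k d) (exteriorPower.toTensorPower k U.as d y)) :=
  LinearMap.congr_fun (detLin_toExt (stdTen k d)) y

lemma signChar_inv (σ : Equiv.Perm (Fin d)) : signChar k d σ⁻¹ = signChar k d σ := by
  change (((Equiv.Perm.sign σ⁻¹ : ℤˣ) : ℤ) : k) = _
  rw [Equiv.Perm.sign_inv]
  rfl

/-! ### Couniversality -/

/-- The map `k^d → k^d` sending `e_l` to `e_{m(l)}`. -/
def collapse (m : Fin d → Fin d) : (stdObj k d).as →ₗ[k] (stdObj k d).as :=
  Fintype.linearCombination k fun l => stdVec k d (m l)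

lemma actHom_collapse (m : Fin d → Fin d) :
    actHom (ofLin (collapse m)) (stdTen k d) =
      PiTensorProduct.tprod k fun l => stdVec k d (m l) := by
  refine (act_tprod _ _).trans (congrArg _ (funext fun l => ?_))
  exact (Fintype.linearCombination_apply_single k _ l 1).trans (one_smul k _)

section

variable {n : ℕ} (b : Module.Basis (Fin n) k U.as)

/-- The basis of `k^d ⊗ U` given by a basis of `U`. -/
def tensorBasis : Module.Basis (Fin d × Fin n) k (tensorObj (stdObj k d) U).as :=
  Module.Basis.tensorProduct (Pi.basisFun k (Fin d)) b

lemma tensorBasis_repr_star (m : Fin d → Fin d) (t : TPow k (Fin d) U.as)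
    (p : Fin d → Fin d × Fin n) :
    (tbasis (tensorBasis b) (Fin d)).repr
        (star (stdObj k d) U (PiTensorProduct.tprod k fun l => stdVec k d (m l)) t) p =
      if (fun l => (p l).1) = m then (tbasis b (Fin d)).repr t fun l => (p l).2 else 0 := by
  induction t using tind with
  | tp y =>
    rw [star_tprod, tbasis, tbasis]
    refine (Basis.piTensorProduct_repr_tprod_apply _ _ _).trans ?_
    have h : ∀ l, (tensorBasis b).repr (stdVec k d (m l) ⊗ₜ[k] y l) (p l) =
        (if (p l).1 = m l then 1 else 0) * b.repr (y l) (p l).2 := fun l => by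
      refine (Module.Basis.tensorProduct_repr_tmul_apply (Pi.basisFun k (Fin d)) b
        (Pi.single (m l) 1) (y l) (p l).1 (p l).2).trans ?_
      rw [Pi.basisFun_repr, Pi.single_apply, smul_eq_mul, mul_comm]
    rw [Finset.prod_congr rfl fun l _ => h l, Finset.prod_mul_distrib,
      Basis.piTensorProduct_repr_tprod_apply]
    split_ifs with hp
    · rw [Finset.prod_eq_one fun l _ => if_pos (congrFun hp l), one_mul]
    · obtain ⟨l, hl⟩ := Function.ne_iff.mp hp
      rw [Finset.prod_eq_zero (Finset.mem_univ l) (if_neg hl), zero_mul]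
  | smul c x h =>
    rw [map_smul, map_smul, map_smul, Finsupp.smul_apply, Finsupp.smul_apply, h]
    split_ifs <;> simp
  | add x y h h' =>
    rw [map_add, map_add, map_add, Finsupp.add_apply, Finsupp.add_apply, h, h']
    split_ifs <;> simp

/-- Suppose c i = c j with i ≠ j. Replacing e_j by e_i kills ω, so it kills the class of e₁ ⊗ ⋯ ⊗
e_d times t in S^d(k^d ⊗ U). The sum of coefficients over one orbit of multi-indices is a linear
form on S^d, and for a suitable orbit it returns exactly the coefficient of t at c. -/
lemma repr_eq_zero_of_isAnnihilated {t : TPow k (Fin d) U.as}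
    (ht : IsAnnihilated (SymRep k d) U (symProj _ (star (stdObj k d) U (stdTen k d) t)))
    {c : Fin d → Fin n} (hc : ¬ Function.Injective c) : (tbasis b (Fin d)).repr t c = 0 := by
  classical
  obtain ⟨i, j, hij, hne⟩ : ∃ i j, c i = c j ∧ i ≠ j := by
    simpa [Function.Injective] using hc
  -- m sends j to i and fixes the rest, so c ∘ m = c.
  let m : Fin d → Fin d := Function.update id j i
  have hcm : ∀ l, c (m l) = c l := fun l => by
    rcases eq_or_ne l j with rfl | h
    · simp [m, hij]
    · simp [m, h]
  have h₀ : symProj (tensorObj (stdObj k d) U) (star (stdObj k d) U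
      (PiTensorProduct.tprod k fun l => stdVec k d (m l)) t) = 0 := by
    have h := ht _ (ofLin (collapse m)) (by
      rw [omega, extQuotient.mp_proj, actHom_collapse]
      refine (toExt_tprod _).trans ?_
      exact AlternatingMap.map_eq_zero_of_eq _ _ (i := i) (j := j) (by simp [m, hne]) hne)
    rwa [symQuotient.mp_proj, actHom_tensorMap_star, actHom_id, actHom_collapse] at h
  let p₀ : Fin d → Fin d × Fin n := fun l => (m l, c l)
  -- The orbit of `p₀` is recognised by its representative; summing over a whole orbit makes L
  -- vanish on the relations of S^d.
  let L : TPow k (Fin d) (tensorObj (stdObj k d) U).as →ₗ[k] k :=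
    ∑ p : Fin d → Fin d × Fin n, if rep p = rep p₀ then
      (tbasis (tensorBasis b) (Fin d)).coord p else 0
  have hL' : ∀ s, L s = ∑ p : Fin d → Fin d × Fin n, if rep p = rep p₀ then
      (tbasis (tensorBasis b) (Fin d)).repr s p else 0 := fun s => by
    rw [LinearMap.sum_apply]
    exact Finset.sum_congr rfl fun p _ => by split_ifs <;> rfl
  have hL : symRel k d (tensorObj (stdObj k d) U).as ≤ LinearMap.ker L := by
    refine Submodule.span_le.mpr ?_
    rintro _ ⟨σ, s, rfl⟩
    rw [SetLike.mem_coe, LinearMap.mem_ker, map_sub, sub_eq_zero, hL', hL']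
    refine Fintype.sum_equiv (Equiv.arrowCongr σ.symm (Equiv.refl _)) _ _ fun p => ?_
    have e : Equiv.arrowCongr σ.symm (Equiv.refl _) p = p ∘ σ := rfl
    rw [e, rep_comp, tbasis_repr_permute]
  have h₁ := hL ((Submodule.Quotient.mk_eq_zero _).mp h₀)
  rw [LinearMap.mem_ker, hL', Finset.sum_eq_single p₀] at h₁
  · rwa [if_pos rfl, tensorBasis_repr_star, if_pos rfl] at h₁
  -- A rearrangement p = p₀ ∘ ρ with first component m satisfies m ∘ ρ = m, hence c ∘ ρ = c because
  -- c = c ∘ m, so p = p₀. The coefficient is therefore not multiplied by an orbit count.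
  · intro p _ hp
    split_ifs with hrep
    · rw [tensorBasis_repr_star, if_neg]
      intro hm
      refine hp ?_
      obtain ⟨σ, hσ⟩ := rep_spec p
      obtain ⟨τ, hτ⟩ := rep_spec p₀
      have e : p = p₀ ∘ (σ.symm.trans τ) := by
        funext l
        have := congrFun (hσ.symm.trans (hrep.trans hτ)) (σ.symm l)
        simpa using this
      have hm' : ∀ l, m ((σ.symm.trans τ) l) = m l := fun l => by
        rw [← congrFun hm l, e]
        rfl
      rw [e]
      funext l
      refine Prod.ext (hm' l) ?_
      change c ((σ.symm.trans τ) l) = c l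
      rw [← hcm, hm', hcm]
    · rfl
  · simp

end

/-- The object `k^n` of `Γ^d P_k`. -/
def freeObj (k : Type u) [CommRing k] (d n : ℕ) : DivPow k d := ⟨FinProj.mk (Fin n → k)⟩

lemma exists_retract (U : DivPow k d) : ∃ (n : ℕ) (i : U ⟶ freeObj k d n)
    (p : freeObj k d n ⟶ U), i ≫ p = 𝟙 U := by
  obtain ⟨n, p, s, -, -, h⟩ := Module.Finite.exists_comp_eq_id_of_projective k U.as
  refine ⟨n, ofLin (W := freeObj k d n) s, ofLin (V := freeObj k d n) p, ?_⟩
  exact (ofLin_comp (V := freeObj k d n) s p).trans (congrArg ofLin h)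

/-- Here χ is trivial, so t is antisymmetric, and its coefficients at repeated indices vanish; thus
t is the antisymmetrisation of a unique element of Λ^d U. -/
lemma detBil_couniversal_free {n : ℕ} (b : Module.Basis (Fin n) k U.as)
    {z : (SymRep k d).obj.obj (tensorObj (stdObj k d) U)} (hz : IsAnnihilated (SymRep k d) U z) :
    ∃! y, (detBil k d).toFun (stdObj k d) U (omega k d) y = z := by
  obtain ⟨t, rfl⟩ := symQuotient.exists_proj_star hz
  have h₁ : ∀ σ : Equiv.Perm (Fin d), permute k U.as σ t = signChar k d σ • t := fun σ => by
    have h := symQuotient.permute_eq hz σ⁻¹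
    rw [MonoidHom.one_apply, one_smul, inv_inv] at h
    rw [h, signChar_inv]
  refine ⟨freeAlt b t, ?_, fun y hy => ?_⟩
  · refine (detBil_omega _).trans ?_
    rw [toTensorPower_freeAlt b h₁ fun c hc => repr_eq_zero_of_isAnnihilated b hz hc]
  · have := symQuotient.injective_proj_star U ((detBil_omega y).symm.trans hy)
    refine (freeAlt_toTensorPower b y).symm.trans ?_
    exact congrArg (freeAlt b) this

lemma mp_tensorMap_retract {i : U ⟶ V} {p : V ⟶ U} (h : i ≫ p = 𝟙 U)
    (z : Z.obj.obj (tensorObj W U)) :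
    mp Z (tensorMap (𝟙 W) p) (mp Z (tensorMap (𝟙 W) i) z) = z :=
  mp_mp_cancel (by rw [← tensorMap_comp_right, h, tensorMap_id]) z

/-- U is a retract of a free object, and both existence and uniqueness pass to retracts by
naturality in U. -/
lemma detBil_couniversal {z : (SymRep k d).obj.obj (tensorObj (stdObj k d) U)}
    (hz : IsAnnihilated (SymRep k d) U z) :
    ∃! y, (detBil k d).toFun (stdObj k d) U (omega k d) y = z := by
  obtain ⟨n, i, p, hip⟩ := exists_retract U
  have hb : ∀ z', IsAnnihilated (SymRep k d) (freeObj k d n) z' →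
      ∃! y, (detBil k d).toFun (stdObj k d) (freeObj k d n) (omega k d) y = z' := fun z' hz' =>
    detBil_couniversal_free (U := freeObj k d n) (Pi.basisFun k (Fin n)) hz'
  have hi : IsAnnihilated (SymRep k d) (freeObj k d n)
      (mp (SymRep k d) (tensorMap (𝟙 _) i) z) := fun V f hf => by
    rw [mp_square (tensorMap_swap f i).symm, hz V f hf, map_zero]
  obtain ⟨y, hy, hu⟩ := hb _ hi
  refine ⟨mp (ExtRep k d) p y, ?_, fun y' hy' => ?_⟩
  · beta_reduce
    rw [(detBil k d).nat_right, hy, mp_tensorMap_retract hip]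
  · rw [← hu (mp (ExtRep k d) i y') (((detBil k d).nat_right _ i _ y').trans (congrArg _ hy')),
      mp_mp_cancel hip]

/-! ### Universality -/

/-- Components of a bilinear family are mere functions; homogeneity is naturality along r times the
identity. -/
lemma Bil.smul_left (c : Bil X Y Z) (r : k) (x : X.obj.obj V) (y : Y.obj.obj W) :
    c.toFun V W (r • x) y = r • c.toFun V W x y := by
  have h := c.nat_left (r • 𝟙 V) W x y
  rwa [mp_smul, mp_id, tensorMap_smul_left, mp_smul, tensorMap_id, mp_id] at h

lemma Bil.smul_right (c : Bil X Y Z) (r : k) (x : X.obj.obj V) (y : Y.obj.obj W) :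
    c.toFun V W x (r • y) = r • c.toFun V W x y := by
  have h := c.nat_right V (r • 𝟙 W) x y
  have e : tensorMap (𝟙 V) (r • 𝟙 W) = r • tensorMap (𝟙 V) (𝟙 W) :=
    (gmap₂ (Fin d) (tensorB k V.as V.as W.as W.as) (𝟙 V : V ⟶ V)).map_smul r (𝟙 W)
  rwa [mp_smul, mp_id, e, mp_smul, tensorMap_id, mp_id] at h

lemma pairing_mulForm_star (ε : Fin d → V.as →ₗ[k] k) (ε' : Fin d → W.as →ₗ[k] k)
    (a : TPow k (Fin d) V.as) (b : TPow k (Fin d) W.as) :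
    pairing (fun j => mulForm (ε j) (ε' j)) (star V W a b) = pairing ε a * pairing ε' b := by
  induction a using tind with
  | tp x =>
    induction b using tind with
    | tp y =>
      rw [star_tprod, pairing_tprod, pairing_tprod, ← Finset.prod_mul_distrib]
      exact pairing_tprod (M := (tensorObj V W).as) _ _
    | smul c x h => rw [map_smul, map_smul, map_smul, h, smul_eq_mul, smul_eq_mul, mul_left_comm]
    | add x y h h' => rw [map_add, map_add, map_add, h, h', mul_add]
  | smul c x h =>
    rw [map_smul, map_smul, LinearMap.smul_apply, map_smul, h, smul_eq_mul, smul_eq_mul, mul_assoc]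
  | add x y h h' => rw [map_add, map_add, LinearMap.add_apply, map_add, h, h', add_mul]

variable (k d) in
/-- The linear forms `e_j^* ⊗ e_j^*` on `k^d ⊗ k^d`. -/
def sqForm (j : Fin d) : (tensorObj (stdObj k d) (stdObj k d)).as →ₗ[k] k :=
  mulForm (stdForm j) (stdForm j)

lemma tensorMap_permMor_comp_bracket (σ τ : Equiv.Perm (Fin d)) (t : TPow k (Fin d) W.as) :
    tensorMap (permMor σ) (permMor τ) ≫ bracket (sqForm k d) t =
      bracket (fun j => mulForm (stdForm (σ j)) (stdForm (τ j))) t := by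
  rw [permMor, permMor, tensorMap_ofLin, ofLin_comp_bracket]
  refine congrArg (fun ε => bracket ε t) (funext fun j => ?_)
  exact TensorProduct.ext' (R := k) (M := Fin d → k) (N := Fin d → k) (P₂ := k) fun v w => rfl

variable (k d) in
/-- The value of the determinant pairing at `ω, ω`. -/
def detTen : TPow k (Fin d) (tensorObj (stdObj k d) (stdObj k d)).as :=
  ∑ σ, signChar k d σ • star (stdObj k d) (stdObj k d) (stdTen k d)
    (permute k _ σ (stdTen k d))

lemma detBil_omega_omega : (detBil k d).toFun (stdObj k d) (stdObj k d) (omega k d) (omega k d) =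
    symProj _ (detTen k d) := by
  rw [detBil_omega, detTen]
  refine congrArg _ ?_
  refine (congrArg (star _ _ _) (toTensorPower_toExt (stdTen k d))).trans ?_
  simp only [map_sum, map_smul]

/-- The determinant of (ω, ω) generates S^d. -/
lemma mp_bracket_detTen (t : TPow k (Fin d) W.as) :
    mp (SymRep k d) (bracket (sqForm k d) t) (symProj _ (detTen k d)) = symProj W t := by
  rw [symQuotient.mp_proj, actHom_bracket, map_sum]
  -- Pairing with the forms e_j^* ⊗ e_j^* forces the permutations of both factors to be trivial, so
  -- only one term of the determinant is seen.
  have h : ∀ σ : Equiv.Perm (Fin d), pairing (sqForm k d) (permute k _ σ (detTen k d)) =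
      if σ = 1 then 1 else 0 := fun σ => by
    rw [detTen, map_sum, map_sum]
    have h' : ∀ τ : Equiv.Perm (Fin d), pairing (sqForm k d) (permute k _ σ (signChar k d τ •
        star (stdObj k d) (stdObj k d) (stdTen k d) (permute k _ τ (stdTen k d)))) =
        signChar k d τ * ((if σ = 1 then 1 else 0) * if σ * τ = 1 then 1 else 0) := fun τ => by
      rw [map_smul, map_smul, permute_star, permute_permute, smul_eq_mul]
      refine congrArg _ ((pairing_mulForm_star stdForm stdForm _ _).trans ?_)
      rw [pairing_permute_stdTen, pairing_permute_stdTen]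
    rw [Finset.sum_congr rfl fun τ _ => h' τ, Finset.sum_eq_single 1]
    · by_cases hσ : σ = 1 <;> simp [hσ]
    · intro τ _ hτ
      by_cases hσ : σ = 1
      · simp [hσ, hτ]
      · simp [hσ]
    · exact fun h => absurd (Finset.mem_univ _) h
  rw [Finset.sum_eq_single 1]
  · rw [h, if_pos inv_one, one_smul, permute_one]
  · intro σ _ hσ
    rw [h, if_neg (inv_ne_one.mpr hσ), zero_smul, map_zero]
  · exact fun h => absurd (Finset.mem_univ _) h

section

variable (c : Bil (ExtRep k d) (ExtRep k d) Z)

/-- The value of a bilinear family at `ω, ω`. -/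
def Bil.atOmega : Z.obj.obj (tensorObj (stdObj k d) (stdObj k d)) :=
  c.toFun (stdObj k d) (stdObj k d) (omega k d) (omega k d)

lemma Bil.mp_permMor_atOmega (σ τ : Equiv.Perm (Fin d)) :
    mp Z (tensorMap (permMor σ) (permMor τ)) c.atOmega =
      (signChar k d σ * signChar k d τ) • c.atOmega := by
  have e : tensorMap (permMor (k := k) σ) (permMor τ) =
      tensorMap (permMor σ) (𝟙 _) ≫ tensorMap (𝟙 _) (permMor τ) := by
    rw [← tensorMap_comp, Category.id_comp, Category.comp_id]
  rw [e, mp_comp, Bil.atOmega, ← c.nat_left, ← c.nat_right, mp_permMor_omega, mp_permMor_omega,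
    c.smul_left, c.smul_right, smul_smul]

/-- The linear map `V^{⊗d} → Z(V)` determined by the value of a bilinear family at `ω, ω`. -/
def Bil.descTen (V : DivPow k d) : TPow k (Fin d) V.as →ₗ[k] Z.obj.obj V :=
  (mpLin Z _ V).flip c.atOmega ∘ₗ bracket (sqForm k d)

lemma Bil.descTen_apply (t : TPow k (Fin d) V.as) :
    c.descTen V t = mp Z (bracket (sqForm k d) t) c.atOmega := rfl

/-- A simultaneous permutation of both copies of k^d multiplies (ω, ω) by the square of the sign,
which is 1, so the map descends to S^d. -/
lemma Bil.descTen_permute (τ : Equiv.Perm (Fin d)) (t : TPow k (Fin d) V.as) :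
    c.descTen V (permute k V.as τ t) = c.descTen V t := by
  rw [c.descTen_apply, bracket_permute]
  have e := tensorMap_permMor_comp_bracket τ τ t
  refine (congrArg (fun f => mp Z f c.atOmega) e.symm).trans ?_
  rw [mp_comp, c.mp_permMor_atOmega, signChar_mul_self, one_smul, c.descTen_apply]

/-- The morphism from the symmetric power determined by a bilinear family. -/
def Bil.desc : SymRep k d ⟶ Z :=
  repHom (X := SymRep k d) (fun V => (symRel k d V.as).liftQ (c.descTen V) <| by
    refine Submodule.span_le.mpr ?_
    rintro _ ⟨τ, t, rfl⟩
    rw [SetLike.mem_coe, LinearMap.mem_ker, map_sub, sub_eq_zero, c.descTen_permute])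
  fun V W f x => by
    obtain ⟨t, rfl⟩ := symQuotient.proj_surjective V x
    change c.descTen W (actHom f t) = mp Z f (c.descTen V t)
    rw [c.descTen_apply, c.descTen_apply, ← bracket_comp, mp_comp]

lemma Bil.desc_symProj (t : TPow k (Fin d) V.as) :
    ap c.desc V (symProj V t) = mp Z (bracket (sqForm k d) t) c.atOmega := rfl

/-- The endomorphism `br (stdTen k d)` fixes ω in both arguments. Expanding its tensor square over
relative permutations turns c(ω, ω) into the signed sum defining the determinant. -/
lemma Bil.desc_detTen : ap c.desc _ (symProj _ (detTen k d)) = c.atOmega := by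
  have h : mp Z (tensorMap (br (stdTen k d)) (br (stdTen k d))) c.atOmega = c.atOmega := by
    have e : tensorMap (br (stdTen k d)) (br (stdTen k d)) =
        tensorMap (br (stdTen k d)) (𝟙 _) ≫ tensorMap (𝟙 _) (br (stdTen k d)) := by
      rw [← tensorMap_comp, Category.id_comp, Category.comp_id]
    rw [e, mp_comp, Bil.atOmega, ← c.nat_left, ← c.nat_right, mp_br_omega]
    rfl
  rw [← h, tensorMap_bracket, mp_sum, detTen, map_sum, map_sum]
  refine Finset.sum_congr rfl fun σ _ => ?_
  rw [map_smul, map_smul, c.desc_symProj]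
  have e := tensorMap_permMor_comp_bracket 1 σ⁻¹ (star (stdObj k d) (stdObj k d) (stdTen k d)
    (permute k _ σ (stdTen k d)))
  refine Eq.trans ?_ (congrArg (fun f => mp Z f c.atOmega) e)
  rw [mp_comp, c.mp_permMor_atOmega, map_one, one_mul, signChar_inv, map_smul]

end

/-- All arguments are images of (ω, ω), so families are compared there: `Bil.desc_detTen` gives
existence, and uniqueness holds since S^d is generated by the determinant of (ω, ω). -/
lemma detBil_universal (Z' : RepGam k d) (c : Bil (ExtRep k d) (ExtRep k d) Z') :
    ∃! h : SymRep k d ⟶ Z', (detBil k d).postcomp h = c := by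
  refine ⟨c.desc, ?_, fun h hh => ?_⟩
  · ext V W x y
    obtain ⟨a, rfl⟩ := extQuotient.proj_surjective V x
    obtain ⟨s, rfl⟩ := extQuotient.proj_surjective W y
    rw [← mp_br_omega, ← mp_br_omega, Bil.nat_left, Bil.nat_right, c.nat_left, c.nat_right]
    refine congrArg _ (congrArg _ ?_)
    refine Eq.trans ?_ c.desc_detTen
    exact congrArg (ap c.desc _) detBil_omega_omega
  · refine rep_hom_ext fun V x => ?_
    obtain ⟨t, rfl⟩ := symQuotient.proj_surjective V x
    refine Eq.trans ?_ (c.desc_symProj t).symm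
    have e : ap h _ (symProj _ (detTen k d)) = c.atOmega :=
      (congrArg (ap h _) detBil_omega_omega.symm).trans
        (congrFun (congrFun (congrFun (congrFun (congrArg Bil.toFun hh) _) _) _) _)
    rw [← e, ← ap_mp, mp_bracket_detTen]

/-- The pairing `Λ^d(V) × Λ^d(W) → S^d(V ⊗ W)` is perfect. -/
lemma detBil_isPerfect : (detBil k d).IsPerfect where
  universal := detBil_universal
  couniversal U := couniversal_of_omega _ U fun _ hz => detBil_couniversal hz

end

/-! ### Tensor products of quotients -/

section

variable {k : Type u} [CommRing k] {J : Type} [Finite J] {A B : J → Type u}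
  [∀ j, AddCommGroup (A j)] [∀ j, Module k (A j)] [∀ j, AddCommGroup (B j)] [∀ j, Module k (B j)]
  {N : Type u} [AddCommGroup N] [Module k N]

lemma apply_tprod_congr (q : ∀ j, A j →ₗ[k] B j) (h : (⨂[k] j, A j) →ₗ[k] N)
    (hh : ∀ a : ∀ j, A j, (∃ j, q j (a j) = 0) → h (PiTensorProduct.tprod k a) = 0)
    {a a' : ∀ j, A j} (haa : ∀ j, q j (a j) = q j (a' j)) :
    h (PiTensorProduct.tprod k a) = h (PiTensorProduct.tprod k a') := by
  classical
  have := Fintype.ofFinite J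
  -- The entries are exchanged one at a time; each difference has an entry in a kernel.
  suffices key : ∀ S : Finset J, h (PiTensorProduct.tprod k fun j => if j ∈ S then a' j else a j) =
      h (PiTensorProduct.tprod k a) by
    simpa using (key Finset.univ).symm
  intro S
  induction S using Finset.induction_on with
  | empty => simp
  | insert i S hi ih =>
    rw [← ih]
    set b : ∀ j, A j := fun j => if j ∈ S then a' j else a j
    have h₁ : (fun j => if j ∈ insert i S then a' j else a j) = Function.update b i (a' i) := by
      funext j
      by_cases hj : j = i
      · subst hj; simp
      · simp [b, hj]
    have h₂ : b = Function.update b i (a i) := by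
      rw [eq_comm, Function.update_eq_self_iff]
      simp [b, hi]
    rw [h₁]
    conv_rhs => rw [h₂]
    rw [← sub_eq_zero, ← map_sub, ← MultilinearMap.map_update_sub]
    refine hh _ ⟨i, ?_⟩
    rw [Function.update_self, map_sub, haa, sub_self]

/-- Right exactness of the tensor product: the kernel of a tensor product of surjections is
generated by pure tensors with one entry in a kernel. -/
lemma apply_eq_zero_of_map_eq_zero (q : ∀ j, A j →ₗ[k] B j) (hq : ∀ j, Function.Surjective (q j))
    (h : (⨂[k] j, A j) →ₗ[k] N)
    (hh : ∀ a : ∀ j, A j, (∃ j, q j (a j) = 0) → h (PiTensorProduct.tprod k a) = 0)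
    {x : ⨂[k] j, A j} (hx : PiTensorProduct.map q x = 0) : h x = 0 := by
  classical
  choose s hs using hq
  -- The sections are only set-theoretic; g is multilinear because h does not depend on the choice
  -- of preimages.
  let g : MultilinearMap k B N :=
    { toFun := fun b => h (PiTensorProduct.tprod k fun j => s j (b j))
      map_update_add' := fun {inst} b i x y => by
        obtain rfl := Subsingleton.elim inst (Classical.decEq J)
        have e : ∀ z : A i, ∀ z', q i z = z' →
            h (PiTensorProduct.tprod k fun j => s j (Function.update b i z' j)) =
            h (PiTensorProduct.tprod k (Function.update (fun j => s j (b j)) i z)) := by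
          rintro z _ rfl
          refine apply_tprod_congr q h hh fun j => ?_
          rw [hs]
          by_cases hj : j = i
          · subst hj; simp
          · simp [hj, hs]
        rw [e (s i x + s i y) _ (by rw [map_add, hs, hs]), e (s i x) _ (hs i x),
          e (s i y) _ (hs i y), MultilinearMap.map_update_add, map_add]
      map_update_smul' := fun {inst} b i c x => by
        obtain rfl := Subsingleton.elim inst (Classical.decEq J)
        have e : ∀ z : A i, ∀ z', q i z = z' →
            h (PiTensorProduct.tprod k fun j => s j (Function.update b i z' j)) =
            h (PiTensorProduct.tprod k (Function.update (fun j => s j (b j)) i z)) := by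
          rintro z _ rfl
          refine apply_tprod_congr q h hh fun j => ?_
          rw [hs]
          by_cases hj : j = i
          · subst hj; simp
          · simp [hj, hs]
        rw [e (c • s i x) _ (by rw [map_smul, hs]), e (s i x) _ (hs i x),
          MultilinearMap.map_update_smul, map_smul] }
  have hg : PiTensorProduct.lift g ∘ₗ PiTensorProduct.map q = h := by
    refine PiTensorProduct.ext (MultilinearMap.ext fun a => ?_)
    simp only [LinearMap.compMultilinearMap_apply, LinearMap.comp_apply,
      PiTensorProduct.map_tprod, PiTensorProduct.lift.tprod]
    exact apply_tprod_congr q h hh fun j => hs j _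
  rw [← hg, LinearMap.comp_apply, hx, map_zero]

lemma map_tprod_surjective (q : ∀ j, A j →ₗ[k] B j) (hq : ∀ j, Function.Surjective (q j)) :
    Function.Surjective (PiTensorProduct.map q) := fun y => by
  choose s hs using hq
  induction y using tind with
  | tp b => exact ⟨PiTensorProduct.tprod k fun j => s j (b j), by simp [hs]⟩
  | smul c y h =>
    obtain ⟨x, hx⟩ := h
    exact ⟨c • x, by rw [map_smul, hx]⟩
  | add y z h h' =>
    obtain ⟨x, hx⟩ := h
    obtain ⟨x', hx'⟩ := h'
    exact ⟨x + x', by rw [map_add, hx, hx']⟩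

end

/-- The factorisation of a linear map through a surjective linear map. -/
def factor {k : Type u} [CommRing k] {A B N : Type u} [AddCommGroup A] [Module k A]
    [AddCommGroup B] [Module k B] [AddCommGroup N] [Module k N] (q : A →ₗ[k] B)
    (hq : Function.Surjective q) (g : A →ₗ[k] N) (h : ∀ x, q x = 0 → g x = 0) : B →ₗ[k] N :=
  (LinearMap.ker q).liftQ g (fun x hx => h x hx) ∘ₗ (q.quotKerEquivOfSurjective hq).symm

lemma factor_apply {k : Type u} [CommRing k] {A B N : Type u} [AddCommGroup A] [Module k A]
    [AddCommGroup B] [Module k B] [AddCommGroup N] [Module k N] (q : A →ₗ[k] B)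
    (hq : Function.Surjective q) (g : A →ₗ[k] N) (h : ∀ x, q x = 0 → g x = 0) (x : A) :
    factor q hq g h (q x) = g x := by
  have e : (q.quotKerEquivOfSurjective hq).symm (q x) = Submodule.Quotient.mk x := by
    rw [LinearEquiv.symm_apply_eq]
    rfl
  simp only [factor, LinearMap.comp_apply, LinearEquiv.coe_coe, e]
  rfl

/-! ### Grouping the factors of a tensor -/

section

variable {k : Type u} [CommRing k] {ι J : Type} {κ : J → Type} [Fintype ι] [Fintype J]
  [∀ j, Fintype (κ j)] {M : Type u} [AddCommGroup M] [Module k M]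

lemma blocks_bijective_of_basis {I : Type} [Finite I] (b : Module.Basis I k M)
    (e : (Σ j, κ j) ≃ ι) : Function.Bijective (blocks (k := k) M e) := by
  classical
  have := Fintype.ofFinite I
  let E : (ι → I) ≃ (∀ j, κ j → I) :=
    (Equiv.arrowCongr e.symm (Equiv.refl I)).trans (Equiv.piCurry fun (j : J) (_ : κ j) => I)
  have h : blocks M e = ((tbasis b ι).equiv
      (Basis.piTensorProduct fun j => tbasis b (κ j)) E).toLinearMap := by
    refine (tbasis b ι).ext fun z => ?_
    rw [LinearEquiv.coe_coe, Module.Basis.equiv_apply, Basis.piTensorProduct_apply, tbasis_apply,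
      blocks_tprod]
    refine congrArg _ (funext fun j => ?_)
    rw [tbasis_apply]
    rfl
  rw [h]
  exact LinearEquiv.bijective _

variable [Module.Finite k M] [Module.Projective k M]

/-- For free modules a basis goes to a basis; a projective module is a retract of a free one,
compatibly with grouping. -/
lemma blocks_bijective (e : (Σ j, κ j) ≃ ι) : Function.Bijective (blocks (k := k) M e) := by
  obtain ⟨n, p, s, -, -, h⟩ := Module.Finite.exists_comp_eq_id_of_projective k M
  have hb := blocks_bijective_of_basis (Pi.basisFun k (Fin n)) e
  constructor
  · intro x y hxy
    rw [← tmap_id x, ← tmap_id y, ← h, ← tmap_tmap, ← tmap_tmap]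
    refine congrArg _ (hb.1 ?_)
    rw [blocks_tmap, blocks_tmap, hxy]
  · intro y
    obtain ⟨x, hx⟩ := hb.2 (PiTensorProduct.map (fun j => tmap (κ j) s) y)
    refine ⟨tmap ι p x, ?_⟩
    rw [blocks_tmap, hx, ← LinearMap.comp_apply, ← PiTensorProduct.map_comp]
    have e : (fun j => tmap (κ j) p ∘ₗ tmap (κ j) s) = fun j => LinearMap.id := by
      refine funext fun j => LinearMap.ext fun t => (tmap_tmap p s t).trans ?_
      rw [h]
      exact tmap_id t
    rw [e, PiTensorProduct.map_id, LinearMap.id_apply]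

/-- The isomorphism `⨂ⱼ M^{⊗κⱼ} ≅ M^{⊗ι}` inverse to the grouping of factors. -/
def unblocks (M : Type u) [AddCommGroup M] [Module k M] [Module.Finite k M]
    [Module.Projective k M] (e : (Σ j, κ j) ≃ ι) : (⨂[k] j, TPow k (κ j) M) →ₗ[k] TPow k ι M :=
  (LinearEquiv.ofBijective (blocks (k := k) M e) (blocks_bijective e)).symm.toLinearMap

lemma blocks_unblocks (e : (Σ j, κ j) ≃ ι) (x : ⨂[k] j, TPow k (κ j) M) :
    blocks M e (unblocks M e x) = x :=
  LinearEquiv.apply_symm_apply (LinearEquiv.ofBijective (blocks (k := k) M e) (blocks_bijective e)) x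

lemma unblocks_blocks (e : (Σ j, κ j) ≃ ι) (x : TPow k ι M) :
    unblocks M e (blocks M e x) = x :=
  LinearEquiv.symm_apply_apply (LinearEquiv.ofBijective (blocks (k := k) M e) (blocks_bijective e)) x


/-- The permutation of `ι` given by permutations of the blocks. -/
def blockPerm (e : (Σ j, κ j) ≃ ι) (σ : ∀ j, Equiv.Perm (κ j)) : Equiv.Perm ι :=
  e.permCongr (Equiv.sigmaCongrRight σ)

lemma blocks_permute (e : (Σ j, κ j) ≃ ι) (σ : ∀ j, Equiv.Perm (κ j)) (t : TPow k ι M) :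
    blocks M e (permute k M (blockPerm e σ) t) =
      PiTensorProduct.map (fun j => permute k M (σ j)) (blocks M e t) := by
  induction t using tind with
  | tp x =>
    rw [permute_tprod, blocks_tprod, blocks_tprod, PiTensorProduct.map_tprod]
    refine congrArg _ (funext fun j => ?_)
    rw [permute_tprod]
    refine congrArg _ (funext fun a => ?_)
    exact congrArg x (congrArg e (congrArg (Equiv.sigmaCongrRight σ).symm (e.symm_apply_apply _)))
  | smul c x h => simp only [map_smul, h]
  | add x y h h' => simp only [map_add, h, h']

lemma exists_blockPerm (e : (Σ j, κ j) ≃ ι) (τ : Equiv.Perm ι)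
    (h : ∀ x, (e.symm (τ x)).1 = (e.symm x).1) : ∃ σ, τ = blockPerm e σ := by
  have h' : ∀ j (a : κ j), ∃ a', τ (e ⟨j, a⟩) = e ⟨j, a'⟩ := fun j a => by
    have := h (e ⟨j, a⟩)
    rw [Equiv.symm_apply_apply] at this
    obtain ⟨⟨j', a'⟩, ha⟩ := e.surjective (τ (e ⟨j, a⟩))
    rw [← ha, Equiv.symm_apply_apply] at this
    change j' = j at this
    subst this
    exact ⟨a', ha.symm⟩
  choose g hg using h'
  have hinj : ∀ j, Function.Injective (g j) := fun j a b hab => by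
    have : τ (e ⟨j, a⟩) = τ (e ⟨j, b⟩) := by rw [hg, hg, hab]
    simpa using this
  refine ⟨fun j => Equiv.ofBijective (g j) (Finite.injective_iff_bijective.mp (hinj j)), ?_⟩
  ext x
  obtain ⟨⟨j, a⟩, rfl⟩ := e.surjective x
  rw [hg]
  simp [blockPerm]

lemma blockPerm_update_swap [DecidableEq J] [DecidableEq ι] [∀ j, DecidableEq (κ j)]
    (e : (Σ j, κ j) ≃ ι) (j : J) (a b : κ j) :
    blockPerm e (Function.update 1 j (Equiv.swap a b)) = Equiv.swap (e ⟨j, a⟩) (e ⟨j, b⟩) := by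
  ext x
  obtain ⟨⟨j', c⟩, rfl⟩ := e.surjective x
  rw [← e.injective.map_swap]
  simp only [blockPerm, Equiv.permCongr_apply, Equiv.symm_apply_apply, Equiv.sigmaCongrRight_apply]
  refine congrArg e ?_
  by_cases h : j' = j
  · subst h
    simp only [Function.update_self]
    simp only [Equiv.swap_apply_def, Sigma.mk.injEq, heq_eq_eq, true_and]
    split_ifs <;> rfl
  · simp only [Function.update_of_ne h]
    rw [Equiv.swap_apply_of_ne_of_ne]
    · rfl
    · exact fun h' => h (congrArg Sigma.fst h')
    · exact fun h' => h (congrArg Sigma.fst h')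

/-- The insertion of a tensor as one of the factors of a tensor. -/
def insertBlock [DecidableEq J] (e : (Σ j, κ j) ≃ ι) (x : ∀ j, TPow k (κ j) M) (j : J) :
    TPow k (κ j) M →ₗ[k] TPow k ι M :=
  unblocks M e ∘ₗ (PiTensorProduct.tprod k).toLinearMap x j

lemma insertBlock_apply [DecidableEq J] (e : (Σ j, κ j) ≃ ι) (x : ∀ j, TPow k (κ j) M) (j : J)
    (t : TPow k (κ j) M) : insertBlock e x j t =
      unblocks M e (PiTensorProduct.tprod k (Function.update x j t)) := rfl

/-- Relations between two factors of one block become relations between two factors of the whole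
tensor. -/
lemma insertBlock_permute_swap [DecidableEq J] [DecidableEq ι] [∀ j, DecidableEq (κ j)]
    (e : (Σ j, κ j) ≃ ι) (x : ∀ j, TPow k (κ j) M) (j : J) (a b : κ j) (t : TPow k (κ j) M) :
    insertBlock e x j (permute k M (Equiv.swap a b) t) =
      permute k M (Equiv.swap (e ⟨j, a⟩) (e ⟨j, b⟩)) (insertBlock e x j t) := by
  refine (blocks_bijective e).1 ?_
  rw [insertBlock_apply, insertBlock_apply, ← blockPerm_update_swap, blocks_permute,
    blocks_unblocks, blocks_unblocks, PiTensorProduct.map_tprod]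
  refine congrArg _ (funext fun j' => ?_)
  by_cases h : j' = j
  · subst h; simp
  · simp only [Function.update_of_ne h]
    exact (permute_one _).symm

end

/-! ### Colourings of tensors -/

section

variable {k : Type u} [CommRing k] {ι : Type} {n : ℕ} {M N : Type u} [AddCommGroup M] [Module k M]
  [AddCommGroup N] [Module k N]

/-- The map `M^{⊗ι} → (kⁿ ⊗ M)^{⊗ι}` tensoring the factor `i` with the basis vector `e_{c i}`. -/
def colIn (c : ι → Fin n) : TPow k ι M →ₗ[k] TPow k ι ((Fin n → k) ⊗[k] M) :=
  PiTensorProduct.map fun i => TensorProduct.mk k (Fin n → k) M (Pi.single (c i) 1)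

/-- The coordinate maps `kⁿ ⊗ M → M`. -/
def coordLin (M : Type u) [AddCommGroup M] [Module k M] (j : Fin n) : (Fin n → k) ⊗[k] M →ₗ[k] M :=
  (TensorProduct.lid k M).toLinearMap ∘ₗ LinearMap.rTensor M (LinearMap.proj j)

lemma coordLin_tmul (j : Fin n) (v : Fin n → k) (m : M) : coordLin M j (v ⊗ₜ m) = v j • m := by
  simp [coordLin]

lemma sum_single_coordLin (w : (Fin n → k) ⊗[k] M) :
    ∑ j, (Pi.single j 1 : Fin n → k) ⊗ₜ[k] coordLin M j w = w := by
  induction w with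
  | zero => simp
  | tmul v m =>
    simp only [coordLin_tmul, ← TensorProduct.smul_tmul, ← TensorProduct.sum_tmul]
    congr 1
    ext i
    simp [Pi.single_apply]
  | add x y h h' =>
    simp only [map_add, TensorProduct.tmul_add, Finset.sum_add_distrib, h, h']

/-- The map `(kⁿ ⊗ M)^{⊗ι} → M^{⊗ι}` taking the coordinate `c i` of the factor `i`. -/
def colOut (c : ι → Fin n) : TPow k ι ((Fin n → k) ⊗[k] M) →ₗ[k] TPow k ι M :=
  PiTensorProduct.map fun i => coordLin M (c i)

lemma colOut_colIn_self (c : ι → Fin n) (t : TPow k ι M) : colOut c (colIn c t) = t := by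
  induction t using tind with
  | tp x => simp [colOut, colIn, coordLin_tmul]
  | smul r x h => simp only [map_smul, h]
  | add x y h h' => simp only [map_add, h, h']

lemma colOut_colIn_of_ne {c c' : ι → Fin n} (hc : c ≠ c') (t : TPow k ι M) :
    colOut c (colIn c' t) = 0 := by
  obtain ⟨i, hi⟩ := Function.ne_iff.mp hc
  induction t using tind with
  | tp x =>
    simp only [colOut, colIn, PiTensorProduct.map_tprod]
    refine MultilinearMap.map_coord_zero _ i ?_
    rw [TensorProduct.mk_apply, coordLin_tmul, Pi.single_eq_of_ne hi, zero_smul]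
  | smul r x h => simp only [map_smul, h, smul_zero]
  | add x y h h' => simp only [map_add, h, h', add_zero]

/-- With the two preceding lemmas, this decomposes (kⁿ ⊗ M)^{⊗ι} into copies of M^{⊗ι} indexed by
the colourings. -/
lemma sum_colIn_colOut [Fintype ι] [DecidableEq ι] (w : TPow k ι ((Fin n → k) ⊗[k] M)) :
    ∑ c : ι → Fin n, colIn c (colOut c w) = w := by
  induction w using tind with
  | tp x =>
    simp only [colOut, colIn, PiTensorProduct.map_tprod, TensorProduct.mk_apply]
    conv_rhs => rw [← funext fun i => sum_single_coordLin (x i)]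
    exact (MultilinearMap.map_sum _ fun i j => (Pi.single j 1 : Fin n → k) ⊗ₜ[k] coordLin M j (x i)).symm
  | smul r x h => simp only [map_smul, ← Finset.smul_sum, h]
  | add x y h h' => simp only [map_add, Finset.sum_add_distrib, h, h']

lemma colIn_permute (c : ι → Fin n) (σ : Equiv.Perm ι) (t : TPow k ι M) :
    colIn c (permute k M σ t) = permute k _ σ (colIn (c ∘ σ) t) := by
  induction t using tind with
  | tp x => simp [colIn]
  | smul r x h => simp only [map_smul, h]
  | add x y h h' => simp only [map_add, h, h']

lemma colOut_permute (c : ι → Fin n) (σ : Equiv.Perm ι) (w : TPow k ι ((Fin n → k) ⊗[k] M)) :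
    colOut c (permute k _ σ w) = permute k M σ (colOut (c ∘ σ) w) := by
  induction w using tind with
  | tp x => simp [colOut]
  | smul r x h => simp only [map_smul, h]
  | add x y h h' => simp only [map_add, h, h']

lemma colIn_act (c : ι → Fin n) (f : TPow k ι (M →ₗ[k] N)) (t : TPow k ι M) :
    colIn c (act k ι M N f t) = act k ι ((Fin n → k) ⊗[k] M) ((Fin n → k) ⊗[k] N)
      (tmap ι (LinearMap.lTensorHom (Fin n → k)) f) (colIn c t) := by
  induction f using tind with
  | tp f =>
    induction t using tind with
    | tp x => simp [colIn]
    | smul r x h => simp only [map_smul, h]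
    | add x y h h' => simp only [map_add, h, h']
  | smul r x h => simp only [map_smul, LinearMap.smul_apply, h]
  | add x y h h' => simp only [map_add, LinearMap.add_apply, h, h']

lemma colOut_act (c : ι → Fin n) (f : TPow k ι (M →ₗ[k] N))
    (t : TPow k ι ((Fin n → k) ⊗[k] M)) :
    colOut c (act k ι ((Fin n → k) ⊗[k] M) ((Fin n → k) ⊗[k] N)
      (tmap ι (LinearMap.lTensorHom (Fin n → k)) f) t) =
      act k ι M N f (colOut c t) := by
  induction f using tind with
  | tp f =>
    induction t using tind with
    | tp x =>
      simp only [tmap_tprod, act_tprod, colOut, PiTensorProduct.map_tprod]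
      refine congrArg _ (funext fun i => ?_)
      generalize x i = w
      induction w with
      | zero => simp
      | tmul v m => simp [coordLin_tmul]
      | add x y h h' => simp only [map_add, h, h']
    | smul r x h => simp only [map_smul, h]
    | add x y h h' => simp only [map_add, h, h']
  | smul r x h => simp only [map_smul, LinearMap.smul_apply, h]
  | add x y h h' => simp only [map_add, LinearMap.add_apply, h, h']

end

section

variable {k : Type u} [CommRing k] {d n : ℕ} {V W : DivPow k d}

lemma colIn_actHom (c : Fin d → Fin n) (f : V ⟶ W) (t : TPow k (Fin d) V.as) :
    colIn c (actHom f t) = actHom (tensorMap (𝟙 (freeObj k d n)) f) (colIn c t) := by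
  refine (colIn_act c (ten f) t).trans ?_
  exact congrArg (fun g => act k (Fin d) ((Fin n → k) ⊗[k] V.as) ((Fin n → k) ⊗[k] W.as) g
    (colIn c t)) (ten_tensorMap_id_left (V := freeObj k d n) f).symm

lemma colOut_actHom (c : Fin d → Fin n) (f : V ⟶ W)
    (t : TPow k (Fin d) ((Fin n → k) ⊗[k] V.as)) :
    colOut c (actHom (tensorMap (𝟙 (freeObj k d n)) f) t) = actHom f (colOut c t) := by
  refine Eq.trans ?_ (colOut_act c (ten f) t)
  exact congrArg (fun g => colOut c (act k (Fin d) ((Fin n → k) ⊗[k] V.as)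
    ((Fin n → k) ⊗[k] W.as) g t)) (ten_tensorMap_id_left (V := freeObj k d n) f)

end

/-! ### Types of colourings -/

section

variable {n d : ℕ}

/-- The decomposition of `d` elements into blocks of sizes `λ₁, …, λₙ`. -/
abbrev SeqSum.blockEquiv (l : SeqSum n d) : (Σ i, Fin (l.1 i)) ≃ Fin d :=
  finSigmaFinEquiv.trans (finCongr l.2)

/-- The colouring of `d` elements according to the block they lie in. -/
def SeqSum.colour (l : SeqSum n d) (x : Fin d) : Fin n := (l.blockEquiv.symm x).1

lemma SeqSum.colour_blockEquiv (l : SeqSum n d) (p : Σ i, Fin (l.1 i)) :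
    l.colour (l.blockEquiv p) = p.1 := by
  rw [SeqSum.colour, Equiv.symm_apply_apply]

lemma SeqSum.card_colour (l : SeqSum n d) (i : Fin n) :
    Fintype.card {x // l.colour x = i} = l.1 i := by
  rw [← Fintype.card_fin (l.1 i)]
  refine (Fintype.card_congr (Equiv.ofBijective
    (fun a => ⟨l.blockEquiv ⟨i, a⟩, l.colour_blockEquiv _⟩) ⟨fun a b hab => ?_, ?_⟩)).symm
  · simpa using congrArg (fun y => l.blockEquiv.symm y.1) hab
  · rintro ⟨x, hx⟩
    obtain ⟨⟨j, a⟩, rfl⟩ := l.blockEquiv.surjective x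
    rw [l.colour_blockEquiv] at hx
    change j = i at hx
    subst hx
    exact ⟨a, rfl⟩

lemma SeqSum.eq_of_colour_comp {l l' : SeqSum n d} {σ : Equiv.Perm (Fin d)}
    (h : l.colour ∘ σ = l'.colour) : l = l' := by
  refine Subtype.ext (funext fun i => ?_)
  rw [← l.card_colour, ← l'.card_colour, ← h]
  exact (Fintype.card_congr (σ.subtypeEquiv fun x => Iff.rfl)).symm

/-- The sequence λ records the fibre sizes, and matching fibres with blocks gives σ. With
`SeqSum.eq_of_colour_comp`, the orbits of colourings under permutation are indexed by Λ(n, d). -/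
lemma exists_colour_eq (a : Fin d → Fin n) :
    ∃ (l : SeqSum n d) (σ : Equiv.Perm (Fin d)), a ∘ σ = l.colour := by
  let l : SeqSum n d := ⟨fun i => Fintype.card {x // a x = i}, by
    rw [← Fintype.card_sigma, Fintype.card_congr (Equiv.sigmaFiberEquiv a), Fintype.card_fin]⟩
  refine ⟨l, l.blockEquiv.symm.trans ((Equiv.sigmaCongrRight fun i =>
    (Fintype.equivFin {x // a x = i}).symm).trans (Equiv.sigmaFiberEquiv a)), funext fun x => ?_⟩
  obtain ⟨⟨i, y⟩, rfl⟩ := l.blockEquiv.surjective x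
  rw [l.colour_blockEquiv]
  rw [Function.comp_apply, Equiv.trans_apply, Equiv.symm_apply_apply]
  exact ((Fintype.equivFin {x // a x = i}).symm y).2

/-- The type of a colouring: the sizes of its fibres. -/
def colType (a : Fin d → Fin n) : SeqSum n d := (exists_colour_eq a).choose

/-- A permutation turning a colouring into the standard one of the same type. -/
def colPerm (a : Fin d → Fin n) : Equiv.Perm (Fin d) := (exists_colour_eq a).choose_spec.choose

lemma comp_colPerm (a : Fin d → Fin n) : a ∘ colPerm a = (colType a).colour :=
  (exists_colour_eq a).choose_spec.choose_spec

lemma comp_colPerm_inv (a : Fin d → Fin n) : (colType a).colour ∘ ⇑(colPerm a)⁻¹ = a := by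
  rw [← comp_colPerm]
  ext x
  simp

lemma colType_comp (a : Fin d → Fin n) (σ : Equiv.Perm (Fin d)) :
    colType (a ∘ σ) = colType a := by
  refine SeqSum.eq_of_colour_comp (σ := (colPerm (a ∘ σ))⁻¹ * σ⁻¹ * colPerm a) ?_
  rw [← comp_colPerm, ← comp_colPerm]
  ext x
  simp

lemma colType_colour (l : SeqSum n d) : colType l.colour = l :=
  (SeqSum.eq_of_colour_comp (comp_colPerm l.colour)).symm

instance : Finite (SeqSum n d) :=
  Finite.of_surjective (fun a : Fin d → Fin n => colType a) fun l => ⟨l.colour, colType_colour l⟩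

instance : Fintype (SeqSum n d) := Fintype.ofFinite _

instance : DecidableEq (SeqSum n d) := Classical.decEq _

end

/-! ### Colourings in `Γ^d P_k` -/

section

variable {k : Type u} [CommRing k] {d n : ℕ} {V W : DivPow k d}

/-- The map `V^{⊗d} → (kⁿ ⊗ V)^{⊗d}` tensoring the factor `i` with the basis vector `e_{c i}`. -/
def colourIn (V : DivPow k d) (c : Fin d → Fin n) :
    TPow k (Fin d) V.as →ₗ[k] TPow k (Fin d) (tensorObj (freeObj k d n) V).as := colIn c

/-- The map `(kⁿ ⊗ V)^{⊗d} → V^{⊗d}` taking the coordinate `c i` of the factor `i`. -/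
def colourOut (V : DivPow k d) (c : Fin d → Fin n) :
    TPow k (Fin d) (tensorObj (freeObj k d n) V).as →ₗ[k] TPow k (Fin d) V.as := colOut c

lemma colourOut_colourIn_self (c : Fin d → Fin n) (t : TPow k (Fin d) V.as) :
    colourOut V c (colourIn V c t) = t := colOut_colIn_self c t

lemma colourOut_colourIn_of_ne {c c' : Fin d → Fin n} (h : c ≠ c') (t : TPow k (Fin d) V.as) :
    colourOut V c (colourIn V c' t) = 0 := colOut_colIn_of_ne h t

lemma sum_colourIn_colourOut (w : TPow k (Fin d) (tensorObj (freeObj k d n) V).as) :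
    ∑ c, colourIn V c (colourOut V c w) = w := sum_colIn_colOut w

lemma colourIn_permute (c : Fin d → Fin n) (σ : Equiv.Perm (Fin d)) (t : TPow k (Fin d) V.as) :
    colourIn V c (permute k _ σ t) = permute k _ σ (colourIn V (c ∘ σ) t) := colIn_permute c σ t

lemma colourOut_permute (c : Fin d → Fin n) (σ : Equiv.Perm (Fin d))
    (w : TPow k (Fin d) (tensorObj (freeObj k d n) V).as) :
    colourOut V c (permute k _ σ w) = permute k _ σ (colourOut V (c ∘ σ) w) := colOut_permute c σ w

lemma colourIn_actHom (c : Fin d → Fin n) (f : V ⟶ W) (t : TPow k (Fin d) V.as) :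
    colourIn W c (actHom f t) = actHom (tensorMap (𝟙 _) f) (colourIn V c t) := colIn_actHom c f t

lemma colourOut_actHom (c : Fin d → Fin n) (f : V ⟶ W)
    (w : TPow k (Fin d) (tensorObj (freeObj k d n) V).as) :
    colourOut W c (actHom (tensorMap (𝟙 _) f) w) = actHom f (colourOut V c w) := colOut_actHom c f w

end

/-! ### External tensor products of quotients of tensor powers -/

section

variable {k : Type u} [CommRing k] {d n : ℕ} {V W : DivPow k d} {Z : ∀ m, RepGam k m}
  {χ : ∀ m, Equiv.Perm (Fin m) →* k}

variable (Z) in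
/-- The external tensor product of the representations `Z λᵢ`. -/
def blockRep (l : SeqSum n d) : RepGam k d := extTensor l.1 l.2 fun i => Z (l.1 i)

/-- The projection from the tensor power to an external tensor product of quotients of tensor
powers. -/
def blockProj (q : ∀ m, SignedQuotient (Z m) (χ m)) (l : SeqSum n d) (V : DivPow k d) :
    TPow k (Fin d) V.as →ₗ[k] (blockRep Z l).obj.obj V :=
  PiTensorProduct.map (fun i => (q (l.1 i)).proj ⟨V.as⟩) ∘ₗ blocks V.as l.blockEquiv

variable (q : ∀ m, SignedQuotient (Z m) (χ m)) (l : SeqSum n d)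

lemma blockProj_tprod (x : Fin d → V.as) : blockProj q l V (PiTensorProduct.tprod k x) =
    PiTensorProduct.tprod k fun i => (q (l.1 i)).proj ⟨V.as⟩
      (PiTensorProduct.tprod k fun a => x (l.blockEquiv ⟨i, a⟩)) := by
  refine (congrArg (PiTensorProduct.map _) (blocks_tprod _ _)).trans ?_
  exact PiTensorProduct.map_tprod _ _

lemma blockProj_surjective (V : DivPow k d) : Function.Surjective (blockProj q l V) :=
  (map_tprod_surjective _ fun i => (q (l.1 i)).proj_surjective ⟨V.as⟩).comp
    (blocks_bijective l.blockEquiv).2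

lemma mp_blockProj (f : V ⟶ W) (t : TPow k (Fin d) V.as) :
    mp (blockRep Z l) f (blockProj q l V t) =
      blockProj q l W (actHom f t) := by
  change extTensorMap l.blockEquiv (fun i => Z (l.1 i)) V.as W.as f
    (PiTensorProduct.map _ (blocks V.as l.blockEquiv t)) =
      PiTensorProduct.map _ (blocks W.as l.blockEquiv (actHom f t))
  -- A symmetric tensor of linear maps acts on grouped tensors through its image in the product of
  -- the Γ^{λᵢ}, which is how the external tensor product is defined.
  have h : blocks W.as l.blockEquiv (actHom f t) =
      PiTensorProduct.map₂ (fun i => act k (Fin (l.1 i)) V.as W.as)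
        (PiTensorProduct.mapIncl (fun i => Gam k (Fin (l.1 i)) (V.as →ₗ[k] W.as))
          (comul (V.as →ₗ[k] W.as) l.blockEquiv f)) (blocks V.as l.blockEquiv t) := by
    rw [mapIncl_comul]
    exact blocks_tmap₂ _ _ _ _
  rw [h, extTensorMap, LinearMap.comp_apply, LinearMap.comp_apply]
  generalize comul (V.as →ₗ[k] W.as) l.blockEquiv f = y
  generalize blocks V.as l.blockEquiv t = z
  induction y using tind with
  | tp y =>
    induction z using tind with
    | tp z =>
      rw [PiTensorProduct.mapIncl, PiTensorProduct.map_tprod, PiTensorProduct.map_tprod,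
        PiTensorProduct.map_tprod, PiTensorProduct.map₂_tprod_tprod, PiTensorProduct.map_tprod,
        PiTensorProduct.piTensorHomMap_tprod_eq_map, PiTensorProduct.map_tprod]
      exact congrArg _ (funext fun i => (q (l.1 i)).mp_proj ⟨V.as⟩ ⟨W.as⟩ (y i) (z i))
    | smul c x h => simp only [map_smul, h]
    | add x y h h' => simp only [map_add, h, h']
  | smul c x h => simp only [map_smul, LinearMap.smul_apply, h]
  | add x y h h' => simp only [map_add, LinearMap.add_apply, h, h']

lemma blockProj_blockPerm (σ : ∀ i, Equiv.Perm (Fin (l.1 i))) (t : TPow k (Fin d) V.as) :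
    blockProj q l V (permute k _ (blockPerm l.blockEquiv σ) t) =
      (∏ i, χ _ (σ i)) • blockProj q l V t := by
  change PiTensorProduct.map _ (blocks V.as l.blockEquiv _) =
    (∏ i, χ _ (σ i)) • PiTensorProduct.map _ (blocks V.as l.blockEquiv t)
  rw [blocks_permute]
  generalize blocks V.as l.blockEquiv t = z
  induction z using tind with
  | tp z =>
    rw [PiTensorProduct.map_tprod, PiTensorProduct.map_tprod, PiTensorProduct.map_tprod,
      ← MultilinearMap.map_smul_univ]
    exact congrArg _ (funext fun i => (q (l.1 i)).proj_permute ⟨V.as⟩ (σ i) (z i))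
  | smul c x h => rw [map_smul, map_smul, map_smul, h, smul_comm]
  | add x y h h' => simp only [map_add, smul_add, h, h']

end

/-- Representations `Z m` that are quotients of the functors `V ↦ V^{⊗m}` by relations that are
generated by relations between two tensor factors. -/
structure SignedFamily {k : Type u} [CommRing k] (Z : ∀ m, RepGam k m)
    (χ : ∀ m, Equiv.Perm (Fin m) →* k) where
  /-- The quotients. -/
  quot : ∀ m, SignedQuotient (Z m) (χ m)
  char_blockPerm : ∀ {n d : ℕ} (l : SeqSum n d) (σ : ∀ i, Equiv.Perm (Fin (l.1 i))),
    χ d (blockPerm l.blockEquiv σ) = ∏ i, χ _ (σ i)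
  /-- The relations between two factors, in terms of their transposition. -/
  rel : ∀ {A : Type u} [AddCommGroup A] [Module k A], (A →ₗ[k] A) → Set A
  map_mem_rel : ∀ {A B : Type u} [AddCommGroup A] [Module k A] [AddCommGroup B] [Module k B]
    (L : A →ₗ[k] B) {s : A →ₗ[k] A} {s' : B →ₗ[k] B}, (∀ x, L (s x) = s' (L x)) →
    ∀ {x}, x ∈ rel s → L x ∈ rel s'
  -- Makes the contributions of two colourings exchanged by a transposition cancel;
  -- `blockProj_eq_zero` treats colourings fixed by it.
  add_eq_zero : ∀ {m : ℕ} (M : Type u) [AddCommGroup M] [Module k M] {i j : Fin m}, i ≠ j →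
    ∀ {t : TPow k (Fin m) M}, t ∈ rel (permute k M (Equiv.swap i j)) →
    t + χ m (Equiv.swap i j) • permute k M (Equiv.swap i j) t = 0
  proj_eq_zero : ∀ {m : ℕ} (V : DivPow k m) {i j : Fin m}, i ≠ j →
    ∀ {t : TPow k (Fin m) V.as}, t ∈ rel (permute k V.as (Equiv.swap i j)) → (quot m).proj V t = 0
  blockProj_eq_zero : ∀ {n d : ℕ} (l : SeqSum n d) (V : DivPow k d) {i j : Fin d}, i ≠ j →
    l.colour i = l.colour j → ∀ {t : TPow k (Fin d) V.as},
    t ∈ rel (permute k V.as (Equiv.swap i j)) → blockProj quot l V t = 0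
  desc : ∀ {m : ℕ} (V : DivPow k m) {N : Type u} [AddCommGroup N] [Module k N]
    (g : TPow k (Fin m) V.as →ₗ[k] N),
    (∀ i j, i ≠ j → ∀ t ∈ rel (permute k V.as (Equiv.swap i j)), g t = 0) →
    ∀ t, (quot m).proj V t = 0 → g t = 0

namespace SignedFamily

variable {k : Type u} [CommRing k] {d n : ℕ} {V W : DivPow k d} {Z : ∀ m, RepGam k m}
  {χ : ∀ m, Equiv.Perm (Fin m) →* k} (S : SignedFamily Z χ) (l : SeqSum n d)

lemma blockProj_permute (τ : Equiv.Perm (Fin d)) (hτ : l.colour ∘ τ = l.colour)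
    (t : TPow k (Fin d) V.as) :
    blockProj S.quot l V (permute k _ τ t) = χ d τ • blockProj S.quot l V t := by
  obtain ⟨σ, rfl⟩ := exists_blockPerm l.blockEquiv τ (congrFun hτ)
  rw [blockProj_blockPerm, S.char_blockPerm]

section

variable (V : DivPow k d) {N : Type u} [AddCommGroup N] [Module k N]
  (g : TPow k (Fin d) V.as →ₗ[k] N)

lemma insertBlock_desc (hg : ∀ i j, i ≠ j → l.colour i = l.colour j →
      ∀ t ∈ S.rel (permute k V.as (Equiv.swap i j)), g t = 0)
    (a : ∀ i, TPow k (Fin (l.1 i)) V.as) (j : Fin n)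
    (hj : (S.quot (l.1 j)).proj ⟨V.as⟩ (a j) = 0) :
    g (unblocks V.as l.blockEquiv (PiTensorProduct.tprod k a)) = 0 := by
  have h := S.desc ⟨V.as⟩ (g ∘ₗ insertBlock l.blockEquiv a j) (fun x y hxy t ht =>
    hg (l.blockEquiv ⟨j, x⟩) (l.blockEquiv ⟨j, y⟩) (fun h => hxy <| by simpa using h)
      (by rw [l.colour_blockEquiv, l.colour_blockEquiv]) _
      (S.map_mem_rel _ (insertBlock_permute_swap l.blockEquiv a j x y) ht)) (a j) hj
  rwa [LinearMap.comp_apply, insertBlock_apply, Function.update_eq_self] at h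

/-- Relations inside blocks suffice: the kernel of a tensor product of quotients is generated factor
by factor, and each factor's kernel is controlled by `desc`. -/
lemma blockProj_desc (hg : ∀ i j, i ≠ j → l.colour i = l.colour j →
      ∀ t ∈ S.rel (permute k V.as (Equiv.swap i j)), g t = 0)
    (t : TPow k (Fin d) V.as) (ht : blockProj S.quot l V t = 0) : g t = 0 := by
  have ht' : PiTensorProduct.map (fun i => (S.quot (l.1 i)).proj ⟨V.as⟩)
    (blocks V.as l.blockEquiv t) = 0 := ht
  have h := apply_eq_zero_of_map_eq_zero (fun i => (S.quot (l.1 i)).proj ⟨V.as⟩)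
    (fun i => (S.quot (l.1 i)).proj_surjective ⟨V.as⟩)
    (LinearMap.comp g (unblocks (k := k) V.as l.blockEquiv))
    (fun a ⟨j, hj⟩ => S.insertBlock_desc l V g hg a j hj) ht'
  rwa [LinearMap.comp_apply, unblocks_blocks] at h

end

/-- The projection from `(kⁿ ⊗ V)^{⊗d}` to `Z(kⁿ ⊗ V)`. -/
def shiftProj (n : ℕ) (V : DivPow k d) : TPow k (Fin d) (tensorObj (freeObj k d n) V).as →ₗ[k]
    (tensorShift (freeObj k d n) (Z d)).obj.obj V :=
  (S.quot d).proj (tensorObj (freeObj k d n) V)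

lemma shiftProj_surjective (V : DivPow k d) : Function.Surjective (S.shiftProj n V) :=
  (S.quot d).proj_surjective _

lemma shiftProj_permute (σ : Equiv.Perm (Fin d))
    (t : TPow k (Fin d) (tensorObj (freeObj k d n) V).as) :
    S.shiftProj n V (permute k _ σ t) = χ d σ • S.shiftProj n V t := (S.quot d).proj_permute _ _ _

lemma shiftProj_desc {N : Type u} [AddCommGroup N] [Module k N]
    (g : TPow k (Fin d) (tensorObj (freeObj k d n) V).as →ₗ[k] N)
    (hg : ∀ i j, i ≠ j → ∀ t ∈ S.rel (permute k _ (Equiv.swap i j)), g t = 0)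
    (t : TPow k (Fin d) (tensorObj (freeObj k d n) V).as) (ht : S.shiftProj n V t = 0) :
    g t = 0 := S.desc _ g hg t ht

lemma mp_shiftProj (f : V ⟶ W) (t : TPow k (Fin d) (tensorObj (freeObj k d n) V).as) :
    mp (tensorShift (freeObj k d n) (Z d)) f (S.shiftProj n V t) =
      S.shiftProj n W (actHom (tensorMap (𝟙 _) f) t) := (S.quot d).mp_proj _ _ _ _

/-- The embedding of an external tensor product into `V ↦ Z(kⁿ ⊗ V)`. -/
def incl : (blockRep Z l) ⟶ tensorShift (freeObj k d n) (Z d) :=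
  repHom (Y := tensorShift (freeObj k d n) (Z d))
    (fun V => factor (blockProj S.quot l V) (blockProj_surjective S.quot l V)
      (S.shiftProj n V ∘ₗ colourIn V l.colour)
      (S.blockProj_desc l V _ fun i j hij hc t ht => by
        -- A transposition inside a block preserves the standard colouring, so `colourIn` commutes
        -- with it and preserves relations.
        have hs : l.colour ∘ Equiv.swap i j = l.colour := by
          funext x
          rw [Function.comp_apply, Equiv.swap_apply_def]
          split_ifs with h h'
          · rw [h, hc]
          · rw [h', hc]
          · rfl
        refine S.proj_eq_zero _ hij (S.map_mem_rel (colourIn V l.colour) (fun x => ?_) ht)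
        rw [colourIn_permute, hs]))
    fun V W f x => by
      obtain ⟨t, rfl⟩ := blockProj_surjective S.quot l V x
      rw [mp_blockProj, factor_apply, factor_apply, LinearMap.comp_apply, colourIn_actHom,
        LinearMap.comp_apply, mp_shiftProj]

lemma incl_blockProj (t : TPow k (Fin d) V.as) :
    ap (S.incl l) V (blockProj S.quot l V t) =
      S.shiftProj n V (colourIn V l.colour t) :=
  factor_apply _ (blockProj_surjective S.quot l V) _ _ t

/-- The contribution of a colouring to the projection onto an external tensor product. -/
def term (a : Fin d → Fin n) (V : DivPow k d) :
    TPow k (Fin d) (tensorObj (freeObj k d n) V).as →ₗ[k]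
      (blockRep Z l).obj.obj V :=
  χ d (colPerm a) • (blockProj S.quot l V ∘ₗ permute k V.as (colPerm a)⁻¹ ∘ₗ colourOut V a)

lemma term_apply (a : Fin d → Fin n) (w : TPow k (Fin d) (tensorObj (freeObj k d n) V).as) :
    S.term l a V w = χ d (colPerm a) •
      blockProj S.quot l V (permute k V.as (colPerm a)⁻¹ (colourOut V a w)) := rfl

lemma char_mul_inv (σ : Equiv.Perm (Fin d)) : χ d σ * χ d σ⁻¹ = 1 := by
  rw [← map_mul, mul_inv_cancel, map_one]

/-- The standardising permutations of a and a ∘ s differ from s by a permutation preserving the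
blocks, which acts on the target through the character. So `term` changes only by a scalar. -/
lemma term_comp {a : Fin d → Fin n} (ha : colType a = l) (s : Equiv.Perm (Fin d))
    (w : TPow k (Fin d) (tensorObj (freeObj k d n) V).as) :
    S.term l a V (permute k _ s w) = χ d s • S.term l (a ∘ s) V w := by
  have e : permute k V.as (colPerm a)⁻¹ (permute k V.as s (colourOut V (a ∘ s) w)) =
      permute k V.as ((colPerm a)⁻¹ * s * colPerm (a ∘ s))
        (permute k V.as (colPerm (a ∘ s))⁻¹ (colourOut V (a ∘ s) w)) := by
    rw [permute_permute, permute_permute, mul_inv_cancel_right]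
  have hτ : l.colour ∘ ⇑((colPerm a)⁻¹ * s * colPerm (a ∘ s)) = l.colour := by
    have h₁ : l.colour = a ∘ colPerm a := by rw [comp_colPerm, ha]
    have h₂ : l.colour = (a ∘ s) ∘ colPerm (a ∘ s) := by rw [comp_colPerm, colType_comp, ha]
    conv_rhs => rw [h₂]
    rw [h₁]
    ext x
    simp
  rw [term_apply, colourOut_permute, e, S.blockProj_permute l _ hτ, term_apply, smul_smul, smul_smul,
    map_mul, map_mul, ← mul_assoc, ← mul_assoc, char_mul_inv, one_mul]

lemma term_eq_zero {a : Fin d → Fin n} (ha : colType a = l) {i j : Fin d} (hij : i ≠ j)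
    (hs : a ∘ Equiv.swap i j = a) {t : TPow k (Fin d) (tensorObj (freeObj k d n) V).as}
    (ht : t ∈ S.rel (permute k _ (Equiv.swap i j))) : S.term l a V t = 0 := by
  rw [term_apply]
  have hc : ∀ x, l.colour ((colPerm a)⁻¹ x) = a x := fun x => by
    subst ha
    exact congrFun (comp_colPerm_inv a) x
  have haij : a i = a j := by simpa using (congrFun hs j)
  refine Eq.trans (congrArg _ (S.blockProj_eq_zero l V (i := (colPerm a)⁻¹ i)
    (j := (colPerm a)⁻¹ j) ?_ ?_ ?_)) (smul_zero _)
  · exact fun h => hij ((colPerm a)⁻¹.injective h)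
  · rw [hc, hc, haij]
  · refine S.map_mem_rel (permute k V.as (colPerm a)⁻¹ ∘ₗ colourOut V a) (fun x => ?_) ht
    rw [LinearMap.comp_apply, LinearMap.comp_apply, colourOut_permute, hs, permute_permute,
      permute_permute]
    congr 2
    rw [Equiv.mul_swap_eq_swap_mul]

/-- The projection onto an external tensor product, on tensors. -/
def projTen (V : DivPow k d) : TPow k (Fin d) (tensorObj (freeObj k d n) V).as →ₗ[k]
      (blockRep Z l).obj.obj V :=
  ∑ a with colType a = l, S.term l a V

lemma projTen_apply (w : TPow k (Fin d) (tensorObj (freeObj k d n) V).as) :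
    S.projTen l V w = ∑ a with colType a = l, S.term l a V w := LinearMap.sum_apply _ _ _

/-- Colourings are paired by the transposition (i j): two distinct partners cancel by `add_eq_zero`,
while a fixed colouring gives i and j the same colour, so that its term vanishes. -/
lemma projTen_eq_zero {i j : Fin d} (hij : i ≠ j)
    {t : TPow k (Fin d) (tensorObj (freeObj k d n) V).as}
    (ht : t ∈ S.rel (permute k _ (Equiv.swap i j))) : S.projTen l V t = 0 := by
  rw [projTen_apply]
  refine Finset.sum_involution (fun a _ => a ∘ Equiv.swap i j) (fun a ha => ?_)
    (fun a ha h0 hs => h0 ?_) (fun a ha => ?_) fun a _ => ?_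
  · have h1 : S.term l (a ∘ Equiv.swap i j) V t =
        χ d (Equiv.swap i j) • S.term l a V (permute k _ (Equiv.swap i j) t) := by
      rw [S.term_comp l (Finset.mem_filter.mp ha).2, smul_smul, ← map_mul, Equiv.swap_mul_self,
        map_one, one_smul]
    rw [h1, ← map_smul, ← map_add, S.add_eq_zero _ hij ht, map_zero]
  · exact S.term_eq_zero l (Finset.mem_filter.mp ha).2 hij hs ht
  · rw [Finset.mem_filter] at ha ⊢
    exact ⟨Finset.mem_univ _, (colType_comp _ _).trans ha.2⟩
  · ext x
    simp

/-- The projection onto an external tensor product. -/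
def out : tensorShift (freeObj k d n) (Z d) ⟶ blockRep Z l :=
  repHom (X := tensorShift (freeObj k d n) (Z d))
    (fun V => factor (S.shiftProj n V) (S.shiftProj_surjective V)
      (S.projTen l V) (S.shiftProj_desc _ fun i j hij t ht => S.projTen_eq_zero l hij ht))
    fun V W f x => by
      obtain ⟨t, rfl⟩ := S.shiftProj_surjective V x
      rw [mp_shiftProj, factor_apply, factor_apply, projTen_apply, projTen_apply, map_sum]
      refine Finset.sum_congr rfl fun a _ => ?_
      rw [term_apply, term_apply, map_smul, mp_blockProj, actHom_permute, colourOut_actHom]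

lemma out_proj (w : TPow k (Fin d) (tensorObj (freeObj k d n) V).as) :
    ap (S.out l) V (S.shiftProj n V w) = S.projTen l V w :=
  factor_apply _ (S.shiftProj_surjective V) _ _ w

/-- The image of `incl` has only the standard colouring, so one term survives. -/
lemma incl_out : S.incl l ≫ S.out l = 𝟙 _ := rep_hom_ext fun V x => by
  obtain ⟨t, rfl⟩ := blockProj_surjective S.quot l V x
  rw [ap_comp, ap_id, incl_blockProj, out_proj, projTen_apply,
    Finset.sum_eq_single l.colour]
  · have hτ : l.colour ∘ ⇑(colPerm l.colour)⁻¹ = l.colour := by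
      have h := comp_colPerm_inv l.colour
      rwa [colType_colour] at h
    rw [term_apply, colourOut_colourIn_self, S.blockProj_permute l _ hτ, smul_smul, char_mul_inv,
      one_smul]
  · intro a _ ha
    rw [term_apply, colourOut_colourIn_of_ne ha, map_zero, map_zero, smul_zero]
  · intro h
    simp [colType_colour] at h

/-- After undoing the standardising permutation, whose character cancels, each colouring contributes
its own component; summing over types and then over colourings of each type recovers the whole
tensor. -/
lemma sum_out_incl :
    ∑ l : SeqSum n d, S.out l ≫ S.incl l = 𝟙 (tensorShift (freeObj k d n) (Z d)) :=
  rep_hom_ext fun V x => by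
    obtain ⟨w, rfl⟩ := S.shiftProj_surjective V x
    rw [ap_sum]
    have h : ∀ l : SeqSum n d, ap (S.out l ≫ S.incl l) V (S.shiftProj n V w) =
        ∑ a with colType a = l, S.shiftProj n V
          (colourIn V a (colourOut V a w)) := fun l => by
      rw [ap_comp, out_proj, projTen_apply, map_sum]
      refine Finset.sum_congr rfl fun a ha => ?_
      obtain rfl := (Finset.mem_filter.mp ha).2
      rw [term_apply, map_smul, incl_blockProj, colourIn_permute, comp_colPerm_inv,
        shiftProj_permute, smul_smul, char_mul_inv, one_smul]
    refine (Finset.sum_congr rfl fun l _ => h l).trans ?_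
    rw [Finset.sum_fiberwise, ← map_sum, sum_colourIn_colourOut]
    rfl

end SignedFamily

/-! ### Symmetric and exterior powers -/

section

variable {k : Type u} [CommRing k]

/-- Polarisation: expand g at the tensor whose entries i and j are both x i + x j. -/
lemma apply_add_apply_swap {ι : Type} [DecidableEq ι] {M N : Type u} [AddCommGroup M] [Module k M]
    [AddCommGroup N] [Module k N] (g : TPow k ι M →ₗ[k] N) {i j : ι} (hij : i ≠ j)
    (hg : ∀ x : ι → M, x i = x j → g (PiTensorProduct.tprod k x) = 0) (x : ι → M) :
    g (PiTensorProduct.tprod k x) + g (PiTensorProduct.tprod k (x ∘ Equiv.swap i j)) = 0 := by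
  have h : ∀ v w : M, Function.update (Function.update x i v) j w i = v := fun v w => by
    rw [Function.update_of_ne hij, Function.update_self]
  have h₀ : ∀ v, g (PiTensorProduct.tprod k (Function.update (Function.update x i v) j v)) = 0 :=
    fun v => hg _ (by rw [h, Function.update_self])
  have h₁ := h₀ (x i + x j)
  rw [MultilinearMap.map_update_add, Function.update_comm hij, Function.update_comm hij,
    MultilinearMap.map_update_add, MultilinearMap.map_update_add, ← Function.update_comm hij,
    ← Function.update_comm hij, ← Function.update_comm hij, ← Function.update_comm hij,
    map_add, map_add, map_add, h₀, h₀, zero_add, add_zero, Function.update_eq_self] at h₁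
  have h₂ : x ∘ Equiv.swap i j = Function.update (Function.update x i (x j)) j (x i) := by
    funext a
    rw [Function.comp_apply, Equiv.swap_apply_def]
    split_ifs with ha hb
    · rw [ha, h]
    · rw [hb, Function.update_self]
    · rw [Function.update_of_ne hb, Function.update_of_ne ha]
  rw [h₂, add_comm]
  simpa using h₁

/-- In a basis of a free module the coefficients are invariant under the transposition: distinct
multi-indices cancel in pairs, and those it fixes have equal entries i and j. No division by 2 is
involved. -/
lemma apply_eq_zero_of_swap_eq {ι : Type} [Fintype ι] [DecidableEq ι] {M N : Type u}
    [AddCommGroup M] [Module k M] [Module.Finite k M] [Module.Projective k M] [AddCommGroup N]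
    [Module k N] (g : TPow k ι M →ₗ[k] N) {i j : ι} (hij : i ≠ j)
    (hg : ∀ x : ι → M, x i = x j → g (PiTensorProduct.tprod k x) = 0) {t : TPow k ι M}
    (ht : permute k M (Equiv.swap i j) t = t) : g t = 0 := by
  obtain ⟨n, p, s, -, -, h⟩ := Module.Finite.exists_comp_eq_id_of_projective k M
  let b := Pi.basisFun k (Fin n)
  rw [← tmap_id t, ← h, ← tmap_tmap, ← LinearMap.comp_apply]
  set u := tmap ι s t with hu
  have hu' : permute k _ (Equiv.swap i j) u = u := by rw [hu, ← tmap_permute, ht]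
  have hg' : ∀ x : ι → Fin n → k, x i = x j →
      (g ∘ₗ tmap ι p) (PiTensorProduct.tprod k x) = 0 := fun x hx => by
    rw [LinearMap.comp_apply, tmap_tprod]
    exact hg _ (congrArg p hx)
  rw [← (tbasis b ι).sum_repr u, map_sum]
  refine Finset.sum_involution (fun x _ => x ∘ Equiv.swap i j) (fun x _ => ?_)
    (fun x _ hx h' => hx ?_) (fun _ _ => Finset.mem_univ _) (fun x _ => by ext; simp)
  · rw [← tbasis_repr_permute, hu', map_smul, map_smul, ← smul_add, tbasis_apply, tbasis_apply]
    refine (congrArg _ ?_).trans (smul_zero _)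
    exact apply_add_apply_swap _ hij hg' fun a => b (x a)
  · have : x i = x j := by simpa using (congrFun h' j)
    rw [map_smul, tbasis_apply, hg' _ (by rw [this]), smul_zero]

lemma blockProj_tprod_eq_zero {d n : ℕ} {V : DivPow k d} {Z : ∀ m, RepGam k m}
    {χ : ∀ m, Equiv.Perm (Fin m) →* k} (q : ∀ m, SignedQuotient (Z m) (χ m)) (l : SeqSum n d)
    (x : Fin d → V.as) (i : Fin n) (h : (q (l.1 i)).proj ⟨V.as⟩
      (PiTensorProduct.tprod k fun a => x (l.blockEquiv ⟨i, a⟩)) = 0) :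
    blockProj q l V (PiTensorProduct.tprod k x) = 0 :=
  (blockProj_tprod q l x).trans (MultilinearMap.map_coord_zero (PiTensorProduct.tprod k) i h)

/-- Symmetric powers are quotients of tensor powers by commutation of factors. -/
def symFamily (k : Type u) [CommRing k] : SignedFamily (fun m => SymRep k m) fun _ => 1 where
  quot _ := symQuotient
  char_blockPerm _ _ := by simp
  rel s := {x | ∃ y, x = s y - y}
  map_mem_rel L _ _ h := by
    rintro _ ⟨y, rfl⟩
    exact ⟨L y, by rw [map_sub, h]⟩
  add_eq_zero M _ _ i j _ t := by
    rintro ⟨y, rfl⟩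
    rw [MonoidHom.one_apply, one_smul, map_sub, permute_permute, Equiv.swap_mul_self, permute_one,
      sub_add_sub_cancel, sub_self]
  proj_eq_zero V i j _ t := by
    rintro ⟨y, rfl⟩
    rw [map_sub, symQuotient.proj_permute, MonoidHom.one_apply, one_smul, sub_self]
  blockProj_eq_zero l V i j _ hc t := by
    rintro ⟨y, rfl⟩
    obtain ⟨σ, hσ⟩ := exists_blockPerm l.blockEquiv (Equiv.swap i j) fun x => by
      change l.colour _ = l.colour _
      rw [Equiv.swap_apply_def]
      split_ifs with h h'
      · rw [h, hc]
      · rw [h', hc]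
      · rfl
    rw [map_sub, hσ, blockProj_blockPerm]
    simp
  desc V N _ _ g hg t ht := by
    -- Transpositions generate the symmetric group, so relations between two factors give all
    -- relations of S^d.
    have hs : ∀ (σ : Equiv.Perm (Fin _)) (y : TPow k _ V.as), g (permute k _ σ y) = g y := by
      intro σ
      induction σ using Equiv.Perm.swap_induction_on with
      | one => exact fun y => by rw [permute_one]
      | swap_mul σ i j hij ih =>
        intro y
        rw [← permute_permute, ← ih y, ← sub_eq_zero, ← map_sub]
        exact hg i j hij _ ⟨_, rfl⟩
    have h : symRel k _ V.as ≤ LinearMap.ker g := by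
      refine Submodule.span_le.mpr ?_
      rintro _ ⟨σ, y, rfl⟩
      rw [SetLike.mem_coe, LinearMap.mem_ker, map_sub, hs, sub_self]
    exact h ((Submodule.Quotient.mk_eq_zero _).mp ht)

lemma signChar_swap {m : ℕ} {i j : Fin m} (hij : i ≠ j) :
    signChar k m (Equiv.swap i j) = -1 := by
  have h := signChar_smul (k := k) (Equiv.swap i j) (1 : k)
  rw [Equiv.Perm.sign_swap hij, smul_eq_mul, mul_one] at h
  simpa using h

lemma blockPerm_mul {ι J : Type} {κ : J → Type} (e : (Σ j, κ j) ≃ ι)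
    (σ τ : ∀ j, Equiv.Perm (κ j)) : blockPerm e (σ * τ) = blockPerm e σ * blockPerm e τ := by
  ext x
  simp [blockPerm]

/-- Both sides are homomorphisms on the product of symmetric groups, and they agree on a
transposition in a single block. -/
lemma signChar_blockPerm {n d : ℕ} (l : SeqSum n d) (σ : ∀ i, Equiv.Perm (Fin (l.1 i))) :
    signChar k d (blockPerm l.blockEquiv σ) = ∏ i, signChar k _ (σ i) := by
  let f : (∀ i, Equiv.Perm (Fin (l.1 i))) →* k :=
    { toFun := fun σ => signChar k d (blockPerm l.blockEquiv σ)
      map_one' := by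
        have h : blockPerm l.blockEquiv (1 : ∀ i, Equiv.Perm (Fin (l.1 i))) = 1 := by
          ext x
          simp [blockPerm]
        rw [h, map_one]
      map_mul' := fun σ τ => by rw [blockPerm_mul, map_mul] }
  let g : (∀ i, Equiv.Perm (Fin (l.1 i))) →* k :=
    { toFun := fun σ => ∏ i, signChar k _ (σ i)
      map_one' := by simp
      map_mul' := fun σ τ => by simp [Finset.prod_mul_distrib] }
  suffices h : f = g from DFunLike.congr_fun h σ
  refine MonoidHom.pi_ext fun j τ => ?_
  induction τ using Equiv.Perm.swap_induction_on with
  | one => rw [Pi.mulSingle_one, map_one, map_one]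
  | swap_mul τ a b hab ih =>
    rw [Pi.mulSingle_mul, map_mul, map_mul, ih]
    congr 1
    change signChar k d (blockPerm l.blockEquiv (Function.update 1 j (Equiv.swap a b))) =
      ∏ i, signChar k _ ((Pi.mulSingle j (Equiv.swap a b) : ∀ i, Equiv.Perm (Fin (l.1 i))) i)
    rw [blockPerm_update_swap, signChar_swap (by simpa using hab), Finset.prod_eq_single j]
    · rw [Pi.mulSingle_eq_same, signChar_swap hab]
    · intro i _ hi
      rw [Pi.mulSingle_eq_of_ne hi, map_one]
    · exact fun h => absurd (Finset.mem_univ _) h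

/-- Exterior powers are quotients of tensor powers by the tensors invariant under a
transposition. -/
def extFamily (k : Type u) [CommRing k] :
    SignedFamily (fun m => ExtRep k m) fun m => signChar k m where
  quot _ := extQuotient
  char_blockPerm := signChar_blockPerm
  rel s := {x | s x = x}
  map_mem_rel L _ _ h x hx := (h x).symm.trans (congrArg L hx)
  add_eq_zero M _ _ i j hij t ht := by
    rw [signChar_swap hij, show permute k M (Equiv.swap i j) t = t from ht, neg_one_smul,
      add_neg_cancel]
  proj_eq_zero V i j hij t ht := toExt_eq_zero hij ht
  blockProj_eq_zero l V i j hij hc t ht := by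
    refine apply_eq_zero_of_swap_eq _ hij (fun x hx => ?_) ht
    obtain ⟨⟨p, a⟩, rfl⟩ := l.blockEquiv.surjective i
    obtain ⟨⟨q, b⟩, rfl⟩ := l.blockEquiv.surjective j
    rw [l.colour_blockEquiv, l.colour_blockEquiv] at hc
    change p = q at hc
    subst hc
    refine blockProj_tprod_eq_zero _ l x p ?_
    refine (toExt_tprod _).trans ?_
    exact AlternatingMap.map_eq_zero_of_eq _ _ hx fun h => hij (by rw [h])
  desc V N _ _ g hg t ht := by
    -- A pure tensor with two equal entries is fixed by their transposition, so g is alternating on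
    -- pure tensors.
    let f : V.as [⋀^Fin _]→ₗ[k] N :=
      { g.compMultilinearMap (PiTensorProduct.tprod k) with
        map_eq_zero_of_eq' := fun v i j hv hij => by
          refine hg i j hij _ ?_
          refine (permute_tprod _ _).trans (congrArg _ (funext fun a => ?_))
          rw [Equiv.symm_swap, Equiv.swap_apply_def]
          split_ifs with h h'
          · rw [h, hv]
          · rw [h', hv]
          · rfl }
    have h : g = exteriorPower.alternatingMapLinearEquiv f ∘ₗ toExt k V.as _ := by
      refine tpow_hom_ext fun x => ?_
      rw [LinearMap.comp_apply, toExt_tprod, exteriorPower.alternatingMapLinearEquiv_apply_ιMulti]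
      rfl
    rw [h, LinearMap.comp_apply, show toExt k V.as _ t = 0 from ht, map_zero]

end

/-! ### Divided powers -/

section

variable {k : Type u} [CommRing k] {d n : ℕ} (l : SeqSum n d) {M N : Type u} [AddCommGroup M]
  [Module k M] [AddCommGroup N] [Module k N]

lemma mapIncl_gmap₂ {κ : Fin n → Type} (y : ⨂[k] i, Gam k (κ i) (M →ₗ[k] N))
    (x : ⨂[k] i, Gam k (κ i) M) :
    PiTensorProduct.mapIncl (fun i => Gam k (κ i) N) (PiTensorProduct.piTensorHomMap
      (PiTensorProduct.map (fun i => gmap₂ (κ i) LinearMap.id) y) x) =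
    PiTensorProduct.map₂ (fun i => tmap₂ (κ i) LinearMap.id)
      (PiTensorProduct.mapIncl (fun i => Gam k (κ i) (M →ₗ[k] N)) y)
      (PiTensorProduct.mapIncl (fun i => Gam k (κ i) M) x) := by
  induction y using tind with
  | tp y =>
    induction x using tind with
    | tp x =>
      simp only [PiTensorProduct.mapIncl, PiTensorProduct.map_tprod,
        PiTensorProduct.map₂_tprod_tprod, PiTensorProduct.piTensorHomMap_tprod_eq_map]
      rfl
    | smul c x h => simp only [map_smul, h]
    | add x y h h' => simp only [map_add, h, h']
  | smul c y h => simp only [map_smul, LinearMap.smul_apply, h]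
  | add y z h h' => simp only [map_add, LinearMap.add_apply, h, h']

lemma blocks_colOut (w : TPow k (Fin d) ((Fin n → k) ⊗[k] M)) :
    blocks M l.blockEquiv (colOut l.colour w) =
      PiTensorProduct.map (fun i => tmap (Fin (l.1 i)) (coordLin M i))
        (blocks ((Fin n → k) ⊗[k] M) l.blockEquiv w) := by
  induction w using tind with
  | tp x =>
    rw [blocks_tprod, PiTensorProduct.map_tprod, colOut, PiTensorProduct.map_tprod, blocks_tprod]
    refine congrArg _ (funext fun i => ?_)
    rw [tmap_tprod]
    exact congrArg _ (funext fun a => by rw [l.colour_blockEquiv])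
  | smul c x h => simp only [map_smul, h]
  | add x y h h' => simp only [map_add, h, h']

/-- The projection of `Γ^d(kⁿ ⊗ M)` onto an external tensor product of divided powers. -/
def gamOutLin (M : Type u) [AddCommGroup M] [Module k M] [Module.Finite k M]
    [Module.Projective k M] :
    Gam k (Fin d) ((Fin n → k) ⊗[k] M) →ₗ[k] ⨂[k] i, Gam k (Fin (l.1 i)) M :=
  PiTensorProduct.map (fun i => (tmap (Fin (l.1 i)) (coordLin M i)).restrict
    fun _ (ht : _ ∈ Gam k (Fin (l.1 i)) ((Fin n → k) ⊗[k] M)) => tmap_mem ht) ∘ₗ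
      comul ((Fin n → k) ⊗[k] M) l.blockEquiv

lemma mapIncl_gamOutLin [Module.Finite k M] [Module.Projective k M]
    (x : Gam k (Fin d) ((Fin n → k) ⊗[k] M)) :
    PiTensorProduct.mapIncl (fun i => Gam k (Fin (l.1 i)) M) (gamOutLin l M x) =
      blocks M l.blockEquiv (colOut l.colour x.1) := by
  rw [blocks_colOut, ← mapIncl_comul, gamOutLin, LinearMap.comp_apply]
  generalize comul ((Fin n → k) ⊗[k] M) l.blockEquiv x = y
  induction y using tind with
  | tp y =>
    simp only [PiTensorProduct.mapIncl, PiTensorProduct.map_tprod]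
    rfl
  | smul c x h => simp only [map_smul, h]
  | add x y h h' => simp only [map_add, h, h']

end

/-! ### The divided powers Γ^λ as summands of Γ^d(kⁿ ⊗ -) -/

section

variable {k : Type u} [CommRing k] {d n : ℕ} {V W : DivPow k d} (l : SeqSum n d)

/-- The inclusion of an external tensor product of divided powers into the tensor power. -/
def gamIncl (V : DivPow k d) : (GammaL k l).obj.obj V →ₗ[k] TPow k (Fin d) V.as :=
  unblocks V.as l.blockEquiv ∘ₗ PiTensorProduct.mapIncl fun i => Gam k (Fin (l.1 i)) V.as

lemma blocks_gamIncl (x : (GammaL k l).obj.obj V) : blocks V.as l.blockEquiv (gamIncl l V x) =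
    PiTensorProduct.mapIncl (fun i => Gam k (Fin (l.1 i)) V.as) x :=
  blocks_unblocks l.blockEquiv _

/-- Divided powers are submodules of tensor powers, not quotients, so the decomposition is dual to
that of `SignedFamily`: identities are checked after inclusion into the tensor power. -/
lemma gamIncl_injective (V : DivPow k d) : Function.Injective (gamIncl l V) := fun x y h => by
  refine mapIncl_injective (k := k) (κ := fun i => Fin (l.1 i)) (M := V.as) ?_
  exact (blocks_gamIncl l x).symm.trans ((congrArg _ h).trans (blocks_gamIncl l y))

lemma actHom_gamIncl (f : V ⟶ W) (x : (GammaL k l).obj.obj V) :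
    actHom f (gamIncl l V x) = gamIncl l W (mp (GammaL k l) f x) := by
  refine (blocks_bijective l.blockEquiv).1 ?_
  rw [blocks_gamIncl]
  refine (blocks_tmap₂ _ _ _ _).trans ?_
  rw [blocks_gamIncl]
  have h : blocks (V.as →ₗ[k] W.as) l.blockEquiv (ten f) =
      PiTensorProduct.mapIncl (fun i => Gam k (Fin (l.1 i)) (V.as →ₗ[k] W.as))
        (comul (V.as →ₗ[k] W.as) l.blockEquiv f) := (mapIncl_comul _ _).symm
  rw [h]
  exact (mapIncl_gmap₂ (comul (V.as →ₗ[k] W.as) l.blockEquiv f) x).symm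

lemma permute_gamIncl (τ : Equiv.Perm (Fin d)) (hτ : l.colour ∘ τ = l.colour)
    (x : (GammaL k l).obj.obj V) : permute k _ τ (gamIncl l V x) = gamIncl l V x := by
  obtain ⟨σ, rfl⟩ := exists_blockPerm l.blockEquiv τ (congrFun hτ)
  refine (blocks_bijective l.blockEquiv).1 ?_
  rw [blocks_permute, blocks_gamIncl]
  change (⨂[k] i, Gam k (Fin (l.1 i)) V.as) at x
  induction x using tind with
  | tp x =>
    rw [PiTensorProduct.mapIncl, PiTensorProduct.map_tprod, PiTensorProduct.map_tprod]
    exact congrArg _ (funext fun i => (x i).2 (σ i))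
  | smul c x h => simp only [map_smul, h]
  | add x y h h' => simp only [map_add, h, h']

/-- The inclusion of `Γ^d(kⁿ ⊗ V)` into the tensor power. -/
def shiftTen (n : ℕ) (V : DivPow k d) :
    (tensorShift (freeObj k d n) (GammaRep k d)).obj.obj V →ₗ[k]
      TPow k (Fin d) (tensorObj (freeObj k d n) V).as :=
  (Gam k (Fin d) (tensorObj (freeObj k d n) V).as).subtype

lemma shiftTen_injective (V : DivPow k d) :
    Function.Injective (shiftTen (k := k) n V) := Subtype.val_injective

lemma permute_shiftTen (σ : Equiv.Perm (Fin d))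
    (x : (tensorShift (freeObj k d n) (GammaRep k d)).obj.obj V) :
    permute k _ σ (shiftTen n V x) = shiftTen n V x := Subtype.prop (p := (· ∈ Gam k _ _)) x σ

lemma shiftTen_mp (f : V ⟶ W) (x : (tensorShift (freeObj k d n) (GammaRep k d)).obj.obj V) :
    shiftTen n W (mp (tensorShift (freeObj k d n) (GammaRep k d)) f x) =
      actHom (tensorMap (𝟙 _) f) (shiftTen n V x) := rfl

/-- The components of `gamOut`. -/
def gamOutApp (V : DivPow k d) :
    (tensorShift (freeObj k d n) (GammaRep k d)).obj.obj V →ₗ[k] (GammaL k l).obj.obj V :=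
  gamOutLin l V.as

lemma gamIncl_gamOutApp (x : (tensorShift (freeObj k d n) (GammaRep k d)).obj.obj V) :
    gamIncl l V (gamOutApp l V x) = colourOut V l.colour (shiftTen n V x) :=
  (congrArg (unblocks V.as l.blockEquiv) (mapIncl_gamOutLin l x)).trans (unblocks_blocks _ _)

/-- The projection of `V ↦ Γ^d(kⁿ ⊗ V)` onto an external tensor product of divided powers. -/
def gamOut : tensorShift (freeObj k d n) (GammaRep k d) ⟶ GammaL k l :=
  repHom (gamOutApp l) fun V W f x => by
    refine gamIncl_injective l W ?_
    rw [← actHom_gamIncl, gamIncl_gamOutApp, gamIncl_gamOutApp, shiftTen_mp, colourOut_actHom]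

lemma gamIncl_gamOut (x : (tensorShift (freeObj k d n) (GammaRep k d)).obj.obj V) :
    gamIncl l V (ap (gamOut l) V x) = colourOut V l.colour (shiftTen n V x) :=
  gamIncl_gamOutApp l x

/-- The embedding of an external tensor product of divided powers, on tensors. -/
def gamInTen (V : DivPow k d) :
    (GammaL k l).obj.obj V →ₗ[k] TPow k (Fin d) (tensorObj (freeObj k d n) V).as :=
  ∑ a with colType a = l, permute k _ (colPerm a) ∘ₗ colourIn V l.colour ∘ₗ gamIncl l V

lemma gamInTen_apply (x : (GammaL k l).obj.obj V) : gamInTen l V x =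
    ∑ a with colType a = l, permute k _ (colPerm a) (colourIn V l.colour (gamIncl l V x)) :=
  LinearMap.sum_apply _ _ _

/-- A permutation s permutes the colourings of type λ. Its action on the standardising permutations
is right up to a permutation preserving the blocks, which fixes the tensors coming from Γ^λ. -/
lemma gamInTen_mem (x : (GammaL k l).obj.obj V) :
    gamInTen l V x ∈ Gam k (Fin d) (tensorObj (freeObj k d n) V).as := fun s => by
  rw [gamInTen_apply, map_sum]
  refine Finset.sum_equiv (Equiv.arrowCongr s (Equiv.refl _)) (fun a => ?_) fun a ha => ?_
  · rw [Finset.mem_filter, Finset.mem_filter]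
    refine and_congr (by simp) (Eq.congr_left ?_)
    exact (colType_comp a s.symm).symm
  · have ha' := (Finset.mem_filter.mp ha).2
    change _ = permute k _ (colPerm (a ∘ ⇑s⁻¹)) _
    have e : s * colPerm a = colPerm (a ∘ ⇑s⁻¹) * ((colPerm (a ∘ ⇑s⁻¹))⁻¹ * s * colPerm a) := by
      group
    have hτ : l.colour ∘ ⇑((colPerm (a ∘ ⇑s⁻¹))⁻¹ * s * colPerm a) = l.colour := by
      have h₁ : l.colour = a ∘ colPerm a := by rw [comp_colPerm, ha']
      have h₂ : l.colour = (a ∘ ⇑s⁻¹) ∘ colPerm (a ∘ ⇑s⁻¹) := by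
        rw [comp_colPerm, colType_comp, ha']
      conv_rhs => rw [h₁]
      rw [h₂]
      ext x
      simp
    rw [permute_permute, e, ← permute_permute]
    refine congrArg _ ?_
    conv_lhs => rw [← hτ]
    rw [← colourIn_permute, permute_gamIncl l _ hτ]

/-- The embedding of an external tensor product of divided powers into `V ↦ Γ^d(kⁿ ⊗ V)`. -/
def gamIn : GammaL k l ⟶ tensorShift (freeObj k d n) (GammaRep k d) :=
  repHom (Y := tensorShift (freeObj k d n) (GammaRep k d))
    (fun V => (gamInTen l V).codRestrict (Gam k (Fin d) (tensorObj (freeObj k d n) V).as)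
      (gamInTen_mem l))
    fun V W f x => by
      refine shiftTen_injective W ?_
      rw [shiftTen_mp]
      change gamInTen l W _ = actHom _ (gamInTen l V x)
      rw [gamInTen_apply, gamInTen_apply, map_sum]
      refine Finset.sum_congr rfl fun a _ => ?_
      rw [actHom_permute, ← colourIn_actHom, actHom_gamIncl]

lemma shiftTen_gamIn (x : (GammaL k l).obj.obj V) : shiftTen n V (ap (gamIn l) V x) =
    ∑ a with colType a = l, permute k _ (colPerm a) (colourIn V l.colour (gamIncl l V x)) :=
  gamInTen_apply l x

/-- Of all colourings of type λ, reading off the standard one detects only itself. -/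
lemma gamIn_gamOut : gamIn l ≫ gamOut l = 𝟙 (GammaL k l) := rep_hom_ext fun V x => by
  refine gamIncl_injective l V ?_
  rw [ap_comp, ap_id, gamIncl_gamOut, shiftTen_gamIn, map_sum, Finset.sum_eq_single l.colour]
  · have hτ : l.colour ∘ colPerm l.colour = l.colour := by
      rw [comp_colPerm, colType_colour]
    rw [colourOut_permute, hτ, colourOut_colourIn_self, permute_gamIncl l _ hτ]
  · intro a ha ha'
    rw [colourOut_permute, colourOut_colourIn_of_ne, map_zero]
    intro h
    refine ha' ?_
    rw [← comp_colPerm_inv a, (Finset.mem_filter.mp ha).2]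
    conv_lhs => rw [← h]
    ext x
    simp
  · intro h
    simp [colType_colour] at h

/-- For a symmetric tensor, the component at any colouring of type λ is a permutation of the
component at the standard one, so `gamIn` restores all components. -/
lemma sum_gamOut_gamIn : ∑ l : SeqSum n d, gamOut l ≫ gamIn l =
    𝟙 (tensorShift (freeObj k d n) (GammaRep k d)) := rep_hom_ext fun V x => by
  refine shiftTen_injective V ?_
  rw [ap_sum, ap_id, map_sum]
  have h : ∀ l : SeqSum n d, shiftTen n V (ap (gamOut l ≫ gamIn l) V x) =
      ∑ a with colType a = l, colourIn V a (colourOut V a (shiftTen n V x)) := fun l => by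
    rw [ap_comp, shiftTen_gamIn, gamIncl_gamOut]
    refine Finset.sum_congr rfl fun a ha => ?_
    obtain rfl := (Finset.mem_filter.mp ha).2
    rw [← comp_colPerm, ← colourIn_permute, ← colourOut_permute, permute_shiftTen]
  rw [Finset.sum_congr rfl fun l _ => h l, Finset.sum_fiberwise, sum_colourIn_colourOut]

end

/-! ### Additive closures -/

section

variable {C : Type*} [Category* C] [Preadditive C]

/-- The property of being a direct summand of a finite power of `T`, in terms of a decomposition
of the identity. -/
def IsSummand (T : C) : ObjectProperty C := fun Y =>
  ∃ (J : Type) (_ : Fintype J) (i : J → (Y ⟶ T)) (p : J → (T ⟶ Y)), ∑ j, i j ≫ p j = 𝟙 Y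

variable [HasFiniteBiproducts C] [HasBinaryBiproducts C]

/-- The identity of Y factors through the direct sum as s followed by r, and the kernel of r is a
complement. -/
lemma addClosure_of_sum_eq_id [HasKernels C] {I : Type*} (X : I → C) {Y : C} {J : Type} [Fintype J]
    (f : J → I) (i : ∀ j, Y ⟶ X (f j)) (p : ∀ j, X (f j) ⟶ Y) (h : ∑ j, i j ≫ p j = 𝟙 Y) :
    addClosure X Y := by
  let e := (Fintype.equivFin J).symm
  let s : Y ⟶ ⨁ fun a => X (f (e a)) := biproduct.lift fun a => i (e a)
  let r : (⨁ fun a => X (f (e a))) ⟶ Y := biproduct.desc fun a => p (e a)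
  have hs : s ≫ r = 𝟙 Y := by
    rw [biproduct.lift_desc, ← h]
    exact Equiv.sum_comp e fun j => i j ≫ p j
  refine ⟨_, fun a => f (e a), kernel r, ⟨?_⟩⟩
  refine
    { hom := biprod.desc s (kernel.ι r)
      inv := biprod.lift r (kernel.lift r (𝟙 _ - r ≫ s) (by simp [hs]))
      hom_inv_id := ?_
      inv_hom_id := by simp }
  ext
  · simp [hs]
  · simp [reassoc_of% hs]
  · simp
  · simp

/-- Each X l is a retract of T, and T is a retract of the direct sum of the X l, so both generate
the same summands. Orthogonality of the different X l inside T plays no role. -/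
lemma addClosure_eq_isSummand [HasKernels C] {L : Type} [Fintype L] (X : L → C) {T : C}
    (i : ∀ l, X l ⟶ T) (p : ∀ l, T ⟶ X l) (hip : ∀ l, i l ≫ p l = 𝟙 (X l))
    (hpi : ∑ l, p l ≫ i l = 𝟙 T) : addClosure X = IsSummand T := by
  ext Y
  constructor
  · rintro ⟨m, f, Z, ⟨e⟩⟩
    refine ⟨Fin m, inferInstance,
      fun j => biprod.inl ≫ e.hom ≫ biproduct.π (fun j => X (f j)) j ≫ i (f j),
      fun j => p (f j) ≫ biproduct.ι (fun j => X (f j)) j ≫ e.inv ≫ biprod.fst, ?_⟩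
    have h : ∀ j, (biprod.inl ≫ e.hom ≫ biproduct.π (fun j => X (f j)) j ≫ i (f j)) ≫
        p (f j) ≫ biproduct.ι (fun j => X (f j)) j ≫ e.inv ≫ biprod.fst =
        (biprod.inl ≫ e.hom) ≫ (biproduct.π (fun j => X (f j)) j ≫
          biproduct.ι (fun j => X (f j)) j) ≫ e.inv ≫ biprod.fst := fun j => by
      simp only [Category.assoc, reassoc_of% hip]
    simp only [h, ← Preadditive.comp_sum, ← Preadditive.sum_comp, biproduct.total]
    simp
  · rintro ⟨J, _, a, b, h⟩
    refine addClosure_of_sum_eq_id X (J := J × L) (fun x => x.2) (fun x => a x.1 ≫ p x.2)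
      (fun x => i x.2 ≫ b x.1) ?_
    rw [← h, Fintype.sum_prod_type]
    refine Finset.sum_congr rfl fun j _ => ?_
    have h' : ∀ l, (a j ≫ p l) ≫ i l ≫ b j = a j ≫ (p l ≫ i l) ≫ b j := fun l => by
      simp only [Category.assoc]
    simp only [h', ← Preadditive.comp_sum, ← Preadditive.sum_comp, hpi, Category.id_comp]

end

/-! ### Equivalences between categories of summands -/

section

variable {C D : Type*} [Category* C] [Category* D] [Preadditive C] [Preadditive D]
  {F : C ⥤ D} {G : D ⥤ C} {T : C} {S : D}

lemma IsSummand.map [F.Additive] (e : F.obj T ≅ S) {Y : C} (hY : IsSummand T Y) :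
    IsSummand S (F.obj Y) := by
  obtain ⟨J, _, i, p, h⟩ := hY
  refine ⟨J, inferInstance, fun j => F.map (i j) ≫ e.hom, fun j => e.inv ≫ F.map (p j), ?_⟩
  simp only [Category.assoc, Iso.hom_inv_id_assoc, ← F.map_comp]
  rw [← F.map_sum, h, F.map_id]

lemma isIso_app_of_isSummand [F.Additive] {F' : C ⥤ D} [F'.Additive] (α : F ⟶ F')
    [IsIso (α.app T)] {Y : C} (hY : IsSummand T Y) : IsIso (α.app Y) := by
  obtain ⟨J, _, i, p, h⟩ := hY
  -- The inverse is assembled from the inverse at T through the decomposition of the identity of Y.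
  refine ⟨∑ j, F'.map (i j) ≫ inv (α.app T) ≫ F.map (p j), ?_, ?_⟩
  · rw [Preadditive.comp_sum]
    simp only [← NatTrans.naturality_assoc, IsIso.hom_inv_id_assoc, ← F.map_comp]
    rw [← F.map_sum, h, F.map_id]
  · rw [Preadditive.sum_comp]
    simp only [Category.assoc, NatTrans.naturality, IsIso.inv_hom_id_assoc, ← F'.map_comp]
    rw [← F'.map_sum, h, F'.map_id]

/-- Unit and counit are natural transformations of additive functors, so being invertible at T and S
they are invertible on all summands of finite powers. -/
lemma induceEquivalence_isSummand [F.Additive] [G.Additive] (adj : F ⊣ G) (e : F.obj T ≅ S)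
    (e' : G.obj S ≅ T) (h : IsIso (adj.unit.app T)) (h' : IsIso (adj.counit.app S)) :
    InduceEquivalence F G (IsSummand T) (IsSummand S) := by
  have h₁ : ∀ Y : (IsSummand T).FullSubcategory, IsIso (adj.unit.app Y.obj) := fun Y =>
    have : IsIso (adj.unit.app T) := h
    isIso_app_of_isSummand (T := T) adj.unit Y.property
  have h₂ : ∀ Z : (IsSummand S).FullSubcategory, IsIso (adj.counit.app Z.obj) := fun Z =>
    have : IsIso (adj.counit.app S) := h'
    isIso_app_of_isSummand (T := S) adj.counit Z.property
  refine ⟨fun Y => Y.property.map e, fun Z => Z.property.map e',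
    CategoryTheory.Equivalence.mk _ _
      (NatIso.ofComponents (fun Y => ObjectProperty.isoMk _ (@asIso _ _ _ _ _ (h₁ Y)))
        fun {Y Y'} f => ?_)
      (NatIso.ofComponents (fun Z => ObjectProperty.isoMk _ (@asIso _ _ _ _ _ (h₂ Z)))
        fun {Z Z'} f => ?_), rfl, rfl⟩
  · apply ObjectProperty.hom_ext
    exact adj.unit.naturality f.hom
  · apply ObjectProperty.hom_ext
    exact adj.counit.naturality f.hom

end

/-! ### The three additive closures and the induced equivalences -/

section

variable {k : Type u} [CommRing k] {d n : ℕ}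

lemma addClosure_gammaL :
    addClosure (fun l : SeqSum n d => GammaL k l) =
      IsSummand (tensorShift (freeObj k d n) (GammaRep k d)) :=
  addClosure_eq_isSummand _ gamIn gamOut gamIn_gamOut sum_gamOut_gamIn

lemma addClosure_extL :
    addClosure (fun l : SeqSum n d => ExtL k l) =
      IsSummand (tensorShift (freeObj k d n) (ExtRep k d)) :=
  addClosure_eq_isSummand (fun l : SeqSum n d => ExtL k l) (extFamily k).incl (extFamily k).out
    (extFamily k).incl_out (extFamily k).sum_out_incl

lemma addClosure_symL :
    addClosure (fun l : SeqSum n d => SymL k l) =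
      IsSummand (tensorShift (freeObj k d n) (SymRep k d)) :=
  addClosure_eq_isSummand (fun l : SeqSum n d => SymL k l) (symFamily k).incl (symFamily k).out
    (symFamily k).incl_out (symFamily k).sum_out_incl

/-- A left adjoint preserves binary coproducts, hence biproducts. -/
lemma additive_tensor (hd : 1 ≤ d) (X : RepGam k d) : ((internalTensor k d).obj X).Additive := by
  have := (tensorHomAdj hd X).isLeftAdjoint
  have : PreservesColimitsOfSize.{0, 0} ((internalTensor k d).obj X) :=
    (tensorHomAdj hd X).leftAdjoint_preservesColimits
  have : PreservesBinaryBiproducts ((internalTensor k d).obj X) :=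
    preservesBinaryBiproducts_of_preservesBinaryCoproducts _
  exact Functor.additive_of_preservesBinaryBiproducts _

lemma Bil.IsPerfect.induceEquivalence (hd : 1 ≤ d) {X Y Z : RepGam k d} {b : Bil X Y Z}
    (hb : b.IsPerfect) :
    InduceEquivalence ((internalTensor k d).obj X) ((internalHom k d).obj (op X))
      (IsSummand Y) (IsSummand Z) := by
  have := additive_tensor hd X
  have : ((internalHom k d).obj (op X)).Additive := (tensorHomAdj hd X).right_adjoint_additive
  obtain ⟨⟨e⟩, ⟨e'⟩, h, h'⟩ := hb.main hd
  exact induceEquivalence_isSummand (tensorHomAdj hd X) e e' h h'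

end

end StrictPoly

end

theorem mainTheorem11 (k : Type u) [CommRing k] (d n : ℕ) (hd : 1 ≤ d) (hn : 1 ≤ n) :
    InduceEquivalence
        ((internalTensor k d).obj (ExtRep k d)) ((internalHom k d).obj (op (ExtRep k d)))
        (addClosure fun l : SeqSum n d => GammaL k l) (addClosure fun l : SeqSum n d => ExtL k l) ∧
      InduceEquivalence
        ((internalTensor k d).obj (ExtRep k d)) ((internalHom k d).obj (op (ExtRep k d)))
        (addClosure fun l : SeqSum n d => ExtL k l) (addClosure fun l : SeqSum n d => SymL k l) := by
  rw [addClosure_gammaL, addClosure_extL, addClosure_symL]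
  exact ⟨((gammaBil_isPerfect hd).shift (freeObj k d n)).induceEquivalence hd,
    (detBil_isPerfect.shift (freeObj k d n)).induceEquivalence hd⟩
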